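/- Let $p$ be a prime, $K$ a field of characteristic $p$, $n\ge 1$ and $q\in K$. Put $\tau=(p-1,\dots,p-1)\in\mathbb{N}^n$ and let $\epsilon_i$ be the $i$-th unit multi-index. Let $\mathcal O(n;\underline 1)$ be the restricted divided power algebra over $K$, with basis $x^{(\alpha)}$ ($\alpha\in\mathbb N^n$, $0\le\alpha\le\tau$) and product $x^{(\alpha)}x^{(\beta)}=\prod_i\binom{\alpha_i+\beta_i}{\alpha_i}\,x^{(\alpha+\beta)}$, where $x^{(\gamma)}=0$ unless $0\le\gamma\le\tau$; let $D_i$ be its derivation with $D_i x^{(\alpha)}=x^{(\alpha-\epsilon_i)}$. Let $W(n;\underline 1)=\mathrm{Der}_K\,\mathcal O(n;\underline 1)$ be the Jacobson–Witt algebra, which is spanned by the elements $x^{(\alpha)}D_i$, let $u(W(n;\underline 1))$ be the quotient of $U(W(n;\underline 1))$ by the ideal generated by the elements $(x^{(\epsilon_i)}D_i)^p-x^{(\epsilon_i)}D_i$ and $(x^{(\alpha)}D_i)^p$ with $0\le\alpha\le\tau$, $\alpha\neq\epsilon_i$, and put $$R=K[t]/(t^p-qt),\qquad u_{t,q}=u(W(n;\underline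 1))\otimes_K R ,$$ an $R$-algebra. It has the standard coproduct $\Delta_0$ and counit $\varepsilon_0$ over $R$, with $\Delta_0(w)=w\otimes1+1\otimes w$ and $\varepsilon_0(w)=0$ for $w\in W(n;\underline 1)$; below, $\otimes$ between elements of $u_{t,q}$ is over $R$. For $1\le k\le n$ let $h(k)=x^{(\epsilon_k)}D_k$ and $e(k)=2x^{(2\epsilon_k)}D_k$; then $e(k)^p=0$ in $u_{t,q}$, so $1-e(k)t$ is invertible. Write $y_a^{\langle m\rangle}=(y+a)(y+a+1)\cdots(y+a+m-1)$, $y^{\langle m\rangle}=y_0^{\langle m\rangle}$, $y^{[m]}=y(y-1)\cdots(y-m+1)$, and, for $0\le\ell\le p-1$, $d_k^{(\ell)}=\frac1{\ell!}(\mathrm{ad}\,e(k))^\ell$ on $W(n;\underline 1)$. For a multi-index $m$ with $0\le m\le\tau$ put $|m|=\sum_k m_k$, $h(I)_a^{\langle m\rangle}=\prod_k h(k)_a^{\langle m_k\rangle}$, $h(I)^{\langle m\rangle}=h(I)_0^{\langle m\rangle}$, $d_I^{(m)}=\prod_k d_k^{(m_k)}$, and for $c\in\mathbb Z^n$ put $(1-e(I)t)^{c}=\prod_k(1-e(k)t)^{c_k}$.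 For $\eta\in\{0,1\}^n$ let $\eta\tau=(\eta_k(p-1))_k$, let $\eta(\alpha-\delta_{iI})\in\mathbb Z^n$ have the components $\eta_k(\alpha_k-\delta_{ik})$, and let $$\mathcal F(k)=\sum_{r=0}^{p-1}\frac{(-1)^r}{r!}\,h(k)^{[r]}\otimes e(k)^r t^r,\qquad \mathcal F^{\eta}=\mathcal F(1)^{\eta_1}\cdots\mathcal F(n)^{\eta_n}.$$ **Theorem.** For every $\eta\in\{0,1\}^n$ there is a Hopf algebra structure $(\Delta_\eta,S_\eta,\varepsilon_\eta)$ over $R$ on the algebra $u_{t,q}$ (with its algebra structure unchanged) such that for all $0\le\alpha\le\tau$ and $1\le i\le n$ $$\Delta_\eta(x^{(\alpha)}D_i)=x^{(\alpha)}D_i\otimes(1-e(I)t)^{\eta(\alpha-\delta_{iI})}+\sum_{0\le m\le\eta\tau}(-1)^{|m|}\,h(I)^{\langle m\rangle}\otimes(1-e(I)t)^{-m}\,d_I^{(m)}(x^{(\alpha)}D_i)\,t^{|m|},$$ $$S_\eta(x^{(\alpha)}D_i)=-(1-e(I)t)^{-\eta(\alpha-\delta_{iI})}\sum_{0\le m\le\eta\tau}d_I^{(m)}(x^{(\alpha)}D_i)\,h(I)_1^{\langle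 m\rangle}\,t^{|m|},\qquad \varepsilon_\eta(x^{(\alpha)}D_i)=0 .$$ Moreover $\mathcal F^\eta$ is invertible and is a Drinfel'd twist for the standard structure, that is, $$(\mathcal F^\eta\otimes1)(\Delta_0\otimes\mathrm{id})(\mathcal F^\eta)=(1\otimes\mathcal F^\eta)(\mathrm{id}\otimes\Delta_0)(\mathcal F^\eta),\qquad(\varepsilon_0\otimes\mathrm{id})(\mathcal F^\eta)=1=(\mathrm{id}\otimes\varepsilon_0)(\mathcal F^\eta),$$ and $\Delta_\eta(a)=\mathcal F^\eta\,\Delta_0(a)\,(\mathcal F^\eta)^{-1}$ for all $a\in u_{t,q}$. The algebra $u_{t,q}$ is noncommutative and $\dim_K u_{t,q}=p^{1+np^n}$. If $p$ is odd, then the coproducts $\Delta_\eta$ are pairwise distinct and $\Delta_\eta$ is noncocommutative for every $\eta\ne0$, so that one obtains $2^n-1$ noncommutative and noncocommutative Hopf algebra structures. -/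

import Mathlib

open scoped TensorProduct

noncomputable section

/-! ### The restricted divided power algebra -/

/-- The restricted divided power algebra `O(n;1)` over `K`, with `K`-basis `x^(α)`,
`0 ≤ α ≤ τ = (p-1, …, p-1)`. An element is given by its coefficients in this basis. -/
@[ext] structure RDP (n p : ℕ) (K : Type*) where
  /-- the coefficient of `x^(γ)` -/
  coeff : (Fin n → Fin p) → K

namespace RDP

variable {n p : ℕ} {K : Type*}

theorem coeff_injective : Function.Injective (coeff : RDP n p K → _) := fun _ _ => RDP.ext

instance [Field K] : Zero (RDP n p K) := ⟨⟨0⟩⟩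
instance [Field K] : Add (RDP n p K) := ⟨fun f g => ⟨f.coeff + g.coeff⟩⟩
instance [Field K] : Neg (RDP n p K) := ⟨fun f => ⟨-f.coeff⟩⟩
instance [Field K] : Sub (RDP n p K) := ⟨fun f g => ⟨f.coeff - g.coeff⟩⟩
instance [Field K] : SMul ℕ (RDP n p K) := ⟨fun m f => ⟨m • f.coeff⟩⟩
instance [Field K] : SMul ℤ (RDP n p K) := ⟨fun m f => ⟨m • f.coeff⟩⟩
instance [Field K] : SMul K (RDP n p K) := ⟨fun c f => ⟨c • f.coeff⟩⟩

instance [Field K] : AddCommGroup (RDP n p K) :=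
  coeff_injective.addCommGroup _ rfl (fun _ _ => rfl) (fun _ => rfl) (fun _ _ => rfl)
    (fun _ _ => rfl) (fun _ _ => rfl)

instance [Field K] : Module K (RDP n p K) :=
  coeff_injective.module K ⟨⟨coeff, rfl⟩, fun _ _ => rfl⟩ fun _ _ => rfl

/-- The divided power monomial `x^(α)`; it is `0` unless `α ≤ τ`. -/
def dpow (n p : ℕ) (K : Type*) [Field K] (α : Fin n → ℕ) : RDP n p K :=
  ⟨fun γ => if ∀ i, (γ i : ℕ) = α i then 1 else 0⟩

/-- The multiplication, `x^(α) x^(β) = (∏ i, binom (α i + β i) (α i)) x^(α+β)`, extended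
bilinearly: the coefficient of `x^(γ)` in a product collects the pairs with `α + β = γ`. -/
instance [Field K] : Mul (RDP n p K) where
  mul f g := ⟨fun γ => ∑ α : Fin n → Fin p, ∑ β : Fin n → Fin p,
    if ∀ i, (α i : ℕ) + β i = γ i then
      ((∏ i, Nat.choose (γ i) (α i) : ℕ) : K) * (f.coeff α * g.coeff β) else 0⟩

instance [Field K] : One (RDP n p K) := ⟨dpow n p K 0⟩

variable [Field K]

@[simp] theorem add_apply (f g : RDP n p K) (γ) : (f + g).coeff γ = f.coeff γ + g.coeff γ := rfl
@[simp] theorem zero_apply (γ) : (0 : RDP n p K).coeff γ = 0 := rfl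
@[simp] theorem smul_apply (c : K) (f : RDP n p K) (γ) : (c • f).coeff γ = c * f.coeff γ := rfl
theorem one_def : (1 : RDP n p K) = dpow n p K 0 := rfl

theorem mul_apply (f g : RDP n p K) (γ) : (f * g).coeff γ =
    ∑ α : Fin n → Fin p, ∑ β : Fin n → Fin p,
    if ∀ i, (α i : ℕ) + β i = γ i then
      ((∏ i, Nat.choose (γ i) (α i) : ℕ) : K) * (f.coeff α * g.coeff β) else 0 := rfl

theorem add_mul' (f g h : RDP n p K) : (f + g) * h = f * h + g * h := by
  ext γ
  simp only [mul_apply, add_apply, ← Finset.sum_add_distrib]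
  refine Finset.sum_congr rfl fun α _ => Finset.sum_congr rfl fun β _ => ?_
  split_ifs <;> ring

theorem mul_add' (f g h : RDP n p K) : f * (g + h) = f * g + f * h := by
  ext γ
  simp only [mul_apply, add_apply, ← Finset.sum_add_distrib]
  refine Finset.sum_congr rfl fun α _ => Finset.sum_congr rfl fun β _ => ?_
  split_ifs <;> ring

theorem smul_mul' (c : K) (f g : RDP n p K) : (c • f) * g = c • (f * g) := by
  ext γ
  simp only [mul_apply, smul_apply, Finset.mul_sum]
  refine Finset.sum_congr rfl fun α _ => Finset.sum_congr rfl fun β _ => ?_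
  split_ifs <;> ring

theorem mul_smul' (c : K) (f g : RDP n p K) : f * (c • g) = c • (f * g) := by
  ext γ
  simp only [mul_apply, smul_apply, Finset.mul_sum]
  refine Finset.sum_congr rfl fun α _ => Finset.sum_congr rfl fun β _ => ?_
  split_ifs <;> ring

theorem dpow_fin (α : Fin n → Fin p) (γ) :
    (dpow n p K (fun i => (α i : ℕ))).coeff γ = if γ = α then 1 else 0 := by
  simp only [dpow, funext_iff, Fin.ext_iff]

theorem dpow_eq_zero {α : Fin n → ℕ} (h : ¬ ∀ i, α i < p) : dpow n p K α = 0 := by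
  ext γ
  simp only [dpow, zero_apply, ite_eq_right_iff, one_ne_zero, imp_false]
  exact fun h' => h fun i => h' i ▸ (γ i).2

theorem eq_sum (f : RDP n p K) :
    f = ∑ α : Fin n → Fin p, f.coeff α • dpow n p K (fun i => (α i : ℕ)) := by
  ext γ
  have : ∀ s : Finset (Fin n → Fin p),
      (∑ α ∈ s, f.coeff α • dpow n p K (fun i => (α i : ℕ))).coeff γ =
      ∑ α ∈ s, f.coeff α * (dpow n p K (fun i => (α i : ℕ))).coeff γ := by
    intro s
    induction s using Finset.cons_induction with
    | empty => simp
    | cons a s ha ih => rw [Finset.sum_cons, Finset.sum_cons, add_apply, ih, smul_apply]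
  rw [this, Finset.sum_eq_single γ] <;> simp +contextual [dpow_fin, eq_comm]

theorem induction_on {P : RDP n p K → Prop} (f : RDP n p K)
    (hd : ∀ α : Fin n → ℕ, (∀ i, α i < p) → P (dpow n p K α))
    (h0 : P 0) (ha : ∀ f g, P f → P g → P (f + g)) (hs : ∀ (c : K) f, P f → P (c • f)) : P f := by
  rw [eq_sum f]
  exact Finset.sum_induction _ P ha h0 fun α _ => hs _ _ (hd _ fun i => (α i).2)

theorem dpow_mul_dpow {a b : Fin n → ℕ} (ha : ∀ i, a i < p) (hb : ∀ i, b i < p) :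
    dpow n p K a * dpow n p K b =
      ((∏ i, Nat.choose (a i + b i) (a i) : ℕ) : K) • dpow n p K (a + b) := by
  ext γ
  rw [mul_apply, Finset.sum_eq_single (fun i => (⟨a i, ha i⟩ : Fin p)),
    Finset.sum_eq_single (fun i => (⟨b i, hb i⟩ : Fin p))]
  · simp only [dpow, smul_apply, implies_true, if_true, Pi.add_apply]
    by_cases h : ∀ i, a i + b i = (γ i : ℕ)
    · rw [if_pos h, if_pos fun i => (h i).symm]
      simp [h]
    · rw [if_neg h, if_neg fun h' => h fun i => (h' i).symm, mul_zero]
  · intro β _ hβ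
    have : (dpow n p K b).coeff β = 0 := by
      simp only [dpow]
      rw [if_neg]
      exact fun h => hβ (funext fun i => Fin.ext (h i))
    simp [this]
  · simp
  · intro α _ hα
    have : (dpow n p K a).coeff α = 0 := by
      simp only [dpow]
      rw [if_neg]
      exact fun h => hα (funext fun i => Fin.ext (h i))
    simp [this]
  · simp

theorem mul_comm' (f g : RDP n p K) : f * g = g * f := by
  ext γ
  rw [mul_apply, mul_apply, Finset.sum_comm]
  refine Finset.sum_congr rfl fun β _ => Finset.sum_congr rfl fun α _ => ?_
  by_cases h : ∀ i, (α i : ℕ) + β i = γ i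
  · rw [if_pos h, if_pos fun i => (add_comm _ _).trans (h i), mul_comm (f.coeff α)]
    congr 2
    refine Finset.prod_congr rfl fun i _ => ?_
    rw [← h i, Nat.choose_symm_add]
  · rw [if_neg h, if_neg fun h' => h fun i => (add_comm _ _).trans (h' i)]

theorem zero_mul' (f : RDP n p K) : 0 * f = 0 := by
  ext γ; simp [mul_apply]

theorem mul_zero' (f : RDP n p K) : f * 0 = 0 := by
  ext γ; simp [mul_apply]

theorem one_mul' [NeZero p] (f : RDP n p K) : 1 * f = f := by
  induction f using induction_on with
  | h0 => exact mul_zero' _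
  | ha f g hf hg => rw [mul_add', hf, hg]
  | hs c f hf => rw [mul_smul', hf]
  | hd α hα =>
    have h0 : ∀ i, (0 : Fin n → ℕ) i < p := fun _ => Nat.pos_of_ne_zero (NeZero.ne p)
    rw [one_def, dpow_mul_dpow h0 hα]
    simp only [Pi.zero_apply, zero_add, Nat.choose_zero_right, Finset.prod_const_one,
      Nat.cast_one, one_smul]

theorem dpow_mul_dpow' {a b : Fin n → ℕ} :
    dpow n p K a * dpow n p K b =
      ((∏ i, Nat.choose (a i + b i) (a i) : ℕ) : K) • dpow n p K (a + b) := by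
  by_cases ha : ∀ i, a i < p
  · by_cases hb : ∀ i, b i < p
    · exact dpow_mul_dpow ha hb
    · rw [dpow_eq_zero hb, dpow_eq_zero (α := a + b) fun h => hb fun i =>
          lt_of_le_of_lt (by simp) (h i),
        mul_zero', smul_zero]
  · rw [dpow_eq_zero ha, dpow_eq_zero (α := a + b) fun h => ha fun i =>
          lt_of_le_of_lt (by simp) (h i),
        zero_mul', smul_zero]

theorem mul_assoc' (f g h : RDP n p K) : f * g * h = f * (g * h) := by
  induction f using induction_on with
  | h0 => simp [zero_mul']
  | ha f f' h1 h2 => simp only [add_mul', h1, h2]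
  | hs c f h1 => simp only [smul_mul', h1]
  | hd a _ =>
  induction g using induction_on with
  | h0 => simp [zero_mul', mul_zero']
  | ha f f' h1 h2 => simp only [add_mul', mul_add', h1, h2]
  | hs c f h1 => simp only [smul_mul', mul_smul', h1]
  | hd b _ =>
  induction h using induction_on with
  | h0 => simp [mul_zero']
  | ha f f' h1 h2 => simp only [mul_add', h1, h2]
  | hs c f h1 => simp only [mul_smul', h1]
  | hd c _ =>
  simp only [dpow_mul_dpow', smul_mul', mul_smul', smul_smul, ← Nat.cast_mul,
    ← Finset.prod_mul_distrib, add_assoc, Pi.add_apply]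
  congr 2
  refine Finset.prod_congr rfl fun i _ => ?_
  have := Nat.choose_mul (n := a i + b i + c i) (k := a i + b i) (s := a i)
  rw [show a i + b i + c i - a i = b i + c i by omega,
    show a i + b i - a i = b i by omega, add_assoc] at this
  rw [mul_comm, this (by omega), mul_comm]

/-- The linear map with `x^(α) ↦ x^(α - ε_i)` (which is `0` when `α i = 0`). -/
def partialLin (n p : ℕ) (K : Type*) [Field K] (i : Fin n) : RDP n p K →ₗ[K] RDP n p K where
  toFun f := ⟨fun γ =>
    if h : (γ i : ℕ) + 1 < p then f.coeff (Function.update γ i ⟨γ i + 1, h⟩) else 0⟩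
  map_add' f g := by
    ext γ; simp only [add_apply]; split_ifs <;> simp
  map_smul' c f := by
    ext γ; simp only [smul_apply, RingHom.id_apply]; split_ifs <;> simp

theorem partialLin_dpow (i : Fin n) {a : Fin n → ℕ} (ha : ∀ j, a j < p) :
    partialLin n p K i (dpow n p K a) =
      if a i = 0 then 0 else dpow n p K (a - Pi.single i 1) := by
  ext γ
  have key : (∀ j, (γ j : ℕ) = (a - Pi.single i 1 : Fin n → ℕ) j) ∧ a i ≠ 0 ↔
      ∀ j, (if j = i then (γ i : ℕ) + 1 else γ j) = a j := by
    constructor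
    · rintro ⟨h, h0⟩ j
      by_cases hj : j = i
      · subst hj
        have := h j
        simp at this ⊢
        omega
      · have := h j
        simp [hj] at this ⊢
        exact this
    · intro h
      have hi := h i
      simp at hi
      refine ⟨fun j => ?_, by omega⟩
      by_cases hj : j = i
      · subst hj
        simp
        omega
      · have := h j
        simp [hj] at this ⊢
        exact this
  have lhs : (partialLin n p K i (dpow n p K a)).coeff γ =
      if ∀ j, (if j = i then (γ i : ℕ) + 1 else γ j) = a j then 1 else 0 := by
    simp only [partialLin, LinearMap.coe_mk, AddHom.coe_mk, dpow]
    by_cases h : (γ i : ℕ) + 1 < p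
    · rw [dif_pos h]
      congr 1
      refine propext (forall_congr' fun j => ?_)
      by_cases hj : j = i
      · subst hj; simp
      · simp [hj]
    · rw [dif_neg h, if_neg]
      intro h'
      have := h' i
      simp at this
      exact h (this ▸ ha i)
  rw [lhs]
  by_cases h0 : a i = 0
  · rw [if_pos h0, if_neg, zero_apply]
    exact fun h => (key.2 h).2 h0
  · rw [if_neg h0, dpow]
    congr 1
    rw [← key]
    simp [h0]

variable [Fact p.Prime]

instance : CommRing (RDP n p K) where
  __ := (inferInstance : AddCommGroup (RDP n p K))
  left_distrib := mul_add'
  right_distrib := add_mul'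
  zero_mul := zero_mul'
  mul_zero := mul_zero'
  mul_assoc := mul_assoc'
  one_mul := one_mul'
  mul_one f := by rw [mul_comm', one_mul']
  mul_comm := mul_comm'

instance : Algebra K (RDP n p K) := Algebra.ofModule smul_mul' mul_smul'

theorem partialLin_leibniz [CharP K p] (i : Fin n) (f g : RDP n p K) :
    partialLin n p K i (f * g) = f • partialLin n p K i g + g • partialLin n p K i f := by
  simp only [smul_eq_mul]
  induction f using induction_on with
  | h0 => simp
  | ha f f' h1 h2 => simp only [add_mul, map_add, h1, h2, mul_add]; abel
  | hs c f h1 => simp only [smul_mul_assoc, map_smul, h1, mul_smul_comm, smul_add]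
  | hd a ha =>
  induction g using induction_on with
  | h0 => simp
  | ha f f' h1 h2 => simp only [add_mul, map_add, h1, h2, mul_add]; abel
  | hs c f h1 => simp only [smul_mul_assoc, map_smul, h1, mul_smul_comm, smul_add]
  | hd b hb =>
  rw [partialLin_dpow i ha, partialLin_dpow i hb, dpow_mul_dpow', map_smul]
  have hl : ((∏ j, Nat.choose (a j + b j) (a j) : ℕ) : K) • partialLin n p K i (dpow n p K (a + b))
      = ((∏ j, Nat.choose (a j + b j) (a j) : ℕ) : K) •
        if a i + b i = 0 then 0 else dpow n p K (a + b - Pi.single i 1) := by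
    by_cases h : ∀ j, (a + b) j < p
    · rw [partialLin_dpow i h]; rfl
    · push Not at h
      obtain ⟨j, hj⟩ := h
      have : ((∏ j, Nat.choose (a j + b j) (a j) : ℕ) : K) = 0 := by
        rw [CharP.cast_eq_zero_iff K p]
        refine dvd_trans ?_ (Finset.dvd_prod_of_mem _ (Finset.mem_univ j))
        exact (Fact.out : p.Prime).dvd_choose_add (ha j) (hb j) hj
      rw [this, zero_smul, zero_smul]
  rw [hl]
  have split : ∀ c : Fin n → ℕ, ∏ j, c j = c i * ∏ j ∈ Finset.univ.erase i, c j := fun c =>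
    (Finset.mul_prod_erase _ _ (Finset.mem_univ i)).symm
  have e1 : a i ≠ 0 → dpow n p K b * dpow n p K (a - Pi.single i 1) =
      ((Nat.choose (a i + b i - 1) (a i - 1) * ∏ j ∈ Finset.univ.erase i,
        Nat.choose (a j + b j) (a j) : ℕ) : K) • dpow n p K (a + b - Pi.single i 1) := by
    intro h
    have hs : a - Pi.single i 1 + b = a + b - Pi.single i 1 := by
      ext j
      by_cases hj : j = i
      · subst hj; simp; omega
      · simp [hj]
    rw [mul_comm, dpow_mul_dpow', split, hs]
    congr 3
    · simp; congr 1; omega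
    · refine Finset.prod_congr rfl fun j hj => ?_
      simp [Finset.ne_of_mem_erase hj]
  have e2 : b i ≠ 0 → dpow n p K a * dpow n p K (b - Pi.single i 1) =
      ((Nat.choose (a i + b i - 1) (a i) * ∏ j ∈ Finset.univ.erase i,
        Nat.choose (a j + b j) (a j) : ℕ) : K) • dpow n p K (a + b - Pi.single i 1) := by
    intro h
    have hs : a + (b - Pi.single i 1) = a + b - Pi.single i 1 := by
      ext j
      by_cases hj : j = i
      · subst hj; simp; omega
      · simp [hj]
    rw [dpow_mul_dpow', split, hs]
    congr 3
    · simp; congr 1; omega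
    · refine Finset.prod_congr rfl fun j hj => ?_
      simp [Finset.ne_of_mem_erase hj]
  rw [split]
  by_cases h1 : a i = 0
  · by_cases h2 : b i = 0
    · simp [h1, h2]
    · rw [if_neg (by omega), if_neg h2, if_pos h1, e2 h2, mul_zero, add_zero]
      simp [h1]
  · by_cases h2 : b i = 0
    · rw [if_neg (by omega), if_neg h1, if_pos h2, e1 h1, mul_zero, zero_add]
      simp [h2]
    · rw [if_neg (by omega), if_neg h1, if_neg h2, e1 h1, e2 h2, ← add_smul, ← Nat.cast_add,
        ← add_mul]
      congr 3
      obtain ⟨s, hs⟩ : ∃ s, a i = s + 1 := ⟨a i - 1, by omega⟩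
      rw [hs, show s + 1 + b i = (s + b i) + 1 by omega, Nat.choose_succ_succ]
      simp [add_comm]

/-- The partial derivative `D_i` as a derivation of `O(n;1)`: `D_i x^(α) = x^(α - ε_i)`. -/
def partialDer (n p : ℕ) (K : Type*) [Field K] [Fact p.Prime] [CharP K p] (i : Fin n) :
    Derivation K (RDP n p K) (RDP n p K) :=
  Derivation.mk' (partialLin n p K i) (partialLin_leibniz i)

end RDP

/-! ### The Jacobson-Witt algebra and its restricted enveloping algebra -/

/-- The Jacobson-Witt algebra `W(n;1) = Der_K (O(n;1))` with the commutator bracket. -/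
abbrev JW (n p : ℕ) (K : Type*) [Field K] [Fact p.Prime] : Type _ :=
  Derivation K (RDP n p K) (RDP n p K)

/-- The element `x^(α) D_i` of `W(n;1)`. -/
def xD (n p : ℕ) (K : Type*) [Field K] [Fact p.Prime] [CharP K p] (α : Fin n → ℕ) (i : Fin n) :
    JW n p K :=
  RDP.dpow n p K α • RDP.partialDer n p K i

section Restricted

attribute [local instance 100] LieRing.ofAssociativeRing

variable (n p : ℕ) (K : Type*) [Field K] [Fact p.Prime] [CharP K p]

/-- The generators of the ideal `I` of `U(W(n;1))`, as relations:
`(x^(ε_i) D_i)^p = x^(ε_i) D_i`, and `(x^(α) D_i)^p = 0` for `0 ≤ α ≤ τ`, `α ≠ ε_i`. -/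
inductive RestrRel :
    UniversalEnvelopingAlgebra K (JW n p K) → UniversalEnvelopingAlgebra K (JW n p K) → Prop
  | toral (i : Fin n) :
      RestrRel (UniversalEnvelopingAlgebra.ι K (xD n p K (Pi.single i 1) i) ^ p)
        (UniversalEnvelopingAlgebra.ι K (xD n p K (Pi.single i 1) i))
  | nil (α : Fin n → ℕ) (i : Fin n) (hα : ∀ j, α j < p) (h : α ≠ Pi.single i 1) :
      RestrRel (UniversalEnvelopingAlgebra.ι K (xD n p K α i) ^ p) 0

/-- The restricted enveloping algebra `u(W(n;1)) = U(W(n;1)) / I`. -/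
def RestrEnv : Type _ := RingQuot (RestrRel n p K)

instance : Ring (RestrEnv n p K) := inferInstanceAs (Ring (RingQuot (RestrRel n p K)))

instance : Algebra K (RestrEnv n p K) := inferInstanceAs (Algebra K (RingQuot (RestrRel n p K)))

namespace RestrEnv

/-- The quotient map `U(W(n;1)) → u(W(n;1))`. -/
def mk : UniversalEnvelopingAlgebra K (JW n p K) →ₐ[K] RestrEnv n p K :=
  RingQuot.mkAlgHom K (RestrRel n p K)

/-- The canonical map `W(n;1) → u(W(n;1))`. -/
def ι : JW n p K →ₗ[K] RestrEnv n p K :=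
  (mk n p K).toLinearMap ∘ₗ
    (UniversalEnvelopingAlgebra.ι K : JW n p K →ₗ⁅K⁆ _).toLinearMap

theorem ι_apply (x : JW n p K) : ι n p K x = mk n p K (UniversalEnvelopingAlgebra.ι K x) := rfl

theorem ι_lie (x y : JW n p K) :
    ι n p K ⁅x, y⁆ = ι n p K x * ι n p K y - ι n p K y * ι n p K x := by
  simp only [ι_apply, LieHom.map_lie, LieRing.of_associative_ring_bracket, map_sub, map_mul]

theorem ι_toral (i : Fin n) :
    ι n p K (xD n p K (Pi.single i 1) i) ^ p = ι n p K (xD n p K (Pi.single i 1) i) := by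
  rw [ι_apply, ← map_pow]
  exact RingQuot.mkAlgHom_rel K (RestrRel.toral i)

theorem ι_nil (α : Fin n → ℕ) (i : Fin n) (h : α ≠ Pi.single i 1) :
    ι n p K (xD n p K α i) ^ p = 0 := by
  by_cases hα : ∀ j, α j < p
  · rw [ι_apply, ← map_pow, ← map_zero (mk n p K)]
    exact RingQuot.mkAlgHom_rel K (RestrRel.nil α i hα h)
  · rw [xD, RDP.dpow_eq_zero hα, zero_smul, map_zero, zero_pow (Fact.out : p.Prime).ne_zero]

variable {n p K}

theorem hom_ext {B : Type*} [Ring B] [Algebra K B] {f g : RestrEnv n p K →ₐ[K] B}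
    (h : ∀ x, f (ι n p K x) = g (ι n p K x)) : f = g := by
  refine RingQuot.ringQuot_ext' K (s := RestrRel n p K) f g
    (UniversalEnvelopingAlgebra.hom_ext K ?_)
  ext1 x
  exact h x

/-- The universal property of `u(W(n;1))`. -/
def lift {B : Type*} [Ring B] [Algebra K B] (f : JW n p K →ₗ[K] B)
    (hlie : ∀ x y, f ⁅x, y⁆ = f x * f y - f y * f x)
    (htoral : ∀ i, f (xD n p K (Pi.single i 1) i) ^ p = f (xD n p K (Pi.single i 1) i))
    (hnil : ∀ α i, α ≠ Pi.single i 1 → f (xD n p K α i) ^ p = 0) : RestrEnv n p K →ₐ[K] B :=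
  RingQuot.liftAlgHom K ⟨UniversalEnvelopingAlgebra.lift K
    { f with
      map_lie' := fun {x y} => (hlie x y).trans (LieRing.of_associative_ring_bracket _ _).symm },
    by
    intro x y h
    cases h with
    | toral i =>
      simp only [map_pow, UniversalEnvelopingAlgebra.lift_ι_apply]
      exact htoral i
    | nil α i hα h =>
      simp only [map_pow, UniversalEnvelopingAlgebra.lift_ι_apply, map_zero]
      exact hnil α i h⟩

theorem lift_ι {B : Type*} [Ring B] [Algebra K B] (f : JW n p K →ₗ[K] B) (h1 h2 h3)
    (x : JW n p K) : lift f h1 h2 h3 (ι n p K x) = f x := by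
  rw [ι_apply, mk, lift]
  erw [RingQuot.liftAlgHom_mkAlgHom_apply]
  rw [UniversalEnvelopingAlgebra.lift_ι_apply]
  rfl

/-- The standard counit `ε₀`, with `ε₀(w) = 0` for `w ∈ W(n;1)`. -/
def counit : RestrEnv n p K →ₐ[K] K :=
  lift 0 (by simp) (by simp [(Fact.out : p.Prime).ne_zero]) (by simp [(Fact.out : p.Prime).ne_zero])

variable (n p K) in
/-- The linear map `w ↦ w ⊗ 1 + 1 ⊗ w`. -/
def comulLin : JW n p K →ₗ[K] RestrEnv n p K ⊗[K] RestrEnv n p K where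
  toFun x := ι n p K x ⊗ₜ 1 + 1 ⊗ₜ ι n p K x
  map_add' x y := by simp only [map_add, TensorProduct.add_tmul, TensorProduct.tmul_add]; abel
  map_smul' c x := by
    simp only [map_smul, TensorProduct.smul_tmul', TensorProduct.tmul_smul, smul_add,
      RingHom.id_apply]

theorem comulLin_pow (x : JW n p K) :
    comulLin n p K x ^ p = (ι n p K x ^ p) ⊗ₜ 1 + 1 ⊗ₜ (ι n p K x ^ p) := by
  rcases subsingleton_or_nontrivial (RestrEnv n p K ⊗[K] RestrEnv n p K) with h | h
  · exact Subsingleton.elim _ _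
  · have : CharP (RestrEnv n p K ⊗[K] RestrEnv n p K) p :=
      charP_of_injective_algebraMap (algebraMap K _).injective p
    simp only [comulLin, LinearMap.coe_mk, AddHom.coe_mk]
    rw [add_pow_char_of_commute]
    · simp [Algebra.TensorProduct.tmul_pow]
    · simp [Commute, SemiconjBy]

/-- The standard coproduct `Δ₀`, with `Δ₀(w) = w ⊗ 1 + 1 ⊗ w` for `w ∈ W(n;1)`. -/
def comul : RestrEnv n p K →ₐ[K] RestrEnv n p K ⊗[K] RestrEnv n p K :=
  lift (comulLin n p K)
    (by
      intro x y
      simp only [comulLin, LinearMap.coe_mk, AddHom.coe_mk, ι_lie, mul_add, add_mul,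
        Algebra.TensorProduct.tmul_mul_tmul, mul_one, one_mul, TensorProduct.sub_tmul,
        TensorProduct.tmul_sub]
      abel)
    (by
      intro i
      rw [comulLin_pow, ι_toral]; rfl)
    (by
      intro α i h
      rw [comulLin_pow, ι_nil n p K α i h]; simp)

theorem comul_ι (x : JW n p K) : comul (ι n p K x) = ι n p K x ⊗ₜ 1 + 1 ⊗ₜ ι n p K x :=
  lift_ι _ _ _ _ x

theorem counit_ι (x : JW n p K) : counit (ι n p K x) = 0 :=
  lift_ι _ _ _ _ x

/-- The standard bialgebra structure on `u(W(n;1))`. -/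
instance : Bialgebra K (RestrEnv n p K) :=
  Bialgebra.ofAlgHom comul counit
    (hom_ext fun x => by
      simp [comul_ι, TensorProduct.add_tmul, TensorProduct.tmul_add, add_assoc,
        Algebra.TensorProduct.one_def])
    (hom_ext fun x => by simp [comul_ι, counit_ι])
    (hom_ext fun x => by simp [comul_ι, counit_ι])

end RestrEnv

end Restricted

/-! ### Hopf structures and Drinfel'd twists -/

section Hopf

variable (R A : Type*) [CommRing R] [Ring A] [Algebra R A]

/-- A Hopf algebra structure over `R` on a given `R`-algebra `A` (the algebra structure is kept). -/
structure HopfStructure where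
  /-- the coproduct -/
  comul : A →ₐ[R] A ⊗[R] A
  /-- the counit -/
  counit : A →ₐ[R] R
  /-- the antipode -/
  antipode : A →ₗ[R] A
  coassoc : (Algebra.TensorProduct.assoc R R R A A A).toAlgHom.comp
      ((Algebra.TensorProduct.map comul (.id R A)).comp comul) =
    (Algebra.TensorProduct.map (.id R A) comul).comp comul
  counit_left : (Algebra.TensorProduct.map counit (.id R A)).comp comul =
    (Algebra.TensorProduct.lid R A).symm
  counit_right : (Algebra.TensorProduct.map (.id R A) counit).comp comul =
    (Algebra.TensorProduct.rid R R A).symm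
  antipode_left : LinearMap.mul' R A ∘ₗ antipode.rTensor A ∘ₗ comul.toLinearMap =
    Algebra.linearMap R A ∘ₗ counit.toLinearMap
  antipode_right : LinearMap.mul' R A ∘ₗ antipode.lTensor A ∘ₗ comul.toLinearMap =
    Algebra.linearMap R A ∘ₗ counit.toLinearMap

variable {R A}

/-- A Hopf structure gives an instance of Mathlib's class of Hopf algebras. -/
abbrev HopfStructure.toHopfAlgebra (H : HopfStructure R A) : HopfAlgebra R A where
  __ := Bialgebra.ofAlgHom H.comul H.counit H.coassoc H.counit_left H.counit_right
  antipode := H.antipode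
  mul_antipode_rTensor_comul := H.antipode_left
  mul_antipode_lTensor_comul := H.antipode_right

/-- `H` is cocommutative: its coproduct is invariant under the flip of the tensor factors. -/
def HopfStructure.IsCocommutative (H : HopfStructure R A) : Prop :=
  ∀ a, Algebra.TensorProduct.comm R A A (H.comul a) = H.comul a

/-- An invertible `F` is a Drinfel'd twist for a coproduct `Δ₀` and a counit `ε₀` on `A`:
`(F ⊗ 1)(Δ₀ ⊗ id)(F) = (1 ⊗ F)(id ⊗ Δ₀)(F)` and `(ε₀ ⊗ id)(F) = 1 = (id ⊗ ε₀)(F)`. -/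
structure IsDrinfeldTwist (Δ₀ : A →ₐ[R] A ⊗[R] A) (ε₀ : A →ₐ[R] R) (F : (A ⊗[R] A)ˣ) : Prop where
  cocycle : Algebra.TensorProduct.assoc R R R A A A
      (((F : A ⊗[R] A) ⊗ₜ[R] (1 : A)) * Algebra.TensorProduct.map Δ₀ (.id R A) F) =
    ((1 : A) ⊗ₜ[R] (F : A ⊗[R] A)) * Algebra.TensorProduct.map (.id R A) Δ₀ F
  counit_left : Algebra.TensorProduct.lid R A (Algebra.TensorProduct.map ε₀ (.id R A) F) = 1
  counit_right : Algebra.TensorProduct.rid R R A (Algebra.TensorProduct.map (.id R A) ε₀ F) = 1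

end Hopf

/-- The rising factorial `x_a^⟨m⟩ = (x + a)(x + a + 1) ⋯ (x + a + m - 1)`. -/
def rising {A : Type*} [Ring A] (x : A) (a m : ℕ) : A :=
  ((List.range m).map fun j : ℕ => x + (a : A) + (j : A)).prod

/-- The falling factorial `x^[m] = x (x - 1) ⋯ (x - m + 1)`. -/
def falling {A : Type*} [Ring A] (x : A) (m : ℕ) : A :=
  ((List.range m).map fun j : ℕ => x - (j : A)).prod

/-! ### The algebra `u_{t,q}(W(n;1))` -/

/-- The `p`-truncated polynomial ring `K[t]/(t^p - q t)`. -/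
abbrev TruncPoly (p : ℕ) {K : Type*} [Field K] (q : K) : Type _ :=
  AdjoinRoot (Polynomial.X ^ p - Polynomial.C q * Polynomial.X : Polynomial K)

/-- The algebra `u_{t,q}(W(n;1)) = K[t]/(t^p - q t) ⊗_K u(W(n;1))` over `K[t]/(t^p - q t)`. -/
abbrev UTQ (n p : ℕ) {K : Type*} [Field K] [Fact p.Prime] [CharP K p] (q : K) : Type _ :=
  TruncPoly p q ⊗[K] RestrEnv n p K

namespace UTQ

variable (n p : ℕ) {K : Type*} [Field K] [Fact p.Prime] [CharP K p] (q : K)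

/-- The class of `t` in `K[t]/(t^p - q t)`. -/
def t : TruncPoly p q := AdjoinRoot.root _

/-- The canonical map `W(n;1) → u_{t,q}(W(n;1))`. -/
def ι : JW n p K →ₗ[K] UTQ n p q :=
  TensorProduct.mk K (TruncPoly p q) (RestrEnv n p K) 1 ∘ₗ RestrEnv.ι n p K

/-- The standard coproduct, with `Δ₀(w) = w ⊗ 1 + 1 ⊗ w` for `w ∈ W(n;1)`. -/
def comul₀ : UTQ n p q →ₐ[TruncPoly p q] UTQ n p q ⊗[TruncPoly p q] UTQ n p q :=
  Bialgebra.comulAlgHom (TruncPoly p q) (UTQ n p q)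

/-- The standard counit, with `ε₀(w) = 0` for `w ∈ W(n;1)`. -/
def counit₀ : UTQ n p q →ₐ[TruncPoly p q] TruncPoly p q :=
  Bialgebra.counitAlgHom (TruncPoly p q) (UTQ n p q)

theorem comul₀_ι (w : JW n p K) : comul₀ n p q (ι n p q w) =
    ι n p q w ⊗ₜ[TruncPoly p q] 1 + 1 ⊗ₜ[TruncPoly p q] ι n p q w := by
  have h : Bialgebra.comulAlgHom K (RestrEnv n p K) (RestrEnv.ι n p K w) =
      RestrEnv.ι n p K w ⊗ₜ 1 + 1 ⊗ₜ RestrEnv.ι n p K w := RestrEnv.comul_ι w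
  have h' : Bialgebra.comulAlgHom (TruncPoly p q) (TruncPoly p q) 1 = 1 ⊗ₜ 1 := map_one _
  rw [comul₀, Bialgebra.TensorProduct.comulAlgHom_def]
  simp only [ι, LinearMap.comp_apply, TensorProduct.mk_apply, AlgHom.comp_apply,
    Algebra.TensorProduct.map_tmul, h, h', TensorProduct.tmul_add, map_add]
  rfl

theorem counit₀_ι (w : JW n p K) : counit₀ n p q (ι n p q w) = 0 := by
  have h : Bialgebra.counitAlgHom K (RestrEnv n p K) (RestrEnv.ι n p K w) = 0 :=
    RestrEnv.counit_ι w
  rw [counit₀, Bialgebra.TensorProduct.counitAlgHom_def]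
  simp only [ι, LinearMap.comp_apply, TensorProduct.mk_apply, AlgHom.comp_apply,
    Algebra.TensorProduct.map_tmul, h, TensorProduct.tmul_zero, map_zero]

/-- `e(k) = 2 x^(2ε_k) D_k` in `W(n;1)`. -/
def eLie (n p : ℕ) (K : Type*) [Field K] [Fact p.Prime] [CharP K p] (k : Fin n) : JW n p K :=
  (2 : K) • xD n p K (Pi.single k 2) k

/-- `e(k) = 2 x^(2ε_k) D_k` in `u_{t,q}(W(n;1))`. -/
def e (k : Fin n) : UTQ n p q := ι n p q (eLie n p K k)

/-- `h(k) = x^(ε_k) D_k` in `u_{t,q}(W(n;1))`. -/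
def h (k : Fin n) : UTQ n p q := ι n p q (xD n p K (Pi.single k 1) k)

theorem e_pow (k : Fin n) : e n p q k ^ p = 0 := by
  have hk : (Pi.single k 2 : Fin n → ℕ) ≠ Pi.single k 1 := fun h => by
    simpa using congrFun h k
  have h0 : RestrEnv.ι n p K (eLie n p K k) ^ p = 0 := by
    rw [eLie, map_smul, smul_pow, RestrEnv.ι_nil n p K _ _ hk, smul_zero]
  simp only [e, ι, LinearMap.comp_apply, TensorProduct.mk_apply, Algebra.TensorProduct.tmul_pow,
    h0, TensorProduct.tmul_zero]

/-- The unit `1 - e(k) t`. -/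
def oneSub (k : Fin n) : (UTQ n p q)ˣ where
  val := 1 - t p q • e n p q k
  inv := ∑ j ∈ Finset.range p, (t p q • e n p q k) ^ j
  val_inv := by rw [mul_neg_geom_sum, smul_pow, e_pow, smul_zero, sub_zero]
  inv_val := by rw [geom_sum_mul_neg, smul_pow, e_pow, smul_zero, sub_zero]

/-- `(1 - e(I) t)^c = ∏ k, (1 - e(k) t)^(c k)`. -/
def oneSubPow (c : Fin n → ℤ) : (UTQ n p q)ˣ := (List.ofFn fun k => oneSub n p q k ^ c k).prod

/-- `h(I)_a^⟨m⟩ = ∏ k, h(k)_a^⟨m k⟩`. -/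
def hRising (a : ℕ) (m : Fin n → ℕ) : UTQ n p q :=
  (List.ofFn fun k => rising (h n p q k) a (m k)).prod

/-- `d_k^(ℓ) = (1/ℓ!) (ad e(k))^ℓ` on `W(n;1)`. -/
def divAd (n p : ℕ) (K : Type*) [Field K] [Fact p.Prime] [CharP K p] (k : Fin n) (ℓ : ℕ) :
    Module.End K (JW n p K) :=
  (Nat.factorial ℓ : K)⁻¹ • LieAlgebra.ad K (JW n p K) (eLie n p K k) ^ ℓ

/-- `d_I^(m) = ∏ k, d_k^(m k)` on `W(n;1)`. -/
def divAdI (n p : ℕ) (K : Type*) [Field K] [Fact p.Prime] [CharP K p] (m : Fin n → ℕ) :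
    Module.End K (JW n p K) :=
  (List.ofFn fun k => divAd n p K k (m k)).prod

/-- The basic twist `F(k) = ∑_{r<p} ((-1)^r / r!) h(k)^[r] ⊗ e(k)^r t^r`. -/
def basicTwist (k : Fin n) : UTQ n p q ⊗[TruncPoly p q] UTQ n p q :=
  ∑ r ∈ Finset.range p, algebraMap K (TruncPoly p q) ((-1) ^ r * (Nat.factorial r : K)⁻¹) •
    (falling (h n p q k) r ⊗ₜ[TruncPoly p q] (t p q ^ r • e n p q k ^ r))

/-- `F^η = F(1)^(η 1) ⋯ F(n)^(η n)`. -/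
def twist (η : Fin n → Fin 2) : UTQ n p q ⊗[TruncPoly p q] UTQ n p q :=
  (List.ofFn fun k => basicTwist n p q k ^ (η k : ℕ)).prod

/-- The exponents `η_k (α_k - δ_{ik})`. -/
def wt {n : ℕ} (η : Fin n → Fin 2) (α : Fin n → ℕ) (i : Fin n) : Fin n → ℤ :=
  fun k => ((η k : ℕ) : ℤ) * ((α k : ℤ) - if i = k then 1 else 0)

/-- The multi-indices `m = ηℓ` with `0 ≤ m ≤ ητ`, `τ = (p-1, …, p-1)`. -/
def indices {n : ℕ} (p : ℕ) (η : Fin n → Fin 2) : Finset (Fin n → ℕ) :=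
  Finset.Icc 0 fun k => (η k : ℕ) * (p - 1)

/-- The right-hand side of the formula for the coproduct of `x^(α) D_i`. -/
def comulFormula (η : Fin n → Fin 2) (α : Fin n → ℕ) (i : Fin n) :
    UTQ n p q ⊗[TruncPoly p q] UTQ n p q :=
  ι n p q (xD n p K α i) ⊗ₜ[TruncPoly p q] (oneSubPow n p q (wt η α i) : UTQ n p q) +
  ∑ m ∈ indices p η, (-1 : TruncPoly p q) ^ (∑ k, m k) •
    (hRising n p q 0 m ⊗ₜ[TruncPoly p q]
      ((oneSubPow n p q fun k => -(m k : ℤ) : UTQ n p q) *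
        (t p q ^ (∑ k, m k) • ι n p q (divAdI n p K m (xD n p K α i)))))

/-- The right-hand side of the formula for the antipode of `x^(α) D_i`. -/
def antipodeFormula (η : Fin n → Fin 2) (α : Fin n → ℕ) (i : Fin n) : UTQ n p q :=
  -((oneSubPow n p q (-wt η α i) : UTQ n p q) *
    ∑ m ∈ indices p η, t p q ^ (∑ k, m k) •
      (ι n p q (divAdI n p K m (xD n p K α i)) * hRising n p q 1 m))

end UTQ

end

/-!
The whole theorem rests on the truncated binomial series
`(1 - y)^x = ∑_{r<p} ((-1)^r / r!) x^[r] y^r` (`TruncPow.tpow`) in a ring of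
characteristic `p`, for elements with `x^p = x` and `y^p = 0`. Because `x^p = x`, the ring is
cut into pieces by idempotents which are polynomials in `x` and on which `x` acts as an integer
`m`; there the series is the honest power `(1 - y)^m`. An identity between expressions in
`x` may therefore be checked for integers in place of `x`
(`TruncPow.eq_of_eigen`, `TruncPow.tpow_natCast`), where it becomes an induction on the exponent.

The basic twist is such a power: `F(k) = (1 ⊗ 1 - 1 ⊗ e(k) t)^(h(k) ⊗ 1)`. Put `E k = η_k t e(k)`.
Then `[h(k), E k] = E k`, and the pairs `(h(k), E k)` for different `k` commute with each other
(`IsToralFamily`), so that statements on `F^η` reduce to one factor at a time.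
* The cocycle condition is
  `(1 - y₂)^(x₁) (1 - y₃)^(x₁ + x₂) = (1 - y₃)^(x₂) (1 - y₂ - y₃)^(x₁)`
  for `x₁ = h ⊗ 1 ⊗ 1`, `x₂ = 1 ⊗ h ⊗ 1`, and so on (`TruncPow.tpow_cocycle`).
* Twisting any bialgebra with an antipode `S` by an invertible Drinfel'd twist gives a Hopf algebra
  whose antipode is `S` conjugated by `v = m(id ⊗ S)(F)` (`twistedHopf`). Here `v` is the product of
  the normally ordered powers `(1 + E k)^(h(k))`.
* The coproduct formula results from moving `F^η` past `w ⊗ 1` and past `1 ⊗ w`. An element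
  of weight `c` for `ad h` commutes with `(1 - y)^h` up to the factor `(1 - y)^c`, and an element
  commuting with `h` produces the divided powers of `ad y`, weighted by rising factorials
  (`TruncPow.tpow_mul_weight`, `TruncPow.tpow_mul_divSeq`). The antipode formula results from moving
  `v` past `w` (`TruncPow.tpow_neg_mul_divSeq`).

For the dimension, the ordered monomials in the `x^(α) D_i` with exponents below `p` are a basis of
`u(W(n;1))`. They span by the usual straightening. They are linearly independent because `W(n;1)`
embeds into `u(W(n;1))`, which acts on `O(n;1)`, and because independence of primitive elements
passes to their ordered monomials by means of the coproduct (`exists_dual_orderedMonomial`).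

Finally `Δ_η(h(k)) = h(k) ⊗ (1 - e(k) t)^(-η_k) + 1 ⊗ h(k)`. Pairing the two tensor factors with
functionals dual to the basis elements `x^(ε_k) D_k` and `x^(2ε_k) D_k` gives `2 η_k t`, and gives
`0` after the flip. For odd `p` this recovers `η` and shows that `Δ_η` is not cocommutative if
`η ≠ 0`.
-/

open scoped TensorProduct

noncomputable section

/-! ### Truncated powers `(1 - y)^x` -/

namespace TruncPow

variable {B : Type*} [Ring B]

theorem falling_zero (x : B) : falling x 0 = 1 := rfl

theorem falling_succ (x : B) (r : ℕ) : falling x (r + 1) = falling x r * (x - r) := by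
  simp [falling, List.range_succ]

theorem rising_zero (x : B) (a : ℕ) : rising x a 0 = 1 := rfl

theorem rising_succ (x : B) (a r : ℕ) : rising x a (r + 1) = rising x a r * (x + a + r) := by
  simp [rising, List.range_succ]

theorem falling_commute {x z : B} (h : Commute x z) (r : ℕ) : Commute (falling x r) z := by
  induction r with
  | zero => exact Commute.one_left z
  | succ r ih =>
    rw [falling_succ]
    exact ih.mul_left (h.sub_left (Nat.cast_commute _ _))

theorem rising_commute {x z : B} (h : Commute x z) (a r : ℕ) : Commute (rising x a r) z := by
  induction r with
  | zero => exact Commute.one_left z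
  | succ r ih =>
    rw [rising_succ]
    exact ih.mul_left ((h.add_left (Nat.cast_commute _ _)).add_left (Nat.cast_commute _ _))

theorem map_falling {C : Type*} [Ring C] (f : B →+* C) (x : B) (r : ℕ) :
    f (falling x r) = falling (f x) r := by
  induction r with
  | zero => simp [falling_zero]
  | succ r ih => rw [falling_succ, falling_succ, map_mul, ih, map_sub, map_natCast]

theorem rising_succ' (x : B) (a r : ℕ) : rising x a (r + 1) = (x + a) * rising x (a + 1) r := by
  induction r with
  | zero => simp [rising_succ, rising_zero]
  | succ r ih =>
    rw [rising_succ, ih, rising_succ x (a + 1), mul_assoc]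
    congr 2
    push_cast
    abel

theorem falling_succ' (x : B) (r : ℕ) : falling x (r + 1) = x * falling (x - 1) r := by
  induction r with
  | zero => simp [falling_succ, falling_zero]
  | succ r ih =>
    rw [falling_succ, ih, falling_succ (x - 1), mul_assoc]
    congr 2
    push_cast
    abel

theorem rising_add_one (x : B) (a r : ℕ) : rising (x + 1) a r = rising x (a + 1) r := by
  induction r with
  | zero => rfl
  | succ r ih =>
    rw [rising_succ, rising_succ, ih]
    congr 1
    push_cast
    abel

/-- `(x + r)^[r] = x_1^⟨r⟩`. -/
theorem falling_add_self (x : B) (r : ℕ) : falling (x + r) r = rising x 1 r := by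
  induction r generalizing x with
  | zero => rfl
  | succ r ih =>
    have h : x + ((r + 1 : ℕ) : B) - 1 = x + r := by push_cast; abel
    rw [falling_succ', h, ih, rising_succ]
    have : Commute (x + ((r + 1 : ℕ) : B)) (rising x 1 r) :=
      ((rising_commute ((Commute.refl x).add_right (Nat.cast_commute _ _).symm) 1 r)).symm
    rw [this.eq]
    congr 1
    push_cast
    abel

theorem falling_natCast (m r : ℕ) : falling (m : B) r = (m.descFactorial r : B) := by
  induction r with
  | zero => simp [falling_zero]
  | succ r ih =>
    rw [falling_succ, ih, Nat.descFactorial_succ, mul_comm, Nat.cast_mul]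
    rcases le_or_gt r m with h | h
    · rw [Nat.cast_sub h, (Nat.cast_commute _ _).eq]
    · simp [Nat.descFactorial_of_lt h]

theorem falling_mul_of_mul {x w z : B} (h : x * w = w * z) (r : ℕ) :
    falling x r * w = w * falling z r := by
  induction r with
  | zero => simp [falling_zero]
  | succ r ih =>
    rw [falling_succ, falling_succ, mul_assoc, sub_mul, h, (Nat.cast_commute r w).eq, ← mul_sub,
      ← mul_assoc, ih, mul_assoc]

/-- If `P` is a left eigenvector of `x` with an integer eigenvalue, then every polynomial in `x`
may be evaluated behind `P`. -/
theorem eigen_falling {P x : B} {m : ℕ} (h : P * x = P * (m : B)) (r : ℕ) :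
    P * falling x r = P * falling (m : B) r := by
  induction r with
  | zero => rfl
  | succ r ih =>
    have hc := falling_commute (Nat.cast_commute m P) r
    have hc' := falling_commute (Nat.cast_commute m (x - r)) r
    have hc'' := falling_commute (Nat.cast_commute m ((m : B) - r)) r
    rw [falling_succ, falling_succ, ← mul_assoc, ih, mul_assoc, hc'.eq, ← mul_assoc, mul_sub, h,
      ← mul_sub, mul_assoc, ← hc''.eq]

theorem eigen_rising {P x : B} {m : ℕ} (h : P * x = P * (m : B)) (a r : ℕ) :
    P * rising x a r = P * rising (m : B) a r := by
  induction r with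
  | zero => rfl
  | succ r ih =>
    have hc' := rising_commute (Nat.cast_commute m (x + a + r)) a r
    have hc'' := rising_commute (Nat.cast_commute m ((m : B) + a + r)) a r
    rw [rising_succ, rising_succ, ← mul_assoc, ih, mul_assoc, hc'.eq, ← mul_assoc, mul_add,
      mul_add, h, ← mul_add, ← mul_add, mul_assoc, ← hc''.eq]

variable {p : ℕ}

/-- A natural number which is an inverse of `r!` modulo `p`, for `r < p`. Having the inverse
factorials as natural numbers makes every ring homomorphism compatible with `tpow` below. -/
def invFact (p r : ℕ) : ℕ := ((r.factorial : ZMod p)⁻¹).val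

theorem natCast_eq_of_zmod (hp : (p : B) = 0) {a b : ℕ} (h : (a : ZMod p) = b) :
    (a : B) = b := by
  rw [ZMod.natCast_eq_natCast_iff, Nat.modEq_iff_dvd] at h
  obtain ⟨k, hk⟩ := h
  have : ((b : ℤ) : B) - ((a : ℤ) : B) = 0 := by
    rw [← Int.cast_sub, hk]; simp [hp]
  simpa [sub_eq_zero, eq_comm] using this

theorem exists_natCast_eq_intCast [NeZero p] (hp : (p : B) = 0) (c : ℤ) :
    ∃ (m : ℕ) (k : ℤ), c = m + p * k ∧ (c : B) = (m : B) := by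
  have hp0 : (p : ℤ) ≠ 0 := by exact_mod_cast NeZero.ne p
  refine ⟨(c % p).toNat, c / p, ?_, ?_⟩
  · rw [Int.toNat_of_nonneg (Int.emod_nonneg _ hp0), Int.emod_add_mul_ediv]
  · conv_lhs => rw [← Int.emod_add_mul_ediv c p]
    rw [Int.cast_add, Int.cast_mul, Int.cast_natCast, hp, zero_mul, add_zero,
      ← Int.cast_natCast (c % p).toNat, Int.toNat_of_nonneg (Int.emod_nonneg _ hp0)]

variable [Fact p.Prime]

theorem factorial_mul_invFact (hp : (p : B) = 0) {r : ℕ} (hr : r < p) :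
    (r.factorial : B) * invFact p r = 1 := by
  rw [← Nat.cast_mul, ← Nat.cast_one (R := B)]
  apply natCast_eq_of_zmod hp
  rw [Nat.cast_mul, invFact, ZMod.natCast_zmod_val, Nat.cast_one, mul_inv_cancel₀]
  rw [Ne, ZMod.natCast_eq_zero_iff, (Fact.out : p.Prime).dvd_factorial]
  omega

theorem invFact_zero : invFact p 0 = 1 := by
  have : Fact (1 < p) := ⟨(Fact.out : p.Prime).one_lt⟩
  rw [invFact, Nat.factorial_zero, Nat.cast_one, inv_one, ZMod.val_one]

/-- The truncated binomial series `∑_{r<p} ((-1)^r / r!) x^[r] y^r` of `(1 - y)^x`. -/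
def tpow (p : ℕ) (x y : B) : B :=
  ∑ r ∈ Finset.range p, ((-1) ^ r * (invFact p r : ℤ)) • (falling x r * y ^ r)

omit [Fact p.Prime] in
theorem map_tpow {C : Type*} [Ring C] (f : B →+* C) (x y : B) :
    f (tpow p x y) = tpow p (f x) (f y) := by
  simp only [tpow, map_sum, map_zsmul, map_mul, map_falling, map_pow]

omit [Fact p.Prime] in
theorem tpow_commute {x y z : B} (hx : Commute x z) (hy : Commute y z) :
    Commute (tpow p x y) z :=
  Commute.sum_left _ _ _ fun _ _ =>
    ((falling_commute hx _).mul_left (hy.pow_left _)).smul_left _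

theorem tpow_zero_right (x : B) : tpow p x 0 = 1 := by
  rw [tpow, Finset.sum_eq_single 0]
  · simp [invFact_zero, falling_zero]
  · intro r _ hr
    simp [hr]
  · intro h
    exact absurd (Finset.mem_range.2 (Fact.out : p.Prime).pos) h

/-- For a natural number exponent the truncated series is the binomial theorem. -/
theorem tpow_natCast (hp : (p : B) = 0) {y : B} (hy : y ^ p = 0) (m : ℕ) :
    tpow p (m : B) y = (1 - y) ^ m := by
  have key : ∀ r, r < p → ((-1) ^ r * (invFact p r : ℤ)) • (falling (m : B) r * y ^ r) =
      (-y) ^ r * (m.choose r : B) := by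
    intro r hr
    rw [falling_natCast, Nat.descFactorial_eq_factorial_mul_choose, zsmul_eq_mul, neg_pow y]
    push_cast
    have h1 := factorial_mul_invFact hp hr
    have h2 : Commute (r.factorial : B) (invFact p r : B) := Nat.cast_commute _ _
    have h3 := (Nat.cast_commute (m.choose r) (y ^ r)).eq
    rw [mul_assoc (r.factorial : B), h3, mul_assoc, ← mul_assoc (invFact p r : B), ← h2.eq, h1,
      one_mul, mul_assoc]
  have h1 : tpow p (m : B) y =
      ∑ r ∈ Finset.range (p + (m + 1)), (-y) ^ r * (m.choose r : B) := by
    rw [tpow, Finset.sum_congr rfl fun r hr => key r (Finset.mem_range.1 hr)]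
    refine Finset.sum_subset (by simp) fun r _ hr => ?_
    rw [Finset.mem_range, not_lt] at hr
    rw [neg_pow, pow_eq_zero_of_le hr hy, mul_zero, zero_mul]
  rw [h1, sub_eq_neg_add, (Commute.one_right (-y)).add_pow]
  symm
  refine (Finset.sum_congr rfl fun r _ => by rw [one_pow, mul_one]).trans
    (Finset.sum_subset (by simp) fun r _ hr => ?_)
  rw [Finset.mem_range, not_lt] at hr
  rw [Nat.choose_eq_zero_of_lt hr, Nat.cast_zero, mul_zero]

theorem tpow_zero_left (hp : (p : B) = 0) {y : B} (hy : y ^ p = 0) : tpow p 0 y = 1 := by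
  simpa using tpow_natCast hp hy 0

theorem one_sub_pow_char (hp : (p : B) = 0) {y : B} (hy : y ^ p = 0) : (1 - y) ^ p = 1 := by
  rw [← tpow_natCast hp hy, hp, tpow_zero_left hp hy]

omit [Fact p.Prime] in
theorem eigen_tpow_eq {P x : B} {m : ℕ} (h : P * x = P * (m : B)) (y : B) :
    P * tpow p x y = P * tpow p (m : B) y := by
  simp only [tpow, Finset.mul_sum, mul_smul_comm, ← mul_assoc, eigen_falling h]

theorem eigen_tpow (hp : (p : B) = 0) {P x y : B} {m : ℕ} (hy : y ^ p = 0)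
    (h : P * x = P * (m : B)) : P * tpow p x y = P * (1 - y) ^ m := by
  rw [eigen_tpow_eq h, tpow_natCast hp hy]

/-- An element `x` with `x^p = x` is diagonalizable over the prime field: the polynomials
`P_j = 1 - (x - j)^(p - 1)` in `x` add up to `1`, and `P_j x = j P_j`. Hence an equation may be
checked after multiplication by such a `P`, where `x` acts as a natural number `m`. -/
theorem eq_of_eigen (hp : (p : B) = 0) {x : B} (hx : x ^ p = x) {a b : B}
    (H : ∀ (P : B) (m : ℕ), P * x = P * (m : B) → (∀ z, Commute x z → Commute P z) →
      P * a = P * b) : a = b := by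
  rcases subsingleton_or_nontrivial B with hB | hB
  · exact Subsingleton.elim _ _
  have hc : CharP B p := (CharP.charP_iff_prime_eq_zero Fact.out).2 hp
  let _ : Algebra (ZMod p) B := ZMod.algebra B p
  let P : ZMod p → B := fun j => 1 - (x - (j.val : B)) ^ (p - 1)
  have hP : ∀ j, P j = Polynomial.aeval x
      (1 - (Polynomial.X - Polynomial.C j) ^ (p - 1) : Polynomial (ZMod p)) := by
    intro j
    have : Polynomial.aeval x (Polynomial.C ((j.val : ℕ) : ZMod p)) = (j.val : B) := by
      rw [Polynomial.aeval_C, map_natCast]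
    rw [ZMod.natCast_zmod_val] at this
    rw [map_sub, map_one, map_pow, map_sub, Polynomial.aeval_X, this]
  have hsum : ∑ j, P j = 1 := by
    have : ∑ j : ZMod p, (1 - (Polynomial.X - Polynomial.C j) ^ (p - 1) : Polynomial (ZMod p))
        - 1 = 0 := by
      apply Polynomial.eq_zero_of_natDegree_lt_card_of_eval_eq_zero' _ Finset.univ
      · intro i _
        rw [Polynomial.eval_sub, Polynomial.eval_finsetSum, Finset.sum_eq_single i]
        · have := (Fact.out : p.Prime).one_lt
          have h0 : p - 1 ≠ 0 := by omega
          simp [h0]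
        · intro j _ hj
          simp [ZMod.pow_card_sub_one_eq_one (sub_ne_zero.2 hj.symm)]
        · simp
      · rw [Finset.card_univ, ZMod.card]
        refine lt_of_le_of_lt (Polynomial.natDegree_sub_le_of_le (m := p - 1) (n := p - 1)
          (Polynomial.natDegree_sum_le_of_forall_le _ _ fun j _ => ?_) (by simp)) ?_
        · refine (Polynomial.natDegree_sub_le _ _).trans (max_le (by simp) ?_)
          exact (Polynomial.natDegree_pow_le).trans (by simp)
        · have := (Fact.out : p.Prime).pos
          simp; omega
    rw [sub_eq_zero] at this
    simp only [hP, ← map_sum, this, map_one]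
  have heig : ∀ j, P j * x = P j * (j.val : B) := by
    intro j
    have hpow : (x - (j.val : B)) ^ p = x - (j.val : B) := by
      rw [sub_pow_char_of_commute _ (Nat.cast_commute _ _).symm, hx, ← Nat.cast_pow]
      congr 1
      apply natCast_eq_of_zmod hp
      simp
    rw [← sub_eq_zero, ← mul_sub]
    simp only [P]
    rw [sub_mul, one_mul, pow_sub_one_mul (Fact.out : p.Prime).ne_zero, hpow, sub_self]
  rw [← one_mul a, ← one_mul b, ← hsum, Finset.sum_mul, Finset.sum_mul]
  refine Finset.sum_congr rfl fun j _ => H _ _ (heig j) fun z hz => ?_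
  exact (Commute.one_left z).sub_left ((hz.sub_left (Nat.cast_commute _ _)).pow_left _)

/-- Shifting the exponent by an integer multiplies `(1 - y)^x` by a power of `1 - y`. -/
theorem tpow_add_intCast (hp : (p : B) = 0) {x y : B} (hx : x ^ p = x) (hy : y ^ p = 0)
    (U : Bˣ) (hU : (U : B) = 1 - y) (c : ℤ) :
    tpow p (x + (c : B)) y = tpow p x y * (U ^ c : Bˣ) := by
  obtain ⟨c', k, hc, hc'⟩ := exists_natCast_eq_intCast hp c
  have hUp : U ^ p = 1 := Units.ext (by
    rw [Units.val_pow_eq_pow_val, hU, one_sub_pow_char hp hy]; rfl)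
  have hUc : U ^ c = U ^ c' := by
    rw [hc, zpow_add, zpow_mul, zpow_natCast, zpow_natCast, hUp, one_zpow, mul_one]
  rw [hc', hUc, Units.val_pow_eq_pow_val, hU]
  refine eq_of_eigen hp hx fun P m h _ => ?_
  have h' : P * (x + c') = P * ((m + c' : ℕ) : B) := by
    rw [mul_add, h, Nat.cast_add, mul_add]
  rw [eigen_tpow hp hy h', ← mul_assoc, eigen_tpow hp hy h, pow_add, mul_assoc]

theorem tpow_mul_tpow_neg (hp : (p : B) = 0) {x y : B} (hx : x ^ p = x) (hy : y ^ p = 0)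
    (hxy : Commute x y) : tpow p x y * tpow p (-x) y = 1 := by
  refine eq_of_eigen hp hx fun P m h hP => ?_
  have h' : P * (-x) = P * (((p - 1) * m : ℕ) : B) := by
    rw [mul_neg, h, Nat.cast_mul, Nat.cast_sub (Fact.out : p.Prime).one_le, hp]
    simp
  have hc : Commute P ((1 - y) ^ m) := ((Commute.one_right P).sub_right (hP y hxy)).pow_right m
  rw [← mul_assoc, eigen_tpow hp hy h, hc.eq, mul_assoc, eigen_tpow hp hy h', ← mul_assoc,
    ← hc.eq, mul_assoc, ← pow_add, mul_one,
    show m + (p - 1) * m = p * m by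
      obtain ⟨s, hs⟩ : ∃ s, p = s + 1 := ⟨p - 1, by have := (Fact.out : p.Prime).pos; omega⟩
      rw [hs, Nat.add_sub_cancel]; ring,
    pow_mul, one_sub_pow_char hp hy, one_pow, mul_one]

theorem neg_pow_self (hp : (p : B) = 0) {x : B} (hx : x ^ p = x) : (-x) ^ p = -x := by
  rcases subsingleton_or_nontrivial B with hB | hB
  · exact Subsingleton.elim _ _
  have hc : CharP B p := (CharP.charP_iff_prime_eq_zero Fact.out).2 hp
  have := sub_pow_char_of_commute p (Commute.zero_left x)
  rwa [zero_pow (Fact.out : p.Prime).ne_zero, zero_sub, zero_sub, hx] at this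

theorem tpow_neg_mul_tpow (hp : (p : B) = 0) {x y : B} (hx : x ^ p = x) (hy : y ^ p = 0)
    (hxy : Commute x y) : tpow p (-x) y * tpow p x y = 1 := by
  simpa using tpow_mul_tpow_neg hp (neg_pow_self hp hx) hy hxy.neg_left

theorem add_pow_eq_zero (hp : (p : B) = 0) {x y : B} (hx : x ^ p = 0) (hy : y ^ p = 0)
    (hxy : Commute x y) : (x + y) ^ p = 0 := by
  rcases subsingleton_or_nontrivial B with hB | hB
  · exact Subsingleton.elim _ _
  have hc : CharP B p := (CharP.charP_iff_prime_eq_zero Fact.out).2 hp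
  rw [add_pow_char_of_commute _ hxy, hx, hy, add_zero]

omit [Fact p.Prime] in
theorem tpow_mul_of_mul {x y w z : B} (h : x * w = w * z) (hy : Commute y w) :
    tpow p x y * w = w * tpow p z y := by
  simp only [tpow, Finset.sum_mul, Finset.mul_sum, smul_mul_assoc, mul_smul_comm]
  refine Finset.sum_congr rfl fun r _ => ?_
  rw [mul_assoc, (hy.pow_left r).eq, ← mul_assoc, falling_mul_of_mul h, mul_assoc]

/-- Conjugation by `(1 - y)^x` of an element of weight `c` commuting with `y`. -/
theorem tpow_mul_weight (hp : (p : B) = 0) {x y w : B} (hx : x ^ p = x) (hy : y ^ p = 0)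
    (hxy : Commute x y) (hyw : Commute y w) (c : ℤ) (hw : x * w = w * (x + (c : B)))
    (U : Bˣ) (hU : (U : B) = 1 - y) :
    tpow p x y * w = w * (U ^ c : Bˣ) * tpow p x y := by
  have hc : Commute (tpow p x y) (U : B) := by
    rw [hU]
    exact (Commute.one_right _).sub_right (tpow_commute hxy (Commute.refl y))
  rw [tpow_mul_of_mul hw hyw, tpow_add_intCast hp hx hy U hU, (hc.units_zpow_right c).eq, mul_assoc]

/-- The identity `(1-y₂)^{x₁} (1-y₃)^{x₁+x₂} = (1-y₃)^{x₂} (1-y₂-y₃)^{x₁}` behind the cocycle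
condition. -/
theorem tpow_cocycle (hp : (p : B) = 0) {x₁ x₂ y₂ y₃ : B} (hx₁ : x₁ ^ p = x₁) (hx₂ : x₂ ^ p = x₂)
    (hy₂ : y₂ ^ p = 0) (hy₃ : y₃ ^ p = 0) (h₂ : x₂ * y₂ = y₂ * (x₂ + 1))
    (h₁₂ : Commute x₁ x₂) (h₁y₂ : Commute x₁ y₂) (h₁y₃ : Commute x₁ y₃) (h₂y₃ : Commute x₂ y₃)
    (hyy : Commute y₂ y₃) :
    tpow p x₁ y₂ * tpow p (x₁ + x₂) y₃ = tpow p x₂ y₃ * tpow p x₁ (y₂ + y₃) := by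
  have hu : IsUnit (1 - y₃) := ⟨⟨1 - y₃, (1 - y₃) ^ (p - 1), by
      rw [mul_pow_sub_one (Fact.out : p.Prime).ne_zero, one_sub_pow_char hp hy₃], by
      rw [pow_sub_one_mul (Fact.out : p.Prime).ne_zero, one_sub_pow_char hp hy₃]⟩, rfl⟩
  obtain ⟨U, hU⟩ := hu
  set T := tpow p x₂ y₃ with hT
  have hTy₃ : Commute T y₃ := tpow_commute h₂y₃ (Commute.refl y₃)
  -- the key step: `T` carries `1 - y₂ - y₃` to `(1 - y₂)(1 - y₃)`
  have key : T * (1 - (y₂ + y₃)) = (1 - y₂) * (1 - y₃) * T := by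
    have h := tpow_mul_weight hp hx₂ hy₃ h₂y₃ hyy.symm 1 (by simpa using h₂) U hU
    rw [zpow_one, hU, ← hT] at h
    rw [mul_sub, mul_add, h, mul_one, hTy₃.eq]
    noncomm_ring
  have keypow : ∀ m : ℕ, T * (1 - (y₂ + y₃)) ^ m = (1 - y₂) ^ m * (1 - y₃) ^ m * T := by
    intro m
    have hc : Commute (1 - y₂) (1 - y₃) :=
      ((Commute.one_left _).sub_left ((Commute.one_right _).sub_right hyy))
    rw [← hc.mul_pow]
    have : SemiconjBy T (1 - (y₂ + y₃)) ((1 - y₂) * (1 - y₃)) := key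
    exact this.pow_right m
  refine eq_of_eigen hp hx₁ fun P m h hP => ?_
  have hPT : Commute P T := (tpow_commute (hP _ h₁₂).symm (hP _ h₁y₃).symm).symm
  have hPy : Commute P ((1 - y₂) ^ m) :=
    ((Commute.one_right P).sub_right (hP _ h₁y₂)).pow_right m
  rw [← mul_assoc, eigen_tpow hp hy₂ h, hPy.eq, mul_assoc, ← mul_assoc P T, hPT.eq, mul_assoc T,
    eigen_tpow hp (add_pow_eq_zero hp hy₂ hy₃ hyy) h, ← mul_assoc T, ← hPT.eq, mul_assoc P,
    keypow]
  -- on the eigenspace, `x₁ + x₂` may be replaced by `x₂ + m`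
  have h12 : P * tpow p (x₁ + x₂) y₃ = P * tpow p (x₂ + ((m : ℤ) : B)) y₃ := by
    have hfall : ∀ r, P * falling (x₁ + x₂) r = P * falling (x₂ + ((m : ℤ) : B)) r := by
      intro r
      induction r with
      | zero => rfl
      | succ r ih =>
        have hcm : Commute (x₁ + x₂ - (r : B)) (x₂ + ((m : ℤ) : B)) := by
          refine Commute.sub_left (Commute.add_left ?_ ?_) (Nat.cast_commute _ _)
          · exact h₁₂.add_right (Int.cast_commute _ _).symm
          · exact (Commute.refl _).add_right (Int.cast_commute _ _).symm
        have hcm' : Commute (x₂ + ((m : ℤ) : B) - (r : B)) (x₂ + ((m : ℤ) : B)) :=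
          (Commute.refl _).sub_left (Nat.cast_commute _ _)
        rw [falling_succ, falling_succ, ← mul_assoc, ih, mul_assoc,
          (falling_commute hcm.symm r).eq, (falling_commute hcm'.symm r).eq, ← mul_assoc,
          ← mul_assoc]
        congr 1
        rw [mul_sub, mul_add, h, mul_sub, mul_add, Int.cast_natCast, add_comm (P * x₂)]
    simp only [tpow, Finset.mul_sum, mul_smul_comm, ← mul_assoc, hfall]
  rw [h12, tpow_add_intCast hp hx₂ hy₃ U hU, zpow_natCast, Units.val_pow_eq_pow_val, hU, ← hT,
    ← mul_assoc P, mul_assoc, ← mul_assoc]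
  have hTm : Commute T ((1 - y₃) ^ m) := ((Commute.one_right T).sub_right hTy₃).pow_right m
  rw [← hPy.eq, mul_assoc P, hTm.eq, mul_assoc]

/-! ### Conjugation by truncated powers -/

section DividedPowers

/-- `d` is a truncated sequence of divided powers of the inner derivation `ad y`, started at `d 0`:
`[y, d m] = (m + 1) d (m + 1)` for `m < p`. For `m = p - 1` the right-hand side vanishes in
characteristic `p`. -/
def IsDivSeq (p : ℕ) (y : B) (d : ℕ → B) : Prop :=
  ∀ m < p, y * d m - d m * y = (m + 1 : ℕ) * d (m + 1)

omit [Fact p.Prime] in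
/-- The boundary term `f p` vanishes in the applications because it has a factor `p = 0`. -/
theorem sum_range_telescope (f : ℕ → B) (hf : f p = 0) :
    ∑ m ∈ Finset.range p, f (m + 1) = ∑ m ∈ Finset.range p, f m - f 0 := by
  rw [eq_sub_iff_add_eq, ← Finset.sum_range_succ' f p, Finset.sum_range_succ, hf, add_zero]

/-- Conjugation by powers of `U = 1 - y`, written with powers of `U` on the left. -/
theorem unit_pow_mul_eq_rising (hp : (p : B) = 0) {y : B} {d : ℕ → B} (hd : IsDivSeq p y d)
    (U : Bˣ) (hU : (U : B) = 1 - y) (j : ℕ) :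
    (U : B) ^ j * d 0 = (∑ m ∈ Finset.range p,
      (-1 : B) ^ m * rising (j : B) 0 m * ((U ^ (-(m : ℤ)) : Bˣ) : B) * d m) * (U : B) ^ j := by
  induction j with
  | zero =>
    rw [Finset.sum_eq_single 0]
    · simp [rising_zero]
    · intro m _ hm
      obtain ⟨s, rfl⟩ := Nat.exists_eq_succ_of_ne_zero hm
      rw [Nat.succ_eq_add_one, rising_succ']
      simp
    · intro h
      exact absurd (Finset.mem_range.2 (Fact.out : p.Prime).pos) h
  | succ j ih =>
    rw [pow_succ', mul_assoc, ih, ← mul_assoc, ← mul_assoc]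
    congr 1
    -- move the extra factor `U` through each term with `d m * U = U * d m + (m + 1) * d (m + 1)`
    let g : ℕ → B := fun m => (-1 : B) ^ m * rising ((j + 1 : ℕ) : B) 0 (m - 1) * (m : B) *
      ((U ^ (1 - (m : ℤ)) : Bˣ) : B) * d m
    have hg0 : g 0 = 0 := by simp [g]
    have hgp : g p = 0 := by simp [g, hp]
    have hstep : ∀ m ∈ Finset.range p,
        (-1 : B) ^ m * rising ((j + 1 : ℕ) : B) 0 m * ((U ^ (-(m : ℤ)) : Bˣ) : B) * d m * U =
        (-1 : B) ^ m * rising ((j + 1 : ℕ) : B) 0 m * ((U ^ (1 - (m : ℤ)) : Bˣ) : B) * d m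
          - g (m + 1) := by
      intro m hm
      have h1 : d m * (U : B) = U * d m + (m + 1 : ℕ) * d (m + 1) := by
        rw [← hd m (Finset.mem_range.1 hm), hU]; noncomm_ring
      have h2 : ((U ^ (1 - (m : ℤ)) : Bˣ) : B) = ((U ^ (-(m : ℤ)) : Bˣ) : B) * U := by
        rw [← Units.val_mul, ← zpow_add_one]; congr 2; ring
      have h3 : 1 - ((m + 1 : ℕ) : ℤ) = -(m : ℤ) := by push_cast; ring
      simp only [g]
      rw [mul_assoc _ (d m), h1, h2, h3, Nat.add_sub_cancel, mul_add, pow_succ]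
      have h4 := (Nat.cast_commute (m + 1) ((U ^ (-(m : ℤ)) : Bˣ) : B)).eq
      simp only [mul_assoc]
      simp only [neg_mul, mul_neg, one_mul, sub_neg_eq_add]
      simp only [← mul_assoc, h4]
    rw [Finset.sum_mul, Finset.sum_congr rfl hstep, Finset.sum_sub_distrib,
      sum_range_telescope g hgp, hg0, sub_zero, ← Finset.sum_sub_distrib, Finset.mul_sum]
    refine Finset.sum_congr rfl fun m _ => ?_
    have h2 : ((U ^ (1 - (m : ℤ)) : Bˣ) : B) = U * ((U ^ (-(m : ℤ)) : Bˣ) : B) := by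
      rw [← Units.val_mul, ← zpow_one_add]; congr 2
    have hcU : (U : B) * ((-1 : B) ^ m * rising (j : B) 0 m) =
        ((-1 : B) ^ m * rising (j : B) 0 m) * U := by
      have h1 : Commute (rising (j : B) 0 m) (U : B) := rising_commute (Nat.cast_commute _ _) _ _
      have h2 : Commute ((-1 : B) ^ m) (U : B) := (Commute.neg_one_left _).pow_left m
      exact (h2.mul_left h1).eq.symm
    have hcoef : rising ((j + 1 : ℕ) : B) 0 m - rising ((j + 1 : ℕ) : B) 0 (m - 1) * (m : B) =
        rising (j : B) 0 m := by
      cases m with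
      | zero => simp [rising_zero]
      | succ s =>
        rw [Nat.add_sub_cancel, rising_succ, rising_succ', Nat.cast_add, Nat.cast_one,
          rising_add_one]
        have h := (Nat.cast_commute j (rising (j : B) (0 + 1) s)).eq
        simp only [Nat.cast_zero, add_zero]
        rw [h, ← mul_sub]
        congr 1
        push_cast
        abel
    simp only [g]
    rw [h2, ← mul_assoc, ← mul_assoc, hcU, ← hcoef]
    noncomm_ring

/-- Conjugation by powers of `V = 1 + y`, written with powers of `V` on the right. -/
theorem unit_pow_mul_eq_falling {y : B} (hp : (p : B) = 0) {d : ℕ → B} (hd : IsDivSeq p y d)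
    (V : Bˣ) (hV : (V : B) = 1 + y) (j : ℕ) :
    (V : B) ^ j * d 0 = ∑ m ∈ Finset.range p,
      falling (j : B) m * d m * ((V ^ ((j : ℤ) - m) : Bˣ) : B) := by
  induction j with
  | zero =>
    rw [Finset.sum_eq_single 0]
    · simp [falling_zero]
    · intro m _ hm
      obtain ⟨s, rfl⟩ := Nat.exists_eq_succ_of_ne_zero hm
      rw [Nat.succ_eq_add_one, falling_succ']
      simp
    · intro h
      exact absurd (Finset.mem_range.2 (Fact.out : p.Prime).pos) h
  | succ j ih =>
    rw [pow_succ', mul_assoc, ih, Finset.mul_sum]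
    let g : ℕ → B := fun m => falling (j : B) (m - 1) * (m : B) * d m *
      ((V ^ ((j : ℤ) + 1 - m) : Bˣ) : B)
    have hg0 : g 0 = 0 := by simp [g]
    have hgp : g p = 0 := by simp [g, hp]
    have hstep : ∀ m ∈ Finset.range p,
        (V : B) * (falling (j : B) m * d m * ((V ^ ((j : ℤ) - m) : Bˣ) : B)) =
        falling (j : B) m * d m * ((V ^ ((j : ℤ) + 1 - m) : Bˣ) : B) + g (m + 1) := by
      intro m hm
      have h1 : (V : B) * d m = d m * V + (m + 1 : ℕ) * d (m + 1) := by
        rw [← hd m (Finset.mem_range.1 hm), hV]; noncomm_ring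
      have h2 : ((V ^ ((j : ℤ) + 1 - m) : Bˣ) : B) = V * ((V ^ ((j : ℤ) - m) : Bˣ) : B) := by
        rw [← Units.val_mul, ← zpow_one_add]; congr 2; ring
      have h3 : (j : ℤ) + 1 - ((m + 1 : ℕ) : ℤ) = j - m := by push_cast; ring
      have h4 : Commute (falling (j : B) m) (V : B) := falling_commute (Nat.cast_commute _ _) _
      simp only [g]
      rw [h2, h3, Nat.add_sub_cancel, ← mul_assoc, ← mul_assoc, ← h4.eq, mul_assoc _ (V : B), h1]
      simp only [mul_add, add_mul, mul_assoc]
    rw [Finset.sum_congr rfl hstep, Finset.sum_add_distrib,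
      sum_range_telescope g hgp, hg0, sub_zero, ← Finset.sum_add_distrib]
    refine Finset.sum_congr rfl fun m _ => ?_
    have hcoef : falling (j : B) m + falling (j : B) (m - 1) * (m : B) =
        falling ((j + 1 : ℕ) : B) m := by
      cases m with
      | zero => simp [falling_zero]
      | succ s =>
        have h := (falling_commute (Nat.cast_commute j ((j : B) + 1)) s).eq
        rw [Nat.add_sub_cancel, falling_succ, falling_succ', Nat.cast_add, Nat.cast_add,
          Nat.cast_one, add_sub_cancel_right, ← h, ← mul_add]
        congr 1
        abel
    simp only [g]
    rw [← hcoef, Nat.cast_add, Nat.cast_one]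
    noncomm_ring

/-- Conjugation by `(1 - y)^x` of an element commuting with `x`. -/
theorem tpow_mul_divSeq (hp : (p : B) = 0) {x y : B} (hx : x ^ p = x) (hy : y ^ p = 0)
    (hxy : Commute x y) {d : ℕ → B} (hd : IsDivSeq p y d) (hxd : ∀ m, Commute x (d m))
    (U : Bˣ) (hU : (U : B) = 1 - y) :
    tpow p x y * d 0 = (∑ m ∈ Finset.range p,
      (-1 : B) ^ m * rising x 0 m * ((U ^ (-(m : ℤ)) : Bˣ) : B) * d m) * tpow p x y := by
  refine eq_of_eigen hp hx fun P j h hP => ?_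
  have hxU : Commute x (U : B) := by rw [hU]; exact (Commute.one_right x).sub_right hxy
  rw [← mul_assoc, eigen_tpow hp hy h, mul_assoc, ← hU, unit_pow_mul_eq_rising hp hd U hU,
    Finset.sum_mul, Finset.sum_mul, Finset.mul_sum, Finset.mul_sum]
  refine Finset.sum_congr rfl fun m _ => ?_
  set W := ((U ^ (-(m : ℤ)) : Bˣ) : B)
  have hPW : Commute P (W * d m) :=
    hP _ ((hxU.units_zpow_right _).mul_right (hxd m))
  have h1 : Commute P ((-1 : B) ^ m) := (Commute.neg_one_right _).pow_right m
  have e : ∀ X : B, (-1 : B) ^ m * rising X 0 m * W * d m = (-1) ^ m * rising X 0 m * (W * d m) :=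
    fun X => mul_assoc _ _ _
  have hcr : Commute P (rising (j : B) 0 m) := (rising_commute (Nat.cast_commute _ _) _ _).symm
  have hall : Commute P ((-1) ^ m * rising (j : B) 0 m * (W * d m)) :=
    (h1.mul_right hcr).mul_right hPW
  have hx' : P * ((-1) ^ m * rising x 0 m * (W * d m)) =
      (-1) ^ m * rising (j : B) 0 m * (W * d m) * P := by
    have : P * ((-1) ^ m * rising x 0 m) = P * ((-1) ^ m * rising (j : B) 0 m) := by
      rw [← mul_assoc, ← mul_assoc, h1.eq, mul_assoc, mul_assoc, eigen_rising h]
    rw [← hall.eq, ← mul_assoc, this, mul_assoc]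
  rw [e, e, ← mul_assoc P _ ((U : B) ^ j), ← mul_assoc P _ (tpow p x y), hx', hall.eq,
    mul_assoc _ P, mul_assoc _ P, eigen_tpow hp hy h, hU]

section Antipode

variable {h y : B} (hp : (p : B) = 0) (hh : h ^ p = h) (hy : y ^ p = 0)
  (hhy : h * y = y * (h + 1))

include hp hh hy hhy

/-- `(1 - y) v (1 + y) = v` for the normally ordered power `v = (1 + y)^h`. -/
theorem unit_mul_tpow_neg (U V : Bˣ) (hU : (U : B) = 1 - y) (hV : (V : B) = 1 + y) :
    (U : B) * tpow p h (-y) * V = tpow p h (-y) := by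
  have hny : (-y) ^ p = 0 := by rw [neg_pow, hy, mul_zero]
  have hc : tpow p (h - 1) (-y) * y = y * tpow p h (-y) := by
    refine tpow_mul_of_mul ?_ ((Commute.refl y).neg_left)
    rw [sub_mul, hhy]; noncomm_ring
  have hs := tpow_add_intCast hp hh hny V (by rw [hV, sub_neg_eq_add]) (-1)
  have hVy : Commute (V : B) y := by
    rw [hV]; exact (Commute.one_left y).add_left (Commute.refl y)
  rw [Int.cast_neg, Int.cast_one, ← sub_eq_add_neg, zpow_neg_one] at hs
  set v := tpow p h (-y)
  have h1 : y * v * V = v * y := by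
    rw [← hc, hs, mul_assoc, mul_assoc, ← hVy.eq, ← mul_assoc ((V⁻¹ : Bˣ) : B),
      Units.inv_mul, one_mul]
  rw [hU, sub_mul, one_mul, sub_mul, h1, hV, mul_add, mul_one, add_sub_cancel_right]

/-- The normally ordered power `v = (1 + y)^h` satisfies `v (1 + y) = (1 - y)⁻¹ v`. -/
theorem tpow_neg_mul_zpow (U V : Bˣ) (hU : (U : B) = 1 - y) (hV : (V : B) = 1 + y) (c : ℤ) :
    tpow p h (-y) * (V ^ c : Bˣ) = (U ^ (-c) : Bˣ) * tpow p h (-y) := by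
  have key := unit_mul_tpow_neg hp hh hy hhy U V hU hV
  have hs : SemiconjBy (tpow p h (-y)) (V : B) ((U⁻¹ : Bˣ) : B) := by
    rw [SemiconjBy, ← key]
    conv_rhs => rw [mul_assoc (U : B), ← mul_assoc, Units.inv_mul, one_mul]
    rw [key]
  have := hs.units_zpow_right c
  rw [inv_zpow'] at this
  exact this

/-- The normally ordered powers `(1 + y)^h` and `(1 - y)^h` are inverse to each other, although
`h` and `y` do not commute. -/
theorem tpow_neg_mul_tpow_self (U V : Bˣ) (hU : (U : B) = 1 - y) (hV : (V : B) = 1 + y) :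
    tpow p h (-y) * tpow p h y = 1 := by
  have hny : (-y) ^ p = 0 := by rw [neg_pow, hy, mul_zero]
  have hhy' : h * (-y) = (-y) * (h + 1) := by rw [mul_neg, hhy, neg_mul]
  refine eq_of_eigen hp hh fun P j hP _ => ?_
  have h1 := tpow_neg_mul_zpow hp hh hny hhy' V U (by rw [hV, sub_neg_eq_add])
    (by rw [hU, sub_eq_add_neg]) (-j)
  rw [neg_neg, neg_neg, zpow_natCast] at h1
  rw [← mul_assoc, eigen_tpow hp hny hP, sub_neg_eq_add, ← hV, mul_assoc,
    ← Units.val_pow_eq_pow_val, ← h1, ← mul_assoc, eigen_tpow hp hy hP, ← hU,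
    ← Units.val_pow_eq_pow_val, mul_assoc, ← Units.val_mul, zpow_neg, zpow_natCast, mul_inv_cancel,
    Units.val_one]

omit [Fact p.Prime] hh hy hhy in
/-- Conjugation by `1 - y` lowers the shift in the rising factorials of the conjugation formula
below by one. -/
theorem unit_mul_sum_rising {d : ℕ → B} (hd : IsDivSeq p y d) (U : Bˣ) (hU : (U : B) = 1 - y)
    (z : B) (hz : z * y = y * (z + 1)) :
    (U : B) * ∑ m ∈ Finset.range p, d m * rising (z + 1) 1 m =
      (∑ m ∈ Finset.range p, d m * rising z 1 m) * U := by
  let g : ℕ → B := fun m => (m : B) * d m * rising (z + 1) 1 (m - 1)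
  have hg0 : g 0 = 0 := by simp [g]
  have hgp : g p = 0 := by simp [g, hp]
  have hzr : ∀ m, rising z 1 m * y = y * rising (z + 1) 1 m := by
    intro m
    induction m with
    | zero => simp [rising_zero]
    | succ m ih =>
      rw [rising_succ, rising_succ, mul_assoc, add_mul, add_mul, hz, (Nat.cast_commute m y).eq,
        (Nat.cast_commute 1 y).eq, ← mul_add, ← mul_add, ← mul_assoc, ih, mul_assoc]
  have hstep : ∀ m ∈ Finset.range p, (U : B) * (d m * rising (z + 1) 1 m) =
      d m * rising (z + 1) 1 m - d m * rising z 1 m * y - g (m + 1) := by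
    intro m hm
    have h1 : y * d m = d m * y + (m + 1 : ℕ) * d (m + 1) := by
      rw [← hd m (Finset.mem_range.1 hm)]; abel
    simp only [g]
    rw [hU, sub_mul, one_mul, ← mul_assoc, h1, Nat.add_sub_cancel, mul_assoc _ _ y, hzr]
    noncomm_ring
  rw [Finset.mul_sum, Finset.sum_congr rfl hstep, Finset.sum_sub_distrib,
      sum_range_telescope g hgp, hg0, sub_zero, ← Finset.sum_sub_distrib, Finset.sum_mul]
  refine Finset.sum_congr rfl fun m _ => ?_
  rw [hU, mul_sub, mul_one, sub_right_comm]
  congr 1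
  cases m with
  | zero => simp [rising_zero, hg0]
  | succ s =>
    simp only [g]
    have h1 := (Nat.cast_commute (s + 1) (d (s + 1))).eq
    have h2 : Commute (z + 1 + (1 : ℕ) + (s : B)) (rising (z + 1) 1 s) := by
      refine (rising_commute ?_ 1 s).symm
      exact (((Commute.refl _).add_right (Nat.cast_commute _ _).symm).add_right
        (Nat.cast_commute _ _).symm)
    rw [Nat.add_sub_cancel, h1, mul_assoc, ← mul_sub, rising_succ, ← h2.eq, rising_succ',
      ← rising_add_one z 1 s, ← sub_mul]
    congr 2
    push_cast
    abel

/-- Conjugation by the normally ordered power `v = (1 + y)^h` of an element `d 0` of weight `c`. -/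
theorem tpow_neg_mul_divSeq {d : ℕ → B} (hd : IsDivSeq p y d) (c : ℤ)
    (hhd : ∀ m, h * d m = d m * (h + ((c + m : ℤ) : B)))
    (U V : Bˣ) (hU : (U : B) = 1 - y) (hV : (V : B) = 1 + y) :
    tpow p h (-y) * d 0 = ((U ^ (-c) : Bˣ) : B) *
      (∑ m ∈ Finset.range p, d m * rising h 1 m) * tpow p h (-y) := by
  have hny : (-y) ^ p = 0 := by rw [neg_pow, hy, mul_zero]
  have hVp : V ^ p = 1 := Units.ext (by
    rw [Units.val_pow_eq_pow_val, hV, ← sub_neg_eq_add, one_sub_pow_char hp hny]; rfl)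
  -- the formula with shifted rising factorials
  have h1 : tpow p h (-y) * d 0 = (∑ m ∈ Finset.range p, d m * rising (h + (c : B)) 1 m) *
      ((U ^ (-c) : Bˣ) : B) * tpow p h (-y) := by
    refine eq_of_eigen hp hh fun P j hP _ => ?_
    rw [← mul_assoc, eigen_tpow hp hny hP, sub_neg_eq_add, ← hV, mul_assoc,
      unit_pow_mul_eq_falling hp hd V hV, mul_assoc,
      ← tpow_neg_mul_zpow hp hh hy hhy U V hU hV c, Finset.sum_mul, Finset.mul_sum, Finset.mul_sum]
    refine Finset.sum_congr rfl fun m _ => ?_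
    have hfr : d m * rising (h + (c : B)) 1 m = falling h m * d m := by
      rw [falling_mul_of_mul (hhd m), ← falling_add_self]
      congr 2
      push_cast
      abel
    -- `P * d m` is again an eigenvector of `h`
    obtain ⟨j', k, hj, hj'⟩ := exists_natCast_eq_intCast hp ((j : ℤ) - c - m)
    have hPd : P * d m * h = P * d m * (j' : B) := by
      have e : d m * h = h * d m - d m * ((c + m : ℤ) : B) := by rw [hhd m]; noncomm_ring
      rw [mul_assoc, e, mul_sub, ← mul_assoc, hP, ← hj', mul_assoc P (j : B),
        (Nat.cast_commute j (d m)).eq, ← mul_sub, ← mul_sub, mul_assoc]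
      congr 2
      push_cast
      abel
    have hVj : ((V ^ ((j : ℤ) - m) : Bˣ) : B) = (V : B) ^ j' * ((V ^ c : Bˣ) : B) := by
      rw [← Units.val_pow_eq_pow_val, ← Units.val_mul, ← zpow_natCast, ← zpow_add,
        show (j : ℤ) - m = (j' + c) + p * k by linarith, zpow_add V (j' + c), zpow_mul,
        zpow_natCast V p, hVp, one_zpow, mul_one]
    have hfj := falling_commute (Nat.cast_commute j P) m
    have hPf : P * falling (j : B) m * d m = falling (j : B) m * (P * d m) := by
      rw [← hfj.eq, mul_assoc]
    rw [hfr, hVj, ← mul_assoc, ← mul_assoc, ← mul_assoc, ← mul_assoc, ← mul_assoc, ← mul_assoc,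
      eigen_falling hP, hPf, mul_assoc _ (P * d m) (tpow p h (-y)),
      eigen_tpow hp hny hPd, sub_neg_eq_add, ← hV]
    simp only [mul_assoc]
  -- passing from the weight `c` to the weight `0`
  have hzy : ∀ c : ℤ, (h + (c : B)) * y = y * (h + (c : B) + 1) := by
    intro c
    rw [add_mul, hhy, (Int.cast_commute c y).eq]
    noncomm_ring
  have hs : ∀ c : ℤ, (U : B) * (∑ m ∈ Finset.range p, d m * rising (h + ((c + 1 : ℤ) : B)) 1 m) =
      (∑ m ∈ Finset.range p, d m * rising (h + (c : B)) 1 m) * U := by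
    intro c
    have := unit_mul_sum_rising hp hd U hU (h + (c : B)) (hzy c)
    rwa [add_assoc, ← Int.cast_one, ← Int.cast_add] at this
  have h2 : ∀ c : ℤ, ((U ^ c : Bˣ) : B) *
      (∑ m ∈ Finset.range p, d m * rising (h + (c : B)) 1 m) =
      (∑ m ∈ Finset.range p, d m * rising h 1 m) * ((U ^ c : Bˣ) : B) := by
    intro c
    induction c using Int.induction_on with
    | zero => simp
    | succ c ih =>
      rw [zpow_add_one, Units.val_mul, mul_assoc, hs, ← mul_assoc, ih, mul_assoc]
    | pred c ih =>
      have := hs (-(c : ℤ) - 1)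
      rw [sub_add_cancel] at this
      rw [← Units.mul_left_inj U, mul_assoc, ← this, ← mul_assoc, ← Units.val_mul, ← zpow_add_one,
        sub_add_cancel, ih, mul_assoc, ← Units.val_mul, ← zpow_add_one, sub_add_cancel]
  rw [h1]
  congr 1
  have h3 := h2 c
  calc _ = ((U ^ (-c) : Bˣ) : B) * (((U ^ c : Bˣ) : B) *
      (∑ m ∈ Finset.range p, d m * rising (h + (c : B)) 1 m)) * ((U ^ (-c) : Bˣ) : B) := by
        rw [← mul_assoc, ← Units.val_mul, ← zpow_add, neg_add_cancel, zpow_zero, Units.val_one,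
          one_mul]
    _ = _ := by
        rw [h3, mul_assoc, mul_assoc, ← Units.val_mul, ← zpow_add, add_neg_cancel, zpow_zero,
          Units.val_one, mul_one]

end Antipode

end DividedPowers

end TruncPow

/-! ### Ordered products of commuting factors -/

section OrderedProducts

theorem sum_piFinset_succ {M : Type*} [AddCommMonoid M] {n : ℕ} (I : Fin (n + 1) → Finset ℕ)
    (f : (Fin (n + 1) → ℕ) → M) :
    ∑ m ∈ Fintype.piFinset I, f m =
      ∑ a ∈ I 0, ∑ m ∈ Fintype.piFinset fun k : Fin n => I k.succ, f (Fin.cons a m) := by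
  rw [← Finset.sum_product']
  refine Finset.sum_bij' (fun m _ => (m 0, fun k : Fin n => m k.succ))
    (fun x _ => Fin.cons x.1 x.2) ?_ ?_ ?_ ?_ ?_
  · intro m hm
    rw [Fintype.mem_piFinset] at hm
    exact Finset.mem_product.2 ⟨hm 0, Fintype.mem_piFinset.2 fun k => hm k.succ⟩
  · intro x hx
    rw [Finset.mem_product, Fintype.mem_piFinset] at hx
    exact Fintype.mem_piFinset.2 fun k => Fin.cases hx.1 hx.2 k
  · intro m _
    exact Fin.cons_self_tail m
  · intro x _
    simp
  · intro m _
    exact congrArg f (Fin.cons_self_tail m).symm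

variable {B : Type*} [Ring B]

theorem commute_ofFn_prod {n : ℕ} {f : Fin n → B} {z : B} (h : ∀ k, Commute (f k) z) :
    Commute (List.ofFn f).prod z := by
  refine (Commute.list_prod_right _ _ fun x hx => ?_).symm
  obtain ⟨k, rfl⟩ := (List.mem_ofFn' _ _).1 hx
  exact (h k).symm

theorem ofFn_prod_mul {n : ℕ} (a b : Fin n → B) (h : ∀ j k, j ≠ k → Commute (a j) (b k)) :
    (List.ofFn fun k => a k * b k).prod = (List.ofFn a).prod * (List.ofFn b).prod := by
  induction n with
  | zero => simp
  | succ n ih =>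
    simp only [List.ofFn_succ, List.prod_cons]
    rw [ih _ _ fun j k hjk => h _ _ fun e => hjk (Fin.succ_injective n e)]
    have : Commute (List.ofFn fun k => a k.succ).prod (b 0) :=
      commute_ofFn_prod fun k => h _ _ (Fin.succ_ne_zero k)
    rw [mul_assoc, mul_assoc, ← mul_assoc (b 0), ← this.eq, mul_assoc]

theorem ofFn_prod_smul {R : Type*} [CommRing R] [Algebra R B] {n : ℕ} (c : Fin n → R)
    (x : Fin n → B) : (List.ofFn fun k => c k • x k).prod = (∏ k, c k) • (List.ofFn x).prod := by
  induction n with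
  | zero => simp
  | succ n ih =>
    simp only [List.ofFn_succ, List.prod_cons, Fin.prod_univ_succ]
    rw [ih, smul_mul_smul_comm]

theorem ofFn_prod_tmul {R A : Type*} [CommRing R] [Ring A] [Algebra R A] [Algebra R B] {n : ℕ}
    (a : Fin n → A) (b : Fin n → B) :
    (List.ofFn fun k => a k ⊗ₜ[R] b k).prod = (List.ofFn a).prod ⊗ₜ[R] (List.ofFn b).prod := by
  induction n with
  | zero => simp [Algebra.TensorProduct.one_def]
  | succ n ih =>
    simp only [List.ofFn_succ, List.prod_cons]
    rw [ih, Algebra.TensorProduct.tmul_mul_tmul]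

theorem ofFn_prod_sum {n : ℕ} (I : Fin n → Finset ℕ) (g : Fin n → ℕ → B) :
    (List.ofFn fun k => ∑ i ∈ I k, g k i).prod =
      ∑ m ∈ Fintype.piFinset I, (List.ofFn fun k => g k (m k)).prod := by
  induction n with
  | zero => simp
  | succ n ih =>
    rw [sum_piFinset_succ]
    simp only [List.ofFn_succ, List.prod_cons, Fin.cons_zero, Fin.cons_succ]
    rw [ih, Finset.sum_mul]
    exact Finset.sum_congr rfl fun _ _ => Finset.mul_sum _ _ _

/-- If commuting elements `T k` are moved past `f w` by `T k * f w = ∑ a * f (δ w) * b * T k`, then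
so is their ordered product, with all multi-indices on the right. The condition `M k w` stands for
the hypothesis on `w` (such as having a given weight) under which the formula for `T k` holds. -/
theorem ofFn_prod_conj {S W : Type*} [CommRing S] [AddCommGroup W] [Module S W] {n : ℕ}
    (T : Fin n → B) (I : Fin n → Finset ℕ) (a b : Fin n → ℕ → B)
    (δ : Fin n → ℕ → Module.End S W) (f : W → B) (M : Fin n → W → Prop)
    (hT : ∀ k w, M k w → T k * f w = (∑ m ∈ I k, a k m * f (δ k m w) * b k m) * T k)
    (hM : ∀ j k m w, j ≠ k → M k w → M k (δ j m w))
    (haa : ∀ j k l m, j ≠ k → Commute (a j l) (a k m))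
    (hTa : ∀ j k m, j ≠ k → Commute (T j) (a k m))
    (hTb : ∀ j k m, j ≠ k → Commute (T j) (b k m)) (w : W) (hw : ∀ k, M k w) :
    (List.ofFn T).prod * f w = (∑ m ∈ Fintype.piFinset I, (List.ofFn fun k => a k (m k)).prod *
      f ((List.ofFn fun k => δ k (m k)).prod w) * (List.ofFn fun k => b k (m k)).prod) *
      (List.ofFn T).prod := by
  induction n with
  | zero => simp
  | succ n ih =>
    have hne : ∀ {j k : Fin n}, j ≠ k → j.succ ≠ k.succ := fun h e => h (Fin.succ_injective n e)
    have ih' := ih (fun k => T k.succ) (fun k => I k.succ) (fun k => a k.succ) (fun k => b k.succ)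
      (fun k => δ k.succ) (fun k => M k.succ) (fun k => hT k.succ)
      (fun j k m w h => hM _ _ m w (hne h)) (fun j k l m h => haa _ _ l m (hne h))
      (fun j k m h => hTa _ _ m (hne h)) (fun j k m h => hTb _ _ m (hne h)) (fun k => hw k.succ)
    have hM0 : ∀ m : Fin n → ℕ, M 0 ((List.ofFn fun k => δ k.succ (m k)).prod w) := by
      intro m
      have : ∀ l : List (Module.End S W), (∀ D ∈ l, ∀ w, M 0 w → M 0 (D w)) → M 0 (l.prod w) := by
        intro l
        induction l with
        | nil => intro _; exact hw 0
        | cons D l ihl =>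
          intro h
          rw [List.prod_cons]
          exact h D (by simp) _ (ihl fun D' h' => h D' (by simp [h']))
      refine this _ fun D hD => ?_
      obtain ⟨k, rfl⟩ := (List.mem_ofFn' _ _).1 hD
      exact fun w hw => hM _ _ _ _ (Fin.succ_ne_zero k) hw
    rw [sum_piFinset_succ, Finset.sum_comm]
    simp only [List.ofFn_succ, List.prod_cons, Fin.cons_zero, Fin.cons_succ]
    rw [mul_assoc, ih', ← mul_assoc, ← mul_assoc, Finset.mul_sum]
    congr 1
    rw [Finset.sum_mul]
    refine Finset.sum_congr rfl fun m _ => ?_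
    set A := (List.ofFn fun k => a k.succ (m k)).prod
    set Q := (List.ofFn fun k => b k.succ (m k)).prod
    have hA : Commute A (T 0) :=
      commute_ofFn_prod fun k => (hTa _ _ _ (Fin.succ_ne_zero k).symm).symm
    have hQ : Commute Q (T 0) :=
      commute_ofFn_prod fun k => (hTb _ _ _ (Fin.succ_ne_zero k).symm).symm
    have hAa : ∀ i, Commute A (a 0 i) := fun i =>
      commute_ofFn_prod fun k => haa _ _ _ _ (Fin.succ_ne_zero k)
    rw [← mul_assoc, ← mul_assoc, ← hA.eq, mul_assoc A, hT 0 _ (hM0 m), mul_assoc, mul_assoc,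
      ← hQ.eq, ← mul_assoc, ← mul_assoc, Finset.mul_sum, Finset.sum_mul]
    congr 1
    refine Finset.sum_congr rfl fun i _ => ?_
    rw [← (hAa i).eq]
    simp only [mul_assoc, Module.End.mul_apply]

/-- If each `F k` satisfies `α F * β F = γ F * δ F`, then so does their ordered product, provided
that the images of different factors commute. -/
theorem ofFn_prod_cocycle {C : Type*} [Ring C] (α β γ δ : B →+* C) {n : ℕ} (F : Fin n → B)
    (h : ∀ k, α (F k) * β (F k) = γ (F k) * δ (F k))
    (hαβ : ∀ j k, j ≠ k → Commute (α (F j)) (β (F k)))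
    (hγδ : ∀ j k, j ≠ k → Commute (γ (F j)) (δ (F k))) :
    α (List.ofFn F).prod * β (List.ofFn F).prod = γ (List.ofFn F).prod * δ (List.ofFn F).prod := by
  simp only [map_list_prod, List.map_ofFn]
  refine (ofFn_prod_mul _ _ hαβ).symm.trans (Eq.trans ?_ (ofFn_prod_mul _ _ hγδ))
  congr 2
  exact funext h

end OrderedProducts

/-! ### Twisting a Hopf algebra -/

section TwistedHopf

open MulOpposite

variable {R A : Type*} [CommRing R] [Ring A] [Bialgebra R A]

theorem sandwichRight_commute (S : A →ₐ[R] Aᵐᵒᵖ) (a b : A) :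
    Commute (Algebra.lmul R A a) (((Algebra.lsmul R R A).comp S) b) := by
  ext c
  simp [mul_assoc]

/-- The left action of `A ⊗ A` on `A` given by an anti-homomorphism `S`:
`(a ⊗ b) • c = a c S(b)`. -/
def sandwichRight (S : A →ₐ[R] Aᵐᵒᵖ) : A ⊗[R] A →ₐ[R] Module.End R A :=
  Algebra.TensorProduct.lift (Algebra.lmul R A) ((Algebra.lsmul R R A).comp S)
    (sandwichRight_commute S)

theorem sandwichRight_tmul (S : A →ₐ[R] Aᵐᵒᵖ) (a b c : A) :
    sandwichRight S (a ⊗ₜ b) c = a * c * unop (S b) := by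
  rw [sandwichRight, Algebra.TensorProduct.lift_tmul]
  simp [mul_assoc]

theorem sandwichLeft_commute (S : A →ₐ[R] Aᵐᵒᵖ) (a b : A) :
    Commute (((AlgHom.op (Algebra.lmul R A)).comp S) a)
      (((AlgHom.op (Algebra.lsmul R R A)).comp (AlgEquiv.opOp R A).toAlgHom) b) := by
  apply unop_injective
  ext c
  simp [mul_assoc]

/-- The right action of `A ⊗ A` on `A` given by an anti-homomorphism `S`:
`c • (a ⊗ b) = S(a) c b`. -/
def sandwichLeft (S : A →ₐ[R] Aᵐᵒᵖ) : A ⊗[R] A →ₐ[R] (Module.End R A)ᵐᵒᵖ :=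
  Algebra.TensorProduct.lift ((AlgHom.op (Algebra.lmul R A)).comp S)
    ((AlgHom.op (Algebra.lsmul R R A)).comp (AlgEquiv.opOp R A).toAlgHom)
    (sandwichLeft_commute S)

theorem sandwichLeft_tmul (S : A →ₐ[R] Aᵐᵒᵖ) (a b c : A) :
    unop (sandwichLeft S (a ⊗ₜ b)) c = unop (S a) * c * b := by
  rw [sandwichLeft, Algebra.TensorProduct.lift_tmul]
  simp [mul_assoc]

/-- Conjugation of the coproduct by an invertible element of `A ⊗ A`. -/
def conjComul (F : (A ⊗[R] A)ˣ) : A →ₐ[R] A ⊗[R] A where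
  toFun a := F * Bialgebra.comulAlgHom R A a * (F⁻¹ : (_)ˣ)
  map_one' := by rw [map_one, mul_one, Units.mul_inv]
  map_mul' a b := by
    rw [map_mul]
    simp only [mul_assoc, Units.inv_mul_cancel_left]
  map_zero' := by rw [map_zero, mul_zero, zero_mul]
  map_add' a b := by rw [map_add, mul_add, add_mul]
  commutes' r := by
    rw [AlgHom.commutes, ← Algebra.commutes, mul_assoc, Units.mul_inv, mul_one]

theorem conjComul_apply (F : (A ⊗[R] A)ˣ) (a : A) :
    conjComul F a = F * Bialgebra.comulAlgHom R A a * (F⁻¹ : (_)ˣ) := rfl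

theorem map_conjComul_id (F : (A ⊗[R] A)ˣ) (Y : A ⊗[R] A) :
    Algebra.TensorProduct.map (conjComul F) (.id R A) Y =
      (F : A ⊗[R] A) ⊗ₜ[R] (1 : A) *
        Algebra.TensorProduct.map (Bialgebra.comulAlgHom R A) (.id R A) Y *
        ((F⁻¹ : (_)ˣ) : A ⊗[R] A) ⊗ₜ[R] (1 : A) := by
  induction Y using TensorProduct.induction_on with
  | zero => simp
  | add x y hx hy => simp only [map_add, hx, hy, mul_add, add_mul]
  | tmul a b =>
    simp only [Algebra.TensorProduct.map_tmul, Algebra.TensorProduct.tmul_mul_tmul, conjComul_apply,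
      one_mul, mul_one]

theorem map_id_conjComul (F : (A ⊗[R] A)ˣ) (Y : A ⊗[R] A) :
    Algebra.TensorProduct.map (.id R A) (conjComul F) Y =
      (1 : A) ⊗ₜ[R] (F : A ⊗[R] A) *
        Algebra.TensorProduct.map (.id R A) (Bialgebra.comulAlgHom R A) Y *
        (1 : A) ⊗ₜ[R] ((F⁻¹ : (_)ˣ) : A ⊗[R] A) := by
  induction Y using TensorProduct.induction_on with
  | zero => simp
  | add x y hx hy => simp only [map_add, hx, hy, mul_add, add_mul]
  | tmul a b =>
    simp only [Algebra.TensorProduct.map_tmul, Algebra.TensorProduct.tmul_mul_tmul, conjComul_apply,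
      one_mul, mul_one]

/-- Coassociativity of the twisted coproduct: by the cocycle condition, both iterated coproducts are
the conjugates of the original one by the same element. -/
theorem conjComul_coassoc {F : (A ⊗[R] A)ˣ}
    (hF : IsDrinfeldTwist (Bialgebra.comulAlgHom R A) (Bialgebra.counitAlgHom R A) F) :
    (Algebra.TensorProduct.assoc R R R A A A).toAlgHom.comp
      ((Algebra.TensorProduct.map (conjComul F) (.id R A)).comp (conjComul F)) =
    (Algebra.TensorProduct.map (.id R A) (conjComul F)).comp (conjComul F) := by
  let α : A ⊗[R] A →* A ⊗[R] (A ⊗[R] A) :=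
    ((Algebra.TensorProduct.assoc R R R A A A).toAlgHom.comp
      (Algebra.TensorProduct.includeLeft : A ⊗[R] A →ₐ[R] (A ⊗[R] A) ⊗[R] A) : _ →ₐ[R] _)
  let β : A ⊗[R] A →* A ⊗[R] (A ⊗[R] A) :=
    ((Algebra.TensorProduct.assoc R R R A A A).toAlgHom.comp
      (Algebra.TensorProduct.map (Bialgebra.comulAlgHom R A) (.id R A)) : _ →ₐ[R] _)
  let γ : A ⊗[R] A →* A ⊗[R] (A ⊗[R] A) :=
    (Algebra.TensorProduct.includeRight : A ⊗[R] A →ₐ[R] A ⊗[R] (A ⊗[R] A))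
  let δ : A ⊗[R] A →* A ⊗[R] (A ⊗[R] A) :=
    (Algebra.TensorProduct.map (.id R A) (Bialgebra.comulAlgHom R A) : _ →ₐ[R] _)
  have h : Units.map α F * Units.map β F = Units.map γ F * Units.map δ F := by
    ext
    have := hF.cocycle
    rw [map_mul] at this
    exact this
  have h' : Units.map β F⁻¹ * Units.map α F⁻¹ = Units.map δ F⁻¹ * Units.map γ F⁻¹ := by
    simp only [map_inv, ← mul_inv_rev, h]
  have hv : α F * β F = γ F * δ F := congrArg Units.val h
  have hv' : β (F⁻¹ : (_)ˣ) * α (F⁻¹ : (_)ˣ) = δ (F⁻¹ : (_)ˣ) * γ (F⁻¹ : (_)ˣ) :=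
    congrArg Units.val h'
  ext a
  have h0 : β (Bialgebra.comulAlgHom R A a) = δ (Bialgebra.comulAlgHom R A a) :=
    Coalgebra.coassoc_apply a
  have e1 : ((Algebra.TensorProduct.assoc R R R A A A).toAlgHom.comp
      ((Algebra.TensorProduct.map (conjComul F) (.id R A)).comp (conjComul F))) a =
      α F * β (conjComul F a) * α (F⁻¹ : (_)ˣ) := by
    rw [AlgHom.comp_apply, AlgHom.comp_apply, map_conjComul_id, map_mul, map_mul]
    rfl
  have e2 : ((Algebra.TensorProduct.map (.id R A) (conjComul F)).comp (conjComul F)) a =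
      γ F * δ (conjComul F a) * γ (F⁻¹ : (_)ˣ) := by
    rw [AlgHom.comp_apply, map_id_conjComul]
    rfl
  rw [e1, e2, conjComul_apply, map_mul β, map_mul β, map_mul δ, map_mul δ, mul_assoc, mul_assoc,
    mul_assoc, mul_assoc, hv', mul_assoc, mul_assoc, ← mul_assoc (α F), hv, h0]
  simp only [mul_assoc]

/-- Twisting by a Drinfel'd twist `F`: the coproduct is conjugated by `F`, the counit is kept and
the antipode `S` is conjugated by `v = m(id ⊗ S)(F)`, whose inverse is `m(S ⊗ id)(F⁻¹)`. -/
def twistedHopf (S : A →ₐ[R] Aᵐᵒᵖ)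
    (hSr : ∀ a, sandwichRight S (Bialgebra.comulAlgHom R A a) 1 =
      algebraMap R A (Bialgebra.counitAlgHom R A a))
    (hSl : ∀ a, unop (sandwichLeft S (Bialgebra.comulAlgHom R A a)) 1 =
      algebraMap R A (Bialgebra.counitAlgHom R A a))
    (F : (A ⊗[R] A)ˣ)
    (hF : IsDrinfeldTwist (Bialgebra.comulAlgHom R A) (Bialgebra.counitAlgHom R A) F)
    (v : Aˣ) (hv : sandwichRight S F 1 = v)
    (hv' : unop (sandwichLeft S (F⁻¹ : (_)ˣ)) 1 = (v⁻¹ : Aˣ)) : HopfStructure R A where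
  comul := conjComul F
  counit := Bialgebra.counitAlgHom R A
  antipode := (LinearMap.mulLeft R (v : A)) ∘ₗ (LinearMap.mulRight R ((v⁻¹ : Aˣ) : A)) ∘ₗ
    (opLinearEquiv R).symm.toLinearMap ∘ₗ S.toLinearMap
  coassoc := conjComul_coassoc hF
  counit_left := by
    have h1 := hF.counit_left
    rw [← map_one (Algebra.TensorProduct.lid R A), EmbeddingLike.apply_eq_iff_eq] at h1
    have h2 : Algebra.TensorProduct.map (Bialgebra.counitAlgHom R A) (.id R A)
        ((F⁻¹ : (_)ˣ) : A ⊗[R] A) = 1 := by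
      have := map_mul (Algebra.TensorProduct.map (Bialgebra.counitAlgHom R A) (.id R A))
        (F : A ⊗[R] A) ((F⁻¹ : (_)ˣ) : A ⊗[R] A)
      rwa [Units.mul_inv, map_one, h1, one_mul, eq_comm] at this
    ext a
    rw [AlgHom.comp_apply, conjComul_apply, map_mul, map_mul, h1, h2, one_mul, mul_one]
    exact Coalgebra.rTensor_counit_comul a
  counit_right := by
    have h1 := hF.counit_right
    rw [← map_one (Algebra.TensorProduct.rid R R A), EmbeddingLike.apply_eq_iff_eq] at h1
    have h2 : Algebra.TensorProduct.map (.id R A) (Bialgebra.counitAlgHom R A)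
        ((F⁻¹ : (_)ˣ) : A ⊗[R] A) = 1 := by
      have := map_mul (Algebra.TensorProduct.map (.id R A) (Bialgebra.counitAlgHom R A))
        (F : A ⊗[R] A) ((F⁻¹ : (_)ˣ) : A ⊗[R] A)
      rwa [Units.mul_inv, map_one, h1, one_mul, eq_comm] at this
    ext a
    rw [AlgHom.comp_apply, conjComul_apply, map_mul, map_mul, h1, h2, one_mul, mul_one]
    exact Coalgebra.lTensor_counit_comul a
  antipode_left := by
    -- `m(S' ⊗ id)(Y) = v * (v⁻¹ • Y)` for the right action of `A ⊗ A` on `A`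
    have key : ∀ Y : A ⊗[R] A, (LinearMap.mul' R A ∘ₗ
        ((LinearMap.mulLeft R (v : A)) ∘ₗ (LinearMap.mulRight R ((v⁻¹ : Aˣ) : A)) ∘ₗ
          (opLinearEquiv R).symm.toLinearMap ∘ₗ S.toLinearMap).rTensor A) Y =
        v * unop (sandwichLeft S Y) ((v⁻¹ : Aˣ) : A) := by
      intro Y
      induction Y using TensorProduct.induction_on with
      | zero => simp
      | add x y hx hy => rw [map_add, hx, hy, map_add, unop_add, LinearMap.add_apply, mul_add]
      | tmul a b => simp [sandwichLeft_tmul, mul_assoc]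
    ext a
    refine (key (conjComul F a)).trans ?_
    rw [conjComul_apply, map_mul, map_mul, unop_mul, unop_mul, Module.End.mul_apply,
      Module.End.mul_apply, ← hv', ← Module.End.mul_apply (unop (sandwichLeft S (F : A ⊗[R] A))),
      ← unop_mul, ← map_mul, Units.inv_mul, map_one (sandwichLeft S), unop_one,
      Module.End.one_apply, hSl,
      Algebra.algebraMap_eq_smul_one, map_smul, hv', mul_smul_comm, Units.mul_inv,
      ← Algebra.algebraMap_eq_smul_one]
    rfl
  antipode_right := by
    have key : ∀ Y : A ⊗[R] A, (LinearMap.mul' R A ∘ₗ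
        ((LinearMap.mulLeft R (v : A)) ∘ₗ (LinearMap.mulRight R ((v⁻¹ : Aˣ) : A)) ∘ₗ
          (opLinearEquiv R).symm.toLinearMap ∘ₗ S.toLinearMap).lTensor A) Y =
        sandwichRight S Y (v : A) * ((v⁻¹ : Aˣ) : A) := by
      intro Y
      induction Y using TensorProduct.induction_on with
      | zero => simp
      | add x y hx hy => rw [map_add, hx, hy, map_add, LinearMap.add_apply, add_mul]
      | tmul a b => simp [sandwichRight_tmul, mul_assoc]
    ext a
    refine (key (conjComul F a)).trans ?_
    rw [conjComul_apply, map_mul, map_mul, Module.End.mul_apply, Module.End.mul_apply, ← hv,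
      ← Module.End.mul_apply (sandwichRight S ((F⁻¹ : (_)ˣ) : A ⊗[R] A)),
      ← map_mul, Units.inv_mul, map_one (sandwichRight S), Module.End.one_apply, hSr,
      Algebra.algebraMap_eq_smul_one, map_smul, hv, smul_mul_assoc, Units.mul_inv,
      ← Algebra.algebraMap_eq_smul_one]
    rfl

end TwistedHopf

/-! ### Drinfel'd twists from toral families -/

section ToralFamily

open MulOpposite TruncPow

variable {R A : Type*} [CommRing R] [Ring A] [Bialgebra R A] {n : ℕ}

/-- `n` commuting pairs of primitive elements `(h k, E k)` with `[h k, E k] = E k`,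
`(h k)^p = h k` and `(E k)^p = 0`. -/
structure IsToralFamily (R : Type*) {A : Type*} [CommRing R] [Ring A] [Bialgebra R A] {n : ℕ}
    (p : ℕ) (h E : Fin n → A) : Prop where
  comul_h : ∀ k, Bialgebra.comulAlgHom R A (h k) = h k ⊗ₜ 1 + 1 ⊗ₜ h k
  comul_E : ∀ k, Bialgebra.comulAlgHom R A (E k) = E k ⊗ₜ 1 + 1 ⊗ₜ E k
  counit_h : ∀ k, Bialgebra.counitAlgHom R A (h k) = 0
  counit_E : ∀ k, Bialgebra.counitAlgHom R A (E k) = 0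
  commute_h : ∀ j k, Commute (h j) (h k)
  commute_E : ∀ j k, Commute (E j) (E k)
  commute_h_E : ∀ j k, j ≠ k → Commute (h j) (E k)
  h_mul_E : ∀ k, h k * E k = E k * (h k + 1)
  h_pow : ∀ k, h k ^ p = h k
  E_pow : ∀ k, E k ^ p = 0

variable {p : ℕ}

theorem natCast_tensor_eq_zero {S B C : Type*} [CommRing S] [Ring B] [Algebra S B] [Ring C]
    [Algebra S C] (hp : (p : B) = 0) : (p : B ⊗[S] C) = 0 := by
  rw [← map_natCast (Algebra.TensorProduct.includeLeft : B →ₐ[S] B ⊗[S] C), hp, map_zero]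

theorem commute_includeLeft_includeRight {S B C : Type*} [CommRing S] [Ring B] [Algebra S B]
    [Ring C] [Algebra S C] (b : B) (c : C) : Commute (b ⊗ₜ[S] (1 : C)) ((1 : B) ⊗ₜ[S] c) := by
  simp [Commute, SemiconjBy]

theorem commute_tmul_one {S B C : Type*} [CommRing S] [Ring B] [Algebra S B]
    [Ring C] [Algebra S C] {b b' : B} (h : Commute b b') :
    Commute (b ⊗ₜ[S] (1 : C)) (b' ⊗ₜ[S] (1 : C)) := by
  simp [Commute, SemiconjBy, h.eq]

theorem commute_one_tmul {S B C : Type*} [CommRing S] [Ring B] [Algebra S B]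
    [Ring C] [Algebra S C] {c c' : C} (h : Commute c c') :
    Commute ((1 : B) ⊗ₜ[S] c) ((1 : B) ⊗ₜ[S] c') := by
  simp [Commute, SemiconjBy, h.eq]

theorem falling_tmul_one {S B C : Type*} [CommRing S] [Ring B] [Algebra S B]
    [Ring C] [Algebra S C] (b : B) (r : ℕ) :
    falling (b ⊗ₜ[S] (1 : C)) r = falling b r ⊗ₜ[S] (1 : C) :=
  (map_falling (Algebra.TensorProduct.includeLeft : B →ₐ[S] B ⊗[S] C).toRingHom b r).symm

theorem tpow_tmul_eq_sum (x y : A) : tpow p (x ⊗ₜ[R] (1 : A)) ((1 : A) ⊗ₜ[R] y) =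
    ∑ r ∈ Finset.range p, ((-1) ^ r * (invFact p r : ℤ)) • (falling x r ⊗ₜ[R] (y ^ r)) := by
  refine Finset.sum_congr rfl fun r _ => ?_
  rw [falling_tmul_one, Algebra.TensorProduct.tmul_pow, one_pow,
    Algebra.TensorProduct.tmul_mul_tmul, mul_one, one_mul]

theorem unop_falling (x : A) (r : ℕ) : unop (falling (op x) r) = falling x r := by
  induction r with
  | zero => rfl
  | succ r ih =>
    rw [falling_succ, falling_succ, unop_mul, ih, unop_sub, unop_op, unop_natCast]
    exact (falling_commute ((Commute.refl x).sub_right (Nat.cast_commute _ _).symm) r).eq.symm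

/-- The value of `m(id ⊗ S)` at a basic twist, with an extra factor `c` between the two legs. -/
theorem sandwichRight_tpow (S : A →ₐ[R] Aᵐᵒᵖ) {x y c : A} (hS : S y = op (-y))
    (hc : Commute y c) :
    sandwichRight S (tpow p (x ⊗ₜ[R] (1 : A)) ((1 : A) ⊗ₜ[R] y)) c = tpow p x (-y) * c := by
  rw [tpow_tmul_eq_sum, map_sum, LinearMap.sum_apply, tpow, Finset.sum_mul]
  refine Finset.sum_congr rfl fun r _ => ?_
  rw [map_zsmul, LinearMap.smul_apply, sandwichRight_tmul, map_pow, hS, unop_pow, unop_op,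
    mul_assoc, ← (hc.neg_left.pow_left r).eq, smul_mul_assoc, mul_assoc]

/-- The value of `m(S ⊗ id)` at the inverse of a basic twist, with an extra factor `c` between the
two legs. -/
theorem sandwichLeft_tpow (S : A →ₐ[R] Aᵐᵒᵖ) {x y c : A} (hS : S x = op (-x))
    (hc : Commute y c) :
    unop (sandwichLeft S (tpow p (-(x ⊗ₜ[R] (1 : A))) ((1 : A) ⊗ₜ[R] y))) c = tpow p x y * c := by
  rw [← TensorProduct.neg_tmul, tpow_tmul_eq_sum, map_sum, Finset.unop_sum, LinearMap.sum_apply,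
    tpow, Finset.sum_mul]
  refine Finset.sum_congr rfl fun r _ => ?_
  rw [map_zsmul, unop_smul, LinearMap.smul_apply, sandwichLeft_tmul]
  have : unop (S (falling (-x) r)) = falling x r := by
    have := map_falling (S : A →+* Aᵐᵒᵖ) (-x) r
    rw [RingHom.coe_coe, map_neg, hS, ← op_neg, neg_neg] at this
    rw [this, unop_falling]
  rw [this, mul_assoc, ← (hc.pow_left r).eq, smul_mul_assoc, mul_assoc]

/-- The values of the two sandwich actions of an ordered product of twists at `1`. -/
theorem sandwich_ofFn_prod (S : A →ₐ[R] Aᵐᵒᵖ) {n : ℕ} (E : Fin n → A) (F : Fin n → (A ⊗[R] A)ˣ)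
    (v : Fin n → Aˣ)
    (hr : ∀ k c, Commute (E k) c → sandwichRight S (F k : A ⊗[R] A) c = v k * c)
    (hl : ∀ k c, Commute (E k) c → unop (sandwichLeft S ((F k)⁻¹ : (_)ˣ)) c =
      ((v k)⁻¹ : Aˣ) * c)
    (hE : ∀ j k, j ≠ k → Commute (E j) (v k : A))
    (hv : ∀ j k, j ≠ k → Commute (v j : A) (v k : A)) :
    sandwichRight S ((List.ofFn F).prod : (A ⊗[R] A)ˣ) 1 = ((List.ofFn v).prod : Aˣ) ∧
    unop (sandwichLeft S ((List.ofFn F).prod⁻¹ : (A ⊗[R] A)ˣ)) 1 =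
      ((List.ofFn v).prod⁻¹ : Aˣ) := by
  induction n with
  | zero => simp
  | succ n ih =>
    have hne : ∀ {j k : Fin n}, j ≠ k → j.succ ≠ k.succ := fun h e => h (Fin.succ_injective n e)
    obtain ⟨h1, h2⟩ := ih (fun k => E k.succ) (fun k => F k.succ) (fun k => v k.succ)
      (fun k => hr k.succ) (fun k => hl k.succ) (fun j k h => hE _ _ (hne h))
      (fun j k h => hv _ _ (hne h))
    simp only [List.ofFn_succ, List.prod_cons]
    set G := (List.ofFn fun k : Fin n => F k.succ).prod
    set u := (List.ofFn fun k : Fin n => v k.succ).prod with hu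
    have hu' : (u : A) = (List.ofFn fun k : Fin n => (v k.succ : A)).prod := by
      rw [hu, ← Units.coeHom_apply, map_list_prod, List.map_ofFn]; rfl
    have hEu : Commute (u : A) (E 0) := by
      rw [hu']
      exact commute_ofFn_prod fun k => (hE _ _ (Fin.succ_ne_zero k).symm).symm
    have hvu : Commute (u : A) (v 0 : A) := by
      rw [hu']
      exact commute_ofFn_prod fun k => hv _ _ (Fin.succ_ne_zero k)
    constructor
    · rw [Units.val_mul, map_mul, Module.End.mul_apply, h1, hr 0 _ hEu.symm, Units.val_mul]
    · rw [mul_inv_rev, Units.val_mul, map_mul, unop_mul, Module.End.mul_apply, h2,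
        hl 0 _ hEu.units_inv_left.symm, mul_inv_rev, Units.val_mul,
        (hvu.units_inv_left.units_inv_right).eq]

variable [Fact p.Prime]

/-- The basic twist `(1 ⊗ 1 - 1 ⊗ E)^{h ⊗ 1}` as a unit of `A ⊗ A`. -/
def twistUnit (hp : (p : A) = 0) {h E : A} (hh : h ^ p = h) (hE : E ^ p = 0) : (A ⊗[R] A)ˣ where
  val := tpow p (h ⊗ₜ[R] (1 : A)) ((1 : A) ⊗ₜ[R] E)
  inv := tpow p (-(h ⊗ₜ[R] (1 : A))) ((1 : A) ⊗ₜ[R] E)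
  val_inv := tpow_mul_tpow_neg (natCast_tensor_eq_zero hp)
    (by rw [Algebra.TensorProduct.tmul_pow, hh, one_pow])
    (by rw [Algebra.TensorProduct.tmul_pow, hE, TensorProduct.tmul_zero])
    (commute_includeLeft_includeRight _ _)
  inv_val := tpow_neg_mul_tpow (natCast_tensor_eq_zero hp)
    (by rw [Algebra.TensorProduct.tmul_pow, hh, one_pow])
    (by rw [Algebra.TensorProduct.tmul_pow, hE, TensorProduct.tmul_zero])
    (commute_includeLeft_includeRight _ _)

/-- The unit `1 - y` for `y^p = 0`. -/
def oneSubUnit (hp : (p : A) = 0) {y : A} (hy : y ^ p = 0) : Aˣ where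
  val := 1 - y
  inv := (1 - y) ^ (p - 1)
  val_inv := by rw [mul_pow_sub_one (Fact.out : p.Prime).ne_zero, one_sub_pow_char hp hy]
  inv_val := by rw [pow_sub_one_mul (Fact.out : p.Prime).ne_zero, one_sub_pow_char hp hy]

/-- The normally ordered power `(1 + E)^h` as a unit of `A`; its inverse is `(1 - E)^h`. -/
def antipodeUnit (hp : (p : A) = 0) {h E : A} (hh : h ^ p = h) (hE : E ^ p = 0)
    (hhE : h * E = E * (h + 1)) : Aˣ :=
  have hE' : (-E) ^ p = 0 := by rw [neg_pow, hE, mul_zero]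
  { val := tpow p h (-E)
    inv := tpow p h E
    val_inv := tpow_neg_mul_tpow_self hp hh hE hhE (oneSubUnit hp hE) (oneSubUnit hp hE') rfl
      (sub_neg_eq_add _ _)
    inv_val := by
      have := tpow_neg_mul_tpow_self hp hh hE' (by rw [mul_neg, hhE, neg_mul])
        (oneSubUnit hp hE') (oneSubUnit hp hE) rfl (sub_eq_add_neg _ _)
      rwa [neg_neg] at this }

namespace IsToralFamily

variable {h E : Fin n → A} (T : IsToralFamily R p h E) (hp : (p : A) = 0)

/-- The ordered product of the basic twists. -/
def twistProd : (A ⊗[R] A)ˣ :=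
  (List.ofFn fun k => twistUnit (R := R) hp (T.h_pow k) (T.E_pow k)).prod

theorem twistProd_val : ((T.twistProd hp : (A ⊗[R] A)ˣ) : A ⊗[R] A) =
    (List.ofFn fun k => tpow p (h k ⊗ₜ[R] (1 : A)) ((1 : A) ⊗ₜ[R] E k)).prod := by
  rw [twistProd, ← Units.coeHom_apply, map_list_prod, List.map_ofFn]; rfl

/-- The ordered product of the units `(1 + E k)^{h k}`. -/
def antipodeProd : Aˣ :=
  (List.ofFn fun k => antipodeUnit hp (T.h_pow k) (T.E_pow k) (T.h_mul_E k)).prod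

theorem antipodeProd_val : ((T.antipodeProd hp : Aˣ) : A) =
    (List.ofFn fun k => tpow p (h k) (-E k)).prod := by
  rw [antipodeProd, ← Units.coeHom_apply, map_list_prod, List.map_ofFn]; rfl

include T in
omit [Fact p.Prime] in
theorem commute_tpow {j k : Fin n} (hjk : j ≠ k) :
    Commute (tpow p (h j) (-E j)) (tpow p (h k) (-E k)) := by
  have h1 : ∀ z, Commute (h k) z → Commute (E k) z → Commute z (tpow p (h k) (-E k)) :=
    fun z hz hz' => (tpow_commute hz hz'.neg_left).symm
  exact tpow_commute (h1 _ (T.commute_h _ _) (T.commute_h_E _ _ hjk).symm)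
    (h1 _ (T.commute_h_E _ _ hjk.symm).neg_right (T.commute_E _ _).neg_right)

theorem sandwich_twistProd (S : A →ₐ[R] Aᵐᵒᵖ) (hSh : ∀ k, S (h k) = op (-h k))
    (hSE : ∀ k, S (E k) = op (-E k)) :
    sandwichRight S (T.twistProd hp : (A ⊗[R] A)ˣ) 1 = (T.antipodeProd hp : Aˣ) ∧
    unop (sandwichLeft S ((T.twistProd hp)⁻¹ : (A ⊗[R] A)ˣ)) 1 = ((T.antipodeProd hp)⁻¹ : Aˣ) := by
  refine sandwich_ofFn_prod S E _ _ (fun k c hc => ?_) (fun k c hc => ?_) (fun j k hjk => ?_)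
    (fun j k hjk => ?_)
  · exact sandwichRight_tpow S (hSE k) hc
  · exact sandwichLeft_tpow S (hSh k) hc
  · exact (tpow_commute (T.commute_h_E _ _ hjk.symm) (T.commute_E _ _).neg_left).symm
  · exact T.commute_tpow hjk

theorem isDrinfeldTwist : IsDrinfeldTwist (Bialgebra.comulAlgHom R A)
    (Bialgebra.counitAlgHom R A) (T.twistProd hp) where
  cocycle := by
    let α : A ⊗[R] A →+* A ⊗[R] (A ⊗[R] A) :=
      ((Algebra.TensorProduct.assoc R R R A A A).toAlgHom.comp
        (Algebra.TensorProduct.includeLeft : A ⊗[R] A →ₐ[R] (A ⊗[R] A) ⊗[R] A) : _ →ₐ[R] _)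
    let β : A ⊗[R] A →+* A ⊗[R] (A ⊗[R] A) :=
      ((Algebra.TensorProduct.assoc R R R A A A).toAlgHom.comp
        (Algebra.TensorProduct.map (Bialgebra.comulAlgHom R A) (.id R A)) : _ →ₐ[R] _)
    let γ : A ⊗[R] A →+* A ⊗[R] (A ⊗[R] A) :=
      (Algebra.TensorProduct.includeRight : A ⊗[R] A →ₐ[R] A ⊗[R] (A ⊗[R] A))
    let δ : A ⊗[R] A →+* A ⊗[R] (A ⊗[R] A) :=
      (Algebra.TensorProduct.map (.id R A) (Bialgebra.comulAlgHom R A) : _ →ₐ[R] _)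
    -- the three embeddings of `A` into its triple tensor power
    let s₁ : A → A ⊗[R] (A ⊗[R] A) := fun a => a ⊗ₜ 1
    let s₂ : A → A ⊗[R] (A ⊗[R] A) := fun a => 1 ⊗ₜ (a ⊗ₜ 1)
    let s₃ : A → A ⊗[R] (A ⊗[R] A) := fun a => 1 ⊗ₜ (1 ⊗ₜ a)
    have c₁₂ : ∀ a b, Commute (s₁ a) (s₂ b) := fun a b => commute_includeLeft_includeRight _ _
    have c₁₃ : ∀ a b, Commute (s₁ a) (s₃ b) := fun a b => commute_includeLeft_includeRight _ _
    have c₂₃ : ∀ a b, Commute (s₂ a) (s₃ b) := fun a b =>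
      commute_one_tmul (commute_includeLeft_includeRight _ _)
    have c₁ : ∀ {a b}, Commute a b → Commute (s₁ a) (s₁ b) := fun h => commute_tmul_one h
    have c₂ : ∀ {a b}, Commute a b → Commute (s₂ a) (s₂ b) := fun h =>
      commute_one_tmul (commute_tmul_one h)
    have c₃ : ∀ {a b}, Commute a b → Commute (s₃ a) (s₃ b) := fun h =>
      commute_one_tmul (commute_one_tmul h)
    let F : Fin n → A ⊗[R] A := fun k => tpow p (h k ⊗ₜ[R] (1 : A)) ((1 : A) ⊗ₜ[R] E k)
    have hα : ∀ k, α (F k) = tpow p (s₁ (h k)) (s₂ (E k)) := fun k => by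
      rw [map_tpow]
      congr 1
    have hβ : ∀ k, β (F k) = tpow p (s₁ (h k) + s₂ (h k)) (s₃ (E k)) := fun k => by
      rw [map_tpow]
      congr 1
      change Algebra.TensorProduct.assoc R R R A A A
        ((Bialgebra.comulAlgHom R A (h k)) ⊗ₜ 1) = _
      rw [T.comul_h, TensorProduct.add_tmul, map_add]
      rfl
      change Algebra.TensorProduct.assoc R R R A A A
        ((Bialgebra.comulAlgHom R A 1) ⊗ₜ E k) = _
      rw [map_one]
      rfl
    have hγ : ∀ k, γ (F k) = tpow p (s₂ (h k)) (s₃ (E k)) := fun k => by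
      rw [map_tpow]
      congr 1
    have hδ : ∀ k, δ (F k) = tpow p (s₁ (h k)) (s₂ (E k) + s₃ (E k)) := fun k => by
      rw [map_tpow]
      congr 1
      · change h k ⊗ₜ (Bialgebra.comulAlgHom R A 1) = _
        rw [map_one]
      · change (1 : A) ⊗ₜ (Bialgebra.comulAlgHom R A (E k)) = _
        rw [T.comul_E, TensorProduct.tmul_add]
    have key := ofFn_prod_cocycle α β γ δ F
      (fun k => by
        rw [hα, hβ, hγ, hδ]
        refine tpow_cocycle (natCast_tensor_eq_zero hp) ?_ ?_ ?_ ?_ ?_ (c₁₂ _ _) (c₁₂ _ _)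
          (c₁₃ _ _) (c₂₃ _ _) (c₂₃ _ _)
        · simp only [s₁, Algebra.TensorProduct.tmul_pow, one_pow, T.h_pow]
        · simp only [s₂, Algebra.TensorProduct.tmul_pow, one_pow, T.h_pow]
        · simp only [s₂, Algebra.TensorProduct.tmul_pow, one_pow, T.E_pow, TensorProduct.zero_tmul,
            TensorProduct.tmul_zero]
        · simp only [s₃, Algebra.TensorProduct.tmul_pow, one_pow, T.E_pow, TensorProduct.tmul_zero]
        · simp only [s₂, mul_add, Algebra.TensorProduct.tmul_mul_tmul, mul_one, T.h_mul_E,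
            TensorProduct.add_tmul, TensorProduct.tmul_add])
      (fun j k hjk => by
        rw [hα, hβ]
        refine tpow_commute (tpow_commute ?_ ?_).symm (tpow_commute ?_ ?_).symm
        · exact (c₁ (T.commute_h _ _)).add_left (c₁₂ _ _).symm
        · exact (c₁₃ _ _).symm
        · exact (c₁₂ _ _).add_left (c₂ (T.commute_h_E _ _ hjk.symm))
        · exact (c₂₃ _ _).symm)
      (fun j k hjk => by
        rw [hγ, hδ]
        refine tpow_commute (tpow_commute ?_ ?_).symm (tpow_commute ?_ ?_).symm
        · exact c₁₂ _ _
        · exact (c₂ (T.commute_h_E _ _ hjk).symm).add_left (c₂₃ _ _).symm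
        · exact c₁₃ _ _
        · exact (c₂₃ _ _).add_left (c₃ (T.commute_E _ _)))
    rw [map_mul, twistProd_val]
    exact key
  counit_left := by
    rw [twistProd_val]
    have h1 : ∀ k, Algebra.TensorProduct.lid R A (Algebra.TensorProduct.map
        (Bialgebra.counitAlgHom R A) (.id R A)
        (tpow p (h k ⊗ₜ[R] (1 : A)) ((1 : A) ⊗ₜ[R] E k))) = 1 := by
      intro k
      have := map_tpow (p := p) (((Algebra.TensorProduct.lid R A).toAlgHom.comp
        (Algebra.TensorProduct.map (Bialgebra.counitAlgHom R A) (.id R A)) : _ →ₐ[R] A) :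
          A ⊗[R] A →+* A) (h k ⊗ₜ[R] (1 : A)) ((1 : A) ⊗ₜ[R] E k)
      refine this.trans ?_
      have e : ((((Algebra.TensorProduct.lid R A).toAlgHom.comp
        (Algebra.TensorProduct.map (Bialgebra.counitAlgHom R A) (.id R A)) : _ →ₐ[R] A) :
          A ⊗[R] A →+* A) (h k ⊗ₜ[R] (1 : A))) = 0 := by
        change Algebra.TensorProduct.lid R A ((Bialgebra.counitAlgHom R A (h k)) ⊗ₜ 1) = 0
        rw [T.counit_h, TensorProduct.zero_tmul, map_zero]
      rw [e]
      refine tpow_zero_left hp ?_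
      rw [← map_pow, Algebra.TensorProduct.tmul_pow, T.E_pow, TensorProduct.tmul_zero, map_zero]
    simp only [map_list_prod, List.map_ofFn, Function.comp_def, h1]
    simp
  counit_right := by
    rw [twistProd_val]
    have h1 : ∀ k, Algebra.TensorProduct.rid R R A (Algebra.TensorProduct.map
        (.id R A) (Bialgebra.counitAlgHom R A)
        (tpow p (h k ⊗ₜ[R] (1 : A)) ((1 : A) ⊗ₜ[R] E k))) = 1 := by
      intro k
      have := map_tpow (p := p) (((Algebra.TensorProduct.rid R R A).toAlgHom.comp
        (Algebra.TensorProduct.map (.id R A) (Bialgebra.counitAlgHom R A)) : _ →ₐ[R] A) :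
          A ⊗[R] A →+* A) (h k ⊗ₜ[R] (1 : A)) ((1 : A) ⊗ₜ[R] E k)
      refine this.trans ?_
      have e : ((((Algebra.TensorProduct.rid R R A).toAlgHom.comp
        (Algebra.TensorProduct.map (.id R A) (Bialgebra.counitAlgHom R A)) : _ →ₐ[R] A) :
          A ⊗[R] A →+* A) ((1 : A) ⊗ₜ[R] E k)) = 0 := by
        change Algebra.TensorProduct.rid R R A (1 ⊗ₜ (Bialgebra.counitAlgHom R A (E k))) = 0
        rw [T.counit_E, TensorProduct.tmul_zero, map_zero]
      rw [e, tpow_zero_right]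
    simp only [map_list_prod, List.map_ofFn, Function.comp_def, h1]
    simp

end IsToralFamily

end ToralFamily

/-! ### Conjugation by products of twists -/

section WeightConjugation

open MulOpposite TruncPow

variable {R A : Type*} [CommRing R] [Ring A] [Bialgebra R A] {n p : ℕ} [Fact p.Prime]

theorem units_ofFn_prod_val {B : Type*} [Ring B] (U : Fin n → Bˣ) :
    (((List.ofFn U).prod : Bˣ) : B) = (List.ofFn fun k => (U k : B)).prod := by
  rw [← Units.coeHom_apply, map_list_prod, List.map_ofFn]; rfl

theorem TruncPow.rising_tmul_one {S B C : Type*} [CommRing S] [Ring B] [Algebra S B]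
    [Ring C] [Algebra S C] (b : B) (a r : ℕ) :
    rising (b ⊗ₜ[S] (1 : C)) a r = rising b a r ⊗ₜ[S] (1 : C) := by
  have h : ∀ j : ℕ, (j : B ⊗[S] C) = (j : B) ⊗ₜ[S] (1 : C) := fun j =>
    (map_natCast (Algebra.TensorProduct.includeLeft : B →ₐ[S] B ⊗[S] C) j).symm
  induction r with
  | zero => rfl
  | succ r ih =>
    rw [rising_succ, rising_succ, ih, h, h, ← TensorProduct.add_tmul, ← TensorProduct.add_tmul,
      Algebra.TensorProduct.tmul_mul_tmul, mul_one]

namespace IsToralFamily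

variable {h E : Fin n → A} (T : IsToralFamily R p h E) (hp : (p : A) = 0)
  {S W : Type*} [CommRing S] [AddCommGroup W] [Module S W]
  (f : W → A) (δ : Fin n → ℕ → Module.End S W) (τ : Fin n → R) (c : Fin n → ℤ)
  (M : Fin n → W → Prop)

/-- `f : W → A` maps the operators `δ k m` on `W` to the divided powers of the inner derivations
`ad (E k)`, up to the scalars `τ k`, and `M k w` implies that `f w` has weight `c k` with respect to
`ad (h k)`. -/
structure IsWeightSystem (p : ℕ) (h E : Fin n → A) (f : W → A) (δ : Fin n → ℕ → Module.End S W)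
    (τ : Fin n → R) (c : Fin n → ℤ) (M : Fin n → W → Prop) : Prop where
  zero : ∀ k, δ k 0 = 1
  divSeq : ∀ k w, IsDivSeq p (E k) fun m => τ k ^ m • f (δ k m w)
  weight : ∀ k m w, M k w → h k * f (δ k m w) = f (δ k m w) * (h k + ((c k + m : ℤ) : A))
  stable : ∀ j k m w, j ≠ k → M k w → M k (δ j m w)

variable {f δ τ c M} (D : IsWeightSystem p h E f δ τ c M) (U : Fin n → Aˣ)
  (hU : ∀ k, (U k : A) = 1 - E k)

include T D hU

/-- Conjugation of `f w ⊗ 1` by the product of the twists, for `f w` of weight `c`. -/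
theorem twistProd_mul_tmul_one (w : W) (hw : ∀ k, M k w) :
    (T.twistProd hp : A ⊗[R] A) * (f w ⊗ₜ[R] (1 : A)) =
      (f w ⊗ₜ[R] (((List.ofFn fun k => U k ^ c k).prod : Aˣ) : A)) * T.twistProd hp := by
  have hwt : ∀ k, h k * f w = f w * (h k + (c k : A)) := fun k => by
    simpa [D.zero] using D.weight k 0 w (hw k)
  have hE : ∀ k j, Commute (E k) ((U j ^ c j : Aˣ) : A) := fun k j => by
    refine Commute.units_zpow_right ?_ _
    rw [hU]
    exact (Commute.one_right _).sub_right (T.commute_E _ _)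
  have key := ofFn_prod_conj (S := ℤ) (W := A)
    (fun k => tpow p (h k ⊗ₜ[R] (1 : A)) ((1 : A) ⊗ₜ[R] E k)) (fun _ => {0})
    (fun _ _ => 1) (fun k _ => (1 : A) ⊗ₜ[R] ((U k ^ c k : Aˣ) : A)) (fun _ _ => 1)
    (fun a => a ⊗ₜ[R] (1 : A)) (fun k a => h k * a = a * (h k + (c k : A)))
    (fun k a ha => by
      let u : (A ⊗[R] A)ˣ := Units.map
        ((Algebra.TensorProduct.includeRight : A →ₐ[R] A ⊗[R] A) : A →* A ⊗[R] A) (U k)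
      have := tpow_mul_weight (p := p) (natCast_tensor_eq_zero hp) (x := h k ⊗ₜ[R] (1 : A))
        (y := (1 : A) ⊗ₜ[R] E k) (w := a ⊗ₜ[R] (1 : A))
        (by rw [Algebra.TensorProduct.tmul_pow, T.h_pow, one_pow])
        (by rw [Algebra.TensorProduct.tmul_pow, T.E_pow, TensorProduct.tmul_zero])
        (commute_includeLeft_includeRight _ _) (commute_includeLeft_includeRight _ _).symm (c k)
        (by
          have e : ((c k : ℤ) : A ⊗[R] A) = ((c k : ℤ) : A) ⊗ₜ[R] (1 : A) :=
            (map_intCast (Algebra.TensorProduct.includeLeft : A →ₐ[R] A ⊗[R] A) (c k)).symm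
          rw [e, ← TensorProduct.add_tmul, Algebra.TensorProduct.tmul_mul_tmul,
            Algebra.TensorProduct.tmul_mul_tmul, ha])
        u (by
          change (1 : A) ⊗ₜ[R] (U k : A) = _
          rw [hU, TensorProduct.tmul_sub]; rfl)
      rw [this, Finset.sum_singleton, one_mul, Module.End.one_apply]
      congr 2
      rw [← map_zpow]
      rfl)
    (fun j k m a _ ha => ha) (fun j k l m _ => Commute.one_left _)
    (fun j k m _ => Commute.one_right _)
    (fun j k m _ => tpow_commute (commute_includeLeft_includeRight _ _) (commute_one_tmul (hE j k)))
    (f w) hwt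
  rw [twistProd_val, key, Fintype.piFinset_singleton, Finset.sum_singleton, ofFn_prod_tmul,
    units_ofFn_prod_val]
  simp [List.ofFn_const]

/-- Conjugation of `1 ⊗ f w` by the product of the twists produces the divided powers of the
`ad (E k)` in the second tensor factor. -/
theorem twistProd_mul_one_tmul (w : W) (hw : ∀ k, M k w) :
    (T.twistProd hp : A ⊗[R] A) * ((1 : A) ⊗ₜ[R] f w) =
      (∑ m ∈ Fintype.piFinset fun _ : Fin n => Finset.range p,
        (∏ k, τ k ^ m k) • (-1 : R) ^ (∑ k, m k) •
          ((List.ofFn fun k => rising (h k) 0 (m k)).prod ⊗ₜ[R]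
            ((((List.ofFn fun k => U k ^ (-(m k : ℤ))).prod : Aˣ) : A) *
              f ((List.ofFn fun k => δ k (m k)).prod w)))) * T.twistProd hp := by
  let a : Fin n → ℕ → A ⊗[R] A := fun k m => (τ k ^ m * (-1) ^ m) •
    (rising (h k) 0 m ⊗ₜ[R] ((U k ^ (-(m : ℤ)) : Aˣ) : A))
  have hta : ∀ k m z, Commute (h k ⊗ₜ[R] (1 : A)) z → Commute ((1 : A) ⊗ₜ[R] E k) z →
      Commute (a k m) z := by
    intro k m z hz hz'
    have e : a k m = (τ k ^ m * (-1) ^ m) • (rising (h k) 0 m ⊗ₜ[R] (1 : A) *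
      (1 : A) ⊗ₜ[R] ((U k ^ (-(m : ℤ)) : Aˣ) : A)) := by simp [a]
    let u : (A ⊗[R] A)ˣ := Units.map
      ((Algebra.TensorProduct.includeRight : A →ₐ[R] A ⊗[R] A) : A →* A ⊗[R] A) (U k)
    have hu : (u : A ⊗[R] A) = 1 - (1 : A) ⊗ₜ[R] E k := by
      change (1 : A) ⊗ₜ[R] (U k : A) = _
      rw [hU, TensorProduct.tmul_sub]; rfl
    have hu' : ((u ^ (-(m : ℤ)) : (A ⊗[R] A)ˣ) : A ⊗[R] A) =
        (1 : A) ⊗ₜ[R] ((U k ^ (-(m : ℤ)) : Aˣ) : A) := by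
      rw [← map_zpow]; rfl
    rw [e, ← rising_tmul_one, ← hu']
    refine ((rising_commute hz 0 m).mul_left ?_).smul_left _
    refine (Commute.units_zpow_right ?_ _).symm
    rw [hu]
    exact (Commute.one_right _).sub_right hz'.symm
  have key := ofFn_prod_conj
    (fun k => tpow p (h k ⊗ₜ[R] (1 : A)) ((1 : A) ⊗ₜ[R] E k)) (fun _ => Finset.range p)
    a (fun _ _ => 1) δ
    (fun w => (1 : A) ⊗ₜ[R] f w) M
    (fun k w hw => by
      let u : (A ⊗[R] A)ˣ := Units.map
        ((Algebra.TensorProduct.includeRight : A →ₐ[R] A ⊗[R] A) : A →* A ⊗[R] A) (U k)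
      have := tpow_mul_divSeq (p := p) (natCast_tensor_eq_zero hp) (x := h k ⊗ₜ[R] (1 : A))
        (y := (1 : A) ⊗ₜ[R] E k) (d := fun m => (1 : A) ⊗ₜ[R] (τ k ^ m • f (δ k m w)))
        (by rw [Algebra.TensorProduct.tmul_pow, T.h_pow, one_pow])
        (by rw [Algebra.TensorProduct.tmul_pow, T.E_pow, TensorProduct.tmul_zero])
        (commute_includeLeft_includeRight _ _)
        (fun m hm => by
          have e : ((m + 1 : ℕ) : A ⊗[R] A) = (1 : A) ⊗ₜ[R] ((m + 1 : ℕ) : A) :=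
            (map_natCast (Algebra.TensorProduct.includeRight : A →ₐ[R] A ⊗[R] A) (m + 1)).symm
          simp only [e, Algebra.TensorProduct.tmul_mul_tmul, one_mul, ← TensorProduct.tmul_sub]
          exact congrArg _ (D.divSeq k w m hm))
        (fun m => commute_includeLeft_includeRight _ _)
        u (by
          change (1 : A) ⊗ₜ[R] (U k : A) = _
          rw [hU, TensorProduct.tmul_sub]; rfl)
      simp only [pow_zero, one_smul, D.zero, Module.End.one_apply] at this
      rw [this]
      congr 1
      refine Finset.sum_congr rfl fun m _ => ?_
      have hu' : ((u ^ (-(m : ℤ)) : (A ⊗[R] A)ˣ) : A ⊗[R] A) =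
          (1 : A) ⊗ₜ[R] ((U k ^ (-(m : ℤ)) : Aˣ) : A) := by
        rw [← map_zpow]; rfl
      have hs : (-1 : A ⊗[R] A) ^ m = (-1 : R) ^ m • (1 : A ⊗[R] A) := by
        rw [← Algebra.algebraMap_eq_smul_one, map_pow, map_neg, map_one]
      rw [hu', rising_tmul_one, hs, mul_one]
      simp only [a, TensorProduct.tmul_smul, mul_smul_comm, smul_mul_assoc, one_mul, mul_one,
        Algebra.TensorProduct.tmul_mul_tmul, mul_smul])
    D.stable
    (fun j k l m hjk => hta _ _ _ (hta _ _ _ (commute_tmul_one (T.commute_h _ _))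
        (commute_includeLeft_includeRight _ _).symm).symm
      (hta _ _ _ (commute_includeLeft_includeRight _ _) (commute_one_tmul (T.commute_E _ _))).symm)
    (fun j k m hjk => (hta _ _ _ (tpow_commute (commute_tmul_one (T.commute_h _ _))
        (commute_includeLeft_includeRight _ _).symm).symm
      (tpow_commute (commute_includeLeft_includeRight _ _)
        (commute_one_tmul (T.commute_E _ _))).symm).symm)
    (fun j k m _ => Commute.one_right _) w hw
  rw [twistProd_val, key]
  congr 1
  refine Finset.sum_congr rfl fun m _ => ?_
  simp only [a]
  rw [ofFn_prod_smul, ofFn_prod_tmul, Finset.prod_mul_distrib, Finset.prod_pow_eq_pow_sum,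
    units_ofFn_prod_val, mul_smul]
  simp [List.ofFn_const, Algebra.TensorProduct.tmul_mul_tmul]

/-- Conjugation of `f w` by the product of the normally ordered powers, for `f w` of weight `c`. -/
theorem antipodeProd_mul (w : W) (hw : ∀ k, M k w) :
    (T.antipodeProd hp : A) * f w = (((List.ofFn fun k => U k ^ (-c k)).prod : Aˣ) : A) *
      (∑ m ∈ Fintype.piFinset fun _ : Fin n => Finset.range p, (∏ k, τ k ^ m k) •
        (f ((List.ofFn fun k => δ k (m k)).prod w) *
          (List.ofFn fun k => rising (h k) 1 (m k)).prod)) * T.antipodeProd hp := by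
  have hcU : ∀ z k (c : ℤ), Commute (E k) z → Commute z ((U k ^ c : Aˣ) : A) := fun z k c hz => by
    refine Commute.units_zpow_right ?_ _
    rw [hU]
    exact (Commute.one_right _).sub_right hz.symm
  have key := ofFn_prod_conj
    (fun k => tpow p (h k) (-E k)) (fun _ => Finset.range p)
    (fun k _ => ((U k ^ (-c k) : Aˣ) : A)) (fun k m => τ k ^ m • rising (h k) 1 m) δ f M
    (fun k w hw => by
      have hny : (-E k) ^ p = 0 := by rw [neg_pow, T.E_pow, mul_zero]
      have := tpow_neg_mul_divSeq (p := p) hp (T.h_pow k) (T.E_pow k) (T.h_mul_E k) (D.divSeq k w)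
        (c k) (fun m => by rw [mul_smul_comm, D.weight k m w hw, smul_mul_assoc]) (U k)
        (oneSubUnit hp hny) (hU k) (sub_neg_eq_add _ _)
      simp only [pow_zero, one_smul, D.zero, Module.End.one_apply] at this
      rw [this, Finset.mul_sum]
      congr 1
      refine Finset.sum_congr rfl fun m _ => ?_
      rw [smul_mul_assoc, mul_smul_comm, mul_smul_comm, mul_assoc])
    D.stable
    (fun j k l m hjk => hcU _ _ _ (hcU _ _ _ (T.commute_E _ _)))
    (fun j k m hjk => hcU _ _ _ (tpow_commute (T.commute_h_E _ _ hjk)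
      (T.commute_E _ _).neg_left).symm)
    (fun j k m hjk => ((rising_commute (tpow_commute (T.commute_h _ _)
      (T.commute_h_E _ _ hjk.symm).symm.neg_left).symm 1 m).symm).smul_right _) w hw
  rw [antipodeProd_val, key, units_ofFn_prod_val, Finset.mul_sum]
  congr 1
  refine Finset.sum_congr rfl fun m _ => ?_
  rw [ofFn_prod_smul, mul_smul_comm, mul_smul_comm, mul_assoc]

end IsToralFamily

end WeightConjugation

/-! ### The Jacobson-Witt algebra and its action on `O(n;1)` -/

section JacobsonWitt

variable {n p : ℕ} {K : Type*} [Field K]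

namespace RDP

theorem coeff_sum {ι : Type*} (s : Finset ι) (f : ι → RDP n p K) (γ) :
    (∑ a ∈ s, f a).coeff γ = ∑ a ∈ s, (f a).coeff γ := by
  induction s using Finset.cons_induction with
  | empty => simp
  | cons a s ha ih => rw [Finset.sum_cons, Finset.sum_cons, add_apply, ih]

theorem dpow_single_mul (i : Fin n) (b : Fin n → ℕ) :
    dpow n p K (Pi.single i 1) * dpow n p K b =
      ((b i + 1 : ℕ) : K) • dpow n p K (b + Pi.single i 1) := by
  rw [dpow_mul_dpow', add_comm b, Finset.prod_eq_single i]
  · simp [add_comm]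
  · intro j _ hj
    simp [hj]
  · simp

variable [Fact p.Prime]

theorem single_lt {i : Fin n} (j : Fin n) : (Pi.single i 1 : Fin n → ℕ) j < p := by
  have := (Fact.out : p.Prime).one_lt
  by_cases h : j = i
  · subst h; simpa
  · simp [h]; omega

variable [CharP K p]

omit [Fact p.Prime] in
theorem natCast_ne_zero {a : ℕ} (h0 : a ≠ 0) (ha : a < p) : (a : K) ≠ 0 := by
  rw [Ne, CharP.cast_eq_zero_iff K p]
  exact fun h => h0 (Nat.eq_zero_of_dvd_of_lt h ha)

theorem partialDer_dpow (i : Fin n) {a : Fin n → ℕ} (ha : ∀ j, a j < p) :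
    partialDer n p K i (dpow n p K a) =
      if a i = 0 then 0 else dpow n p K (a - Pi.single i 1) :=
  partialLin_dpow i ha

theorem partialDer_dpow_eq_zero (i : Fin n) {a : Fin n → ℕ} (ha : a i = 0) :
    partialDer n p K i (dpow n p K a) = 0 := by
  by_cases h : ∀ j, a j < p
  · rw [partialDer_dpow i h, if_pos ha]
  · rw [dpow_eq_zero h, map_zero]

theorem partialDer_gen (i j : Fin n) :
    partialDer n p K i (dpow n p K (Pi.single j 1)) = if i = j then 1 else 0 := by
  rw [partialDer_dpow i fun k => single_lt k]
  by_cases h : i = j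
  · subst h
    rw [if_neg (by simp), if_pos rfl, one_def]
    simp
  · rw [if_neg h, if_pos (by simp [h])]

theorem euler_dpow (k : Fin n) (a : Fin n → ℕ) :
    dpow n p K (Pi.single k 1) * partialDer n p K k (dpow n p K a) = (a k : K) • dpow n p K a := by
  by_cases h : ∀ j, a j < p
  · rw [partialDer_dpow k h]
    split_ifs with h0
    · simp [h0]
    · rw [dpow_single_mul]
      have e : (a - Pi.single k 1 : Fin n → ℕ) + Pi.single k 1 = a := by
        funext j
        by_cases hj : j = k
        · subst hj; simp; omega
        · simp [hj]
      have e' : (a - Pi.single k 1 : Fin n → ℕ) k + 1 = a k := by simp; omega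
      rw [e, e']
  · rw [dpow_eq_zero h, map_zero, mul_zero, smul_zero]

end RDP

open RDP

variable [Fact p.Prime]

/-- A derivation of `O(n;1)` is determined by its values on the `x^(ε_j)`: since
`a_i x^(a) = x^(ε_i) x^(a - ε_i)` with `0 < a_i < p`, these elements generate the algebra. -/
theorem JW.ext_gen [CharP K p] {D D' : JW n p K}
    (h : ∀ j, D (dpow n p K (Pi.single j 1)) = D' (dpow n p K (Pi.single j 1))) : D = D' := by
  ext1 f
  induction f using RDP.induction_on with
  | h0 => simp
  | ha f g hf hg => rw [map_add, map_add, hf, hg]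
  | hs c f hf => rw [D.map_smul, D'.map_smul, hf]
  | hd a ha =>
    obtain ⟨N, hN⟩ : ∃ N, ∑ i, a i = N := ⟨_, rfl⟩
    induction N generalizing a with
    | zero =>
      have : a = 0 := by
        funext i
        exact (Finset.sum_eq_zero_iff.1 hN) i (Finset.mem_univ i)
      rw [this, ← one_def, Derivation.map_one_eq_zero, Derivation.map_one_eq_zero]
    | succ N ih =>
      obtain ⟨i, hi⟩ : ∃ i, a i ≠ 0 := by
        by_contra! hc
        simp [hc] at hN
      have e : (a - Pi.single i 1 : Fin n → ℕ) + Pi.single i 1 = a := by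
        funext j
        by_cases hj : j = i
        · subst hj; simp; omega
        · simp [hj]
      have e' : (a - Pi.single i 1 : Fin n → ℕ) i + 1 = a i := by simp; omega
      have hmul := dpow_single_mul (p := p) (K := K) i (a - Pi.single i 1)
      rw [e, e'] at hmul
      have hsum : ∑ j, (a - Pi.single i 1 : Fin n → ℕ) j = N := by
        have : ∑ j, ((a - Pi.single i 1 : Fin n → ℕ) + (Pi.single i 1 : Fin n → ℕ)) j = N + 1 := by
          rw [e, hN]
        simp only [Pi.add_apply, Finset.sum_add_distrib, Finset.sum_pi_single', Finset.mem_univ,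
          if_true] at this
        omega
      have ih' := ih (a - Pi.single i 1) (fun j => lt_of_le_of_lt (by simp) (ha j)) hsum
      have h0 := natCast_ne_zero (K := K) hi (ha i)
      have key : (a i : K) • D (dpow n p K a) = (a i : K) • D' (dpow n p K a) := by
        rw [← D.map_smul, ← D'.map_smul, ← hmul, Derivation.leibniz, Derivation.leibniz, ih', h]
      exact smul_right_injective _ h0 key

variable [CharP K p]

theorem xD_apply (a : Fin n → ℕ) (i : Fin n) (f : RDP n p K) :
    xD n p K a i f = dpow n p K a * partialDer n p K i f := rfl

theorem xD_gen (a : Fin n → ℕ) (i j : Fin n) :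
    xD n p K a i (dpow n p K (Pi.single j 1)) = if i = j then dpow n p K a else 0 := by
  rw [xD_apply, partialDer_gen]
  split_ifs <;> simp

/-- `x^(α) D_i` has weight `α_k - δ_{ik}` with respect to `x^(ε_k) D_k`. -/
theorem lie_euler_xD (k : Fin n) (a : Fin n → ℕ) (i : Fin n) :
    ⁅xD n p K (Pi.single k 1) k, xD n p K a i⁆ =
      (((a k : ℤ) - if i = k then 1 else 0 : ℤ) : K) • xD n p K a i := by
  apply JW.ext_gen
  intro j
  rw [Derivation.commutator_apply, xD_gen, xD_gen, Derivation.smul_apply, xD_gen]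
  by_cases hij : i = j
  · subst hij
    rw [if_pos rfl, xD_apply, euler_dpow]
    by_cases hk : k = i
    · subst hk
      rw [if_pos rfl, xD_gen, if_pos rfl]
      simp [sub_smul]
    · rw [if_neg hk, if_neg (Ne.symm hk), map_zero]
      simp
  · rw [if_neg hij, map_zero]
    by_cases hk : k = j
    · subst hk
      rw [if_pos rfl, xD_gen, if_neg hij]
      simp
    · rw [if_neg hk]
      simp

theorem lie_xD_eq_zero {a b : Fin n → ℕ} {i j : Fin n} (ha : a j = 0) (hb : b i = 0) :
    ⁅xD n p K a i, xD n p K b j⁆ = 0 := by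
  apply JW.ext_gen
  intro l
  have h1 : xD n p K a i (dpow n p K b) = 0 := by
    rw [xD_apply, partialDer_dpow_eq_zero i hb, mul_zero]
  have h2 : xD n p K b j (dpow n p K a) = 0 := by
    rw [xD_apply, partialDer_dpow_eq_zero j ha, mul_zero]
  rw [Derivation.commutator_apply, xD_gen, xD_gen]
  split_ifs <;> simp [h1, h2]

/-- The `x^(α) D_i` span `W(n;1)`, with the values at the `x^(ε_i)` as coefficients. -/
theorem JW.eq_sum (D : JW n p K) :
    D = ∑ b : (Fin n → Fin p) × Fin n,
      (D (dpow n p K (Pi.single b.2 1))).coeff b.1 • xD n p K (fun i => (b.1 i : ℕ)) b.2 := by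
  apply JW.ext_gen
  intro j
  have : ∀ (s : Finset ((Fin n → Fin p) × Fin n)) (g : (Fin n → Fin p) × Fin n → JW n p K) f,
      (∑ b ∈ s, g b) f = ∑ b ∈ s, g b f := by
    intro s g f
    induction s using Finset.cons_induction with
    | empty => simp
    | cons a s ha ih => rw [Finset.sum_cons, Finset.sum_cons, Derivation.add_apply, ih]
  rw [this, Fintype.sum_prod_type]
  simp only [Derivation.smul_apply, xD_gen, smul_ite, smul_zero]
  conv_lhs => rw [RDP.eq_sum (D (dpow n p K (Pi.single j 1)))]
  refine Finset.sum_congr rfl fun a _ => ?_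
  simp

variable (n p K) in
theorem xD_linearIndependent : LinearIndependent K fun b : (Fin n → Fin p) × Fin n =>
    xD n p K (fun i => (b.1 i : ℕ)) b.2 := by
  rw [Fintype.linearIndependent_iff]
  intro g hg b
  have : ∀ (s : Finset ((Fin n → Fin p) × Fin n)) (g : (Fin n → Fin p) × Fin n → JW n p K) f,
      (∑ b ∈ s, g b) f = ∑ b ∈ s, g b f := by
    intro s g f
    induction s using Finset.cons_induction with
    | empty => simp
    | cons a s ha ih => rw [Finset.sum_cons, Finset.sum_cons, Derivation.add_apply, ih]
  have h := congrArg (fun D : JW n p K => (D (dpow n p K (Pi.single b.2 1))).coeff b.1) hg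
  simp only [this, Derivation.smul_apply, xD_gen, coeff_sum, RDP.smul_apply, Derivation.zero_apply,
    RDP.zero_apply] at h
  rw [Finset.sum_eq_single b] at h
  · simpa [dpow_fin] using h
  · intro c _ hc
    split_ifs with h2
    · have h1 : b.1 ≠ c.1 := fun h1 => hc (Prod.ext h1.symm h2)
      rw [dpow_fin, if_neg h1, mul_zero]
    · rw [RDP.zero_apply, mul_zero]
  · simp

omit [CharP K p] in
/-- A linear operator on `O(n;1)` which raises a bounded degree function on the monomials is
nilpotent. -/
theorem pow_eq_zero_of_raises (T : Module.End K (RDP n p K)) (g : (Fin n → Fin p) → ℕ)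
    (hg : ∀ γ, g γ < p)
    (hT : ∀ β γ : Fin n → Fin p, (T (dpow n p K fun i => (β i : ℕ))).coeff γ ≠ 0 → g β < g γ) :
    T ^ p = 0 := by
  have key : ∀ s f γ, ((T ^ s) f).coeff γ ≠ 0 → s ≤ g γ := by
    intro s
    induction s with
    | zero => intro f γ _; exact Nat.zero_le _
    | succ s ih =>
      intro f γ h
      rw [pow_succ', Module.End.mul_apply, RDP.eq_sum ((T ^ s) f), map_sum, coeff_sum] at h
      obtain ⟨β, _, hβ⟩ := Finset.exists_ne_zero_of_sum_ne_zero h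
      rw [map_smul, RDP.smul_apply] at hβ
      have h1 := ih f β (left_ne_zero_of_mul hβ)
      have h2 := hT β γ (right_ne_zero_of_mul hβ)
      omega
  ext f γ
  by_contra h
  have h1 := key p f γ h
  have h2 := hg γ
  omega

theorem xD_dpow_coeff_ne_zero {a : Fin n → ℕ} {i : Fin n} {β γ : Fin n → Fin p}
    (h : (xD n p K a i (dpow n p K fun i => (β i : ℕ))).coeff γ ≠ 0) :
    (β i : ℕ) ≠ 0 ∧ ∀ j, (γ j : ℕ) + (if j = i then 1 else 0) = a j + β j := by
  rw [xD_apply, partialDer_dpow i fun j => (β j).2] at h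
  split_ifs at h with h0
  · rw [mul_zero] at h
    exact absurd rfl h
  · refine ⟨h0, fun j => ?_⟩
    rw [dpow_mul_dpow', RDP.smul_apply] at h
    have h1 := right_ne_zero_of_mul h
    simp only [dpow, ne_eq, ite_eq_right_iff, one_ne_zero, imp_false, not_not] at h1
    have := h1 j
    by_cases hj : j = i
    · subst hj
      simp at this ⊢
      omega
    · simp [hj] at this ⊢
      omega

/-- The relation `(x^(α) D_i)^p = 0` for `α ≠ ε_i` holds for the action on `O(n;1)`: the operator
raises the degree in some variable `x_j` with `j ≠ i`, or it lowers or raises the degree in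
`x_i`. -/
theorem xD_pow_eq_zero {a : Fin n → ℕ} {i : Fin n} (h : a ≠ Pi.single i 1) :
    ((xD n p K a i : JW n p K) : Module.End K (RDP n p K)) ^ p = 0 := by
  by_cases h1 : ∃ j, j ≠ i ∧ a j ≠ 0
  · obtain ⟨j, hj, hj'⟩ := h1
    refine pow_eq_zero_of_raises _ (fun γ => γ j) (fun γ => (γ j).2) fun β γ hβ => ?_
    have := (xD_dpow_coeff_ne_zero hβ).2 j
    simp only [hj, if_false] at this
    omega
  · push Not at h1
    by_cases h0 : a i = 0
    · refine pow_eq_zero_of_raises _ (fun γ => p - 1 - γ i)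
        (fun γ => by have := (Fact.out : p.Prime).pos; omega) fun β γ hβ => ?_
      have := (xD_dpow_coeff_ne_zero hβ).2 i
      simp only [if_true] at this
      have := (β i).2
      have := (γ i).2
      omega
    · have h2 : a i ≠ 1 := by
        intro h2
        apply h
        funext j
        by_cases hj : j = i
        · subst hj; simpa
        · simp [hj, h1 j hj]
      refine pow_eq_zero_of_raises _ (fun γ => γ i) (fun γ => (γ i).2) fun β γ hβ => ?_
      have := (xD_dpow_coeff_ne_zero hβ).2 i
      simp only [if_true] at this
      omega

/-- The relation `(x^(ε_i) D_i)^p = x^(ε_i) D_i` holds for the action on `O(n;1)`, by Fermat's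
little theorem. -/
theorem euler_pow (i : Fin n) :
    ((xD n p K (Pi.single i 1) i : JW n p K) : Module.End K (RDP n p K)) ^ p =
      ((xD n p K (Pi.single i 1) i : JW n p K) : Module.End K (RDP n p K)) := by
  apply LinearMap.ext
  intro f
  induction f using RDP.induction_on with
  | h0 => simp
  | ha f g hf hg => rw [map_add, map_add, hf, hg]
  | hs c f hf => rw [map_smul, map_smul, hf]
  | hd a ha =>
    have h1 : ((xD n p K (Pi.single i 1) i : JW n p K) : Module.End K (RDP n p K))
        (dpow n p K a) = (a i : K) • dpow n p K a := euler_dpow i a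
    have h2 : ∀ s : ℕ, (((xD n p K (Pi.single i 1) i : JW n p K) : Module.End K (RDP n p K)) ^ s)
        (dpow n p K a) = (a i : K) ^ s • dpow n p K a := by
      intro s
      induction s with
      | zero => simp
      | succ s ih => rw [pow_succ', Module.End.mul_apply, ih, map_smul, h1, smul_smul, pow_succ]
    rw [h2, h1]
    congr 1
    have := TruncPow.natCast_eq_of_zmod (B := K) (p := p) (a := a i ^ p) (b := a i) (by simp)
      (by simp)
    simpa using this

variable (n p K) in
/-- The action of `u(W(n;1))` on `O(n;1)` extending the tautological action of `W(n;1)`. -/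
def tautAction : RestrEnv n p K →ₐ[K] Module.End K (RDP n p K) :=
  RestrEnv.lift
    { toFun := fun D => (D : Module.End K (RDP n p K))
      map_add' := fun _ _ => rfl
      map_smul' := fun _ _ => rfl }
    (fun _ _ => rfl) (fun i => euler_pow i) (fun _ _ h => xD_pow_eq_zero h)

theorem tautAction_ι (D : JW n p K) (f : RDP n p K) :
    tautAction n p K (RestrEnv.ι n p K D) f = D f :=
  LinearMap.congr_fun (RestrEnv.lift_ι _ _ _ _ D) f

variable (n p K) in
/-- `W(n;1)` embeds into `u(W(n;1))`, since the latter acts on `O(n;1)` extending the faithful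
action of `W(n;1)`. -/
theorem RestrEnv.ι_injective : Function.Injective (RestrEnv.ι n p K) := by
  intro D D' h
  ext1 f
  rw [← tautAction_ι, h, tautAction_ι]

end JacobsonWitt

/-! ### Ordered monomials in primitive elements -/

section OrderedMonomials

variable {N p : ℕ} {K A : Type*} [Field K]

/-- The ordered monomial `y₀^{m₀} y₁^{m₁} ⋯`. -/
def orderedMonomial [Ring A] (y : Fin N → A) (m : Fin N → ℕ) : A :=
  (List.ofFn fun k => y k ^ m k).prod

theorem orderedMonomial_zero [Ring A] (y : Fin N → A) : orderedMonomial y 0 = 1 := by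
  simp [orderedMonomial, List.ofFn_const]

theorem orderedMonomial_single [Ring A] (y : Fin N → A) (b : Fin N) (r : ℕ) :
    orderedMonomial y (Pi.single b r) = y b ^ r := by
  rw [orderedMonomial]
  induction N with
  | zero => exact b.elim0
  | succ N ih =>
    rw [List.ofFn_succ, List.prod_cons]
    refine Fin.cases ?_ (fun b => ?_) b
    · rw [Pi.single_eq_same]
      have : (fun k : Fin N => y k.succ ^ (Pi.single 0 r : Fin (N + 1) → ℕ) k.succ) =
          fun _ => 1 := by
        funext k
        simp
      rw [this]
      simp [List.ofFn_const]
    · have : (fun k : Fin N => y k.succ ^ (Pi.single b.succ r : Fin (N + 1) → ℕ) k.succ) =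
          fun k => y k.succ ^ (Pi.single b r : Fin N → ℕ) k := by
        funext k
        by_cases h : k = b
        · subst h; simp
        · have : k.succ ≠ b.succ := fun e => h (Fin.succ_injective N e)
          simp [h]
      rw [this, ih (fun k => y k.succ) b, Pi.single_eq_of_ne (Fin.succ_ne_zero b).symm, pow_zero,
        one_mul]

section Independence

variable [Ring A] [Bialgebra K A] {y : Fin N → A}

theorem comul_orderedMonomial
    (hy : ∀ b, Bialgebra.comulAlgHom K A (y b) = y b ⊗ₜ 1 + 1 ⊗ₜ y b) (m : Fin N → ℕ) :
    Bialgebra.comulAlgHom K A (orderedMonomial y m) =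
      ∑ i ∈ Fintype.piFinset fun k => Finset.range (m k + 1),
        (∏ k, ((m k).choose (i k) : K)) •
          (orderedMonomial y i ⊗ₜ[K] orderedMonomial y (m - i)) := by
  have h : ∀ k, Bialgebra.comulAlgHom K A (y k ^ m k) =
      ∑ i ∈ Finset.range (m k + 1), ((m k).choose i : K) • ((y k ^ i) ⊗ₜ[K] (y k ^ (m k - i))) := by
    intro k
    rw [map_pow, hy, (commute_includeLeft_includeRight (y k) (y k)).add_pow]
    refine Finset.sum_congr rfl fun i _ => ?_
    rw [Algebra.TensorProduct.tmul_pow, Algebra.TensorProduct.tmul_pow, one_pow, one_pow,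
      Algebra.TensorProduct.tmul_mul_tmul, one_mul, mul_one, ← (Nat.cast_commute _ _).eq,
      ← nsmul_eq_mul, Nat.cast_smul_eq_nsmul]
  rw [orderedMonomial, map_list_prod, List.map_ofFn, Function.comp_def]
  simp only [h]
  rw [ofFn_prod_sum]
  refine Finset.sum_congr rfl fun i _ => ?_
  rw [ofFn_prod_smul, ofFn_prod_tmul]
  rfl

theorem counit_orderedMonomial (hy : ∀ b, Bialgebra.counitAlgHom K A (y b) = 0)
    (m : Fin N → ℕ) :
    Bialgebra.counitAlgHom K A (orderedMonomial y m) = if m = 0 then 1 else 0 := by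
  split_ifs with h
  · rw [h, orderedMonomial_zero, map_one]
  · obtain ⟨b, hb⟩ := Function.ne_iff.1 h
    rw [orderedMonomial, map_list_prod, List.map_ofFn, List.prod_eq_zero]
    rw [List.mem_ofFn']
    exact ⟨b, (by rw [map_pow, hy, zero_pow hb] :
      Bialgebra.counitAlgHom K A (y b ^ m b) = 0)⟩

theorem exists_dual_of_linearIndependent {V ι : Type*} [AddCommGroup V] [Module K V]
    [DecidableEq ι] {v : ι → V} (hv : LinearIndependent K v) (i : ι) :
    ∃ φ : V →ₗ[K] K, ∀ j, φ (v j) = if j = i then 1 else 0 := by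
  obtain ⟨g, hg⟩ := LinearMap.exists_leftInverse_of_injective (Finsupp.linearCombination K v)
    (LinearMap.ker_eq_bot.2 hv)
  refine ⟨Finsupp.lapply i ∘ₗ g, fun j => ?_⟩
  have := LinearMap.congr_fun hg (Finsupp.single j 1)
  simp only [LinearMap.comp_apply, Finsupp.linearCombination_single, one_smul,
    LinearMap.id_apply] at this
  rw [LinearMap.comp_apply, this, Finsupp.lapply_apply, Finsupp.single_apply]

/-- The exponents `m` with all `m k < p` and total degree at most `d`. -/
def boundedExponents (N p d : ℕ) : Finset (Fin N → ℕ) :=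
  (Fintype.piFinset fun _ => Finset.range p).filter fun m => ∑ k, m k ≤ d

theorem mem_boundedExponents {d : ℕ} {m : Fin N → ℕ} :
    m ∈ boundedExponents N p d ↔ (∀ k, m k < p) ∧ ∑ k, m k ≤ d := by
  simp [boundedExponents]

/-- Ordered monomials with exponents below `p` in linearly independent primitive elements of a
bialgebra in characteristic `p` have dual functionals, hence are linearly independent. The proof is
by induction on the degree: a monomial of degree `d + 1` is detected by the coefficient of
`y_b ⊗ y^{m - ε_b}` in its coproduct, which is `m_b ≠ 0`. -/
theorem exists_dual_orderedMonomial [Fact p.Prime] [CharP K p] (hli : LinearIndependent K y)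
    (hc : ∀ b, Bialgebra.comulAlgHom K A (y b) = y b ⊗ₜ 1 + 1 ⊗ₜ y b)
    (he : ∀ b, Bialgebra.counitAlgHom K A (y b) = 0) (d : ℕ) :
    ∀ i ∈ boundedExponents N p (d + 1), ∃ φ : A →ₗ[K] K,
      ∀ j ∈ boundedExponents N p (d + 1), φ (orderedMonomial y j) = if j = i then 1 else 0 := by
  have hε : ∀ j : Fin N → ℕ, (Bialgebra.counitAlgHom K A).toLinearMap (orderedMonomial y j) =
      if j = 0 then 1 else 0 := counit_orderedMonomial he
  -- a nonzero exponent contains some `ε_b`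
  have hpos : ∀ m : Fin N → ℕ, m ≠ 0 → 1 ≤ ∑ k, m k := by
    intro m hm
    by_contra h
    apply hm
    funext k
    have : ∑ k, m k = 0 := by omega
    exact (Finset.sum_eq_zero_iff.1 this) k (Finset.mem_univ k)
  have hsub : ∀ (m : Fin N → ℕ) (a : Fin N → ℕ), (∀ k, a k ≤ m k) →
      ∑ k, a k + ∑ k, (m - a) k = ∑ k, m k := by
    intro m a ha
    rw [← Finset.sum_add_distrib]
    exact Finset.sum_congr rfl fun k _ => Nat.add_sub_cancel' (ha k)
  induction d with
  | zero =>
    intro i hi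
    by_cases hi0 : i = 0
    · exact ⟨_, fun j _ => by rw [hε, hi0]⟩
    have hsingle : ∀ m ∈ boundedExponents N p (0 + 1), m ≠ 0 → ∃ b, m = Pi.single b 1 := by
      intro m hm hm0
      obtain ⟨b, hb⟩ := Function.ne_iff.1 hm0
      refine ⟨b, ?_⟩
      have h1 := (mem_boundedExponents.1 hm).2
      have hb' : 1 ≤ m b := Nat.one_le_iff_ne_zero.2 hb
      have hle : ∀ k, (Pi.single b 1 : Fin N → ℕ) k ≤ m k := by
        intro k
        by_cases hk : k = b
        · subst hk; simpa
        · simp [hk]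
      have h2 := hsub m (Pi.single b 1) hle
      simp only [Finset.sum_pi_single', Finset.mem_univ, if_true] at h2
      have h3 : m - Pi.single b 1 = 0 := by
        by_contra h
        have := hpos _ h
        omega
      funext k
      have := congrFun h3 k
      have := hle k
      simp only [Pi.sub_apply, Pi.zero_apply] at *
      omega
    obtain ⟨b, rfl⟩ := hsingle i hi hi0
    obtain ⟨φ, hφ⟩ := exists_dual_of_linearIndependent hli b
    refine ⟨φ - φ 1 • (Bialgebra.counitAlgHom K A).toLinearMap, fun j hj => ?_⟩
    rw [LinearMap.sub_apply, LinearMap.smul_apply, hε]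
    by_cases hj0 : j = 0
    · subst hj0
      rw [if_pos rfl, if_neg (Ne.symm hi0), orderedMonomial_zero, smul_eq_mul, mul_one, sub_self]
    · obtain ⟨b', rfl⟩ := hsingle j hj hj0
      rw [if_neg hj0, smul_zero, sub_zero, orderedMonomial_single, pow_one, hφ]
      congr 1
      refine propext ⟨fun h => by rw [h], fun h => ?_⟩
      by_contra hne
      have := congrFun h b'
      simp [hne] at this
  | succ d ih =>
    have hdown : ∀ m ∈ boundedExponents N p (d + 1 + 1), ∀ a : Fin N → ℕ, (∀ k, a k ≤ m k) →
        m - a ≠ 0 → a ∈ boundedExponents N p (d + 1) := by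
      intro m hm a ha hma
      obtain ⟨h1, h2⟩ := mem_boundedExponents.1 hm
      have h3 := hsub m a ha
      have h4 := hpos _ hma
      exact mem_boundedExponents.2 ⟨fun k => lt_of_le_of_lt (ha k) (h1 k), by omega⟩
    -- linear independence in degree `d + 2`
    have hli' : LinearIndepOn K (orderedMonomial y)
        (boundedExponents N p (d + 1 + 1) : Set (Fin N → ℕ)) := by
      rw [linearIndepOn_finset_iff]
      intro f hf
      have htop : ∀ m ∈ boundedExponents N p (d + 1 + 1), m ∉ boundedExponents N p (d + 1) →
          f m = 0 := by
        intro m hm hm'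
        have hmd : ∑ k, m k = d + 1 + 1 := by
          rw [mem_boundedExponents] at hm hm'
          have : ¬ ∑ k, m k ≤ d + 1 := fun h => hm' ⟨hm.1, h⟩
          have := hm.2
          omega
        obtain ⟨b, hb⟩ : ∃ b, m b ≠ 0 := by
          by_contra! hc
          simp [hc] at hmd
        have hle : ∀ k, (Pi.single b 1 : Fin N → ℕ) k ≤ m k := by
          intro k
          by_cases hk : k = b
          · subst hk
            rw [Pi.single_eq_same]
            omega
          · simp [hk]
        have hs := hsub m _ hle
        simp only [Finset.sum_pi_single', Finset.mem_univ, if_true] at hs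
        have hj0 : m - Pi.single b 1 ≠ 0 := by
          intro h
          rw [h] at hs
          simp at hs
          omega
        have hi0 : (Pi.single b 1 : Fin N → ℕ) ≠ 0 := by simp
        have hi : (Pi.single b 1 : Fin N → ℕ) ∈ boundedExponents N p (d + 1) :=
          hdown m hm _ hle hj0
        have hmm : m - (m - Pi.single b 1) = Pi.single b 1 := by
          funext k
          have := hle k
          simp only [Pi.sub_apply]
          omega
        have hj : m - Pi.single b 1 ∈ boundedExponents N p (d + 1) :=
          hdown m hm _ (fun k => by simp) (by rw [hmm]; exact hi0)
        obtain ⟨φ, hφ⟩ := ih _ hi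
        obtain ⟨ψ, hψ⟩ := ih _ hj
        have h0 : (0 : Fin N → ℕ) ∈ boundedExponents N p (d + 1) :=
          mem_boundedExponents.2 ⟨fun k => (Fact.out : p.Prime).pos, by simp⟩
        let L : A →ₗ[K] K := LinearMap.mul' K K ∘ₗ TensorProduct.map φ ψ ∘ₗ
          (Bialgebra.comulAlgHom K A).toLinearMap
        have hterm : ∀ m' ∈ boundedExponents N p (d + 1 + 1), ∀ a : Fin N → ℕ, (∀ k, a k ≤ m' k) →
            φ (orderedMonomial y a) * ψ (orderedMonomial y (m' - a)) =
              if a = Pi.single b 1 ∧ m' - a = m - Pi.single b 1 then 1 else 0 := by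
          intro m' hm' a ha
          by_cases ha0 : a = 0
          · rw [ha0, hφ 0 h0, if_neg hi0.symm, zero_mul, if_neg]
            exact fun h => hi0 h.1.symm
          by_cases hma : m' - a = 0
          · rw [hma, hψ 0 h0, if_neg hj0.symm, mul_zero, if_neg]
            exact fun h => hj0 h.2.symm
          have hmm' : m' - (m' - a) = a := by
            funext k
            have := ha k
            simp only [Pi.sub_apply]
            omega
          rw [hφ a (hdown m' hm' a ha hma), hψ _ (hdown m' hm' (m' - a) (fun k => by simp)
            (by rw [hmm']; exact ha0))]
          by_cases h1 : a = Pi.single b 1 <;> by_cases h2 : m' - a = m - Pi.single b 1 <;>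
            simp [h1, h2]
        have hL : ∀ m' ∈ boundedExponents N p (d + 1 + 1), L (orderedMonomial y m') =
            if m' = m then (m b : K) else 0 := by
          intro m' hm'
          simp only [L, LinearMap.comp_apply, AlgHom.toLinearMap_apply]
          rw [comul_orderedMonomial hc, map_sum, map_sum]
          have hle' : ∀ a ∈ Fintype.piFinset fun k => Finset.range (m' k + 1),
              ∀ k, a k ≤ m' k := fun a ha k => by
            have := Fintype.mem_piFinset.1 ha k
            rw [Finset.mem_range] at this
            omega
          simp only [map_smul, TensorProduct.map_tmul, LinearMap.mul'_apply]
          rw [Finset.sum_congr rfl fun a ha => by rw [hterm m' hm' a (hle' a ha)]]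
          split_ifs with hmm'
          · subst hmm'
            rw [Finset.sum_eq_single (Pi.single b 1)]
            · rw [if_pos ⟨rfl, rfl⟩, smul_eq_mul, mul_one, Finset.prod_eq_single b]
              · simp
              · intro k _ hk
                simp [hk]
              · simp
            · intro a _ ha
              rw [if_neg fun h => ha h.1, smul_zero]
            · intro h
              refine absurd (Fintype.mem_piFinset.2 fun k => Finset.mem_range.2 ?_) h
              have := hle k
              omega
          · refine Finset.sum_eq_zero fun a ha => ?_
            rw [if_neg, smul_zero]
            rintro ⟨h1, h2⟩
            apply hmm'
            funext k
            have h3 := congrFun h2 k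
            have h4 := hle' a ha k
            have h5 := hle k
            rw [h1] at h3 h4
            simp only [Pi.sub_apply] at h3
            omega
        have := congrArg L hf
        rw [map_sum, map_zero, Finset.sum_eq_single m] at this
        · rw [map_smul, hL m hm, if_pos rfl, smul_eq_mul] at this
          exact (mul_eq_zero.1 this).resolve_right
            (RDP.natCast_ne_zero hb ((mem_boundedExponents.1 hm).1 b))
        · intro m' hm' hne
          rw [map_smul, hL m' hm', if_neg hne, smul_zero]
        · exact fun h => absurd hm h
      intro m hm
      by_cases hm' : m ∈ boundedExponents N p (d + 1)
      · obtain ⟨φ, hφ⟩ := ih m hm'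
        have := congrArg φ hf
        rw [map_sum, map_zero, Finset.sum_eq_single m] at this
        · simpa [hφ m hm'] using this
        · intro m' h1 hne
          by_cases h2 : m' ∈ boundedExponents N p (d + 1)
          · rw [map_smul, hφ m' h2, if_neg hne, smul_zero]
          · rw [htop m' h1 h2, zero_smul, map_zero]
        · exact fun h => absurd hm h
      · exact htop m hm hm'
    intro i hi
    obtain ⟨φ, hφ⟩ := exists_dual_of_linearIndependent hli' ⟨i, hi⟩
    refine ⟨φ, fun j hj => ?_⟩
    have := hφ ⟨j, hj⟩
    simpa using this

theorem exists_dual_orderedMonomial' [Fact p.Prime] [CharP K p] (hli : LinearIndependent K y)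
    (hc : ∀ b, Bialgebra.comulAlgHom K A (y b) = y b ⊗ₜ 1 + 1 ⊗ₜ y b)
    (he : ∀ b, Bialgebra.counitAlgHom K A (y b) = 0) (i : Fin N → ℕ) (hi : ∀ k, i k < p) :
    ∃ φ : A →ₗ[K] K, ∀ j : Fin N → ℕ, (∀ k, j k < p) →
      φ (orderedMonomial y j) = if j = i then 1 else 0 := by
  have hmem : ∀ j : Fin N → ℕ, (∀ k, j k < p) → j ∈ boundedExponents N p (N * p + 1) := by
    intro j hj
    refine mem_boundedExponents.2 ⟨hj, ?_⟩
    have := Finset.sum_le_sum fun (k : Fin N) (_ : k ∈ Finset.univ) => (hj k).le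
    simp at this
    omega
  obtain ⟨φ, hφ⟩ := exists_dual_orderedMonomial (p := p) hli hc he (N * p) i (hmem i hi)
  exact ⟨φ, fun j hj => hφ j (hmem j hj)⟩

theorem linearIndependent_orderedMonomial [Fact p.Prime] [CharP K p]
    (hli : LinearIndependent K y)
    (hc : ∀ b, Bialgebra.comulAlgHom K A (y b) = y b ⊗ₜ 1 + 1 ⊗ₜ y b)
    (he : ∀ b, Bialgebra.counitAlgHom K A (y b) = 0) :
    LinearIndependent K fun m : Fin N → Fin p => orderedMonomial y fun k => (m k : ℕ) := by
  rw [Fintype.linearIndependent_iff]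
  intro g hg m
  obtain ⟨φ, hφ⟩ := exists_dual_orderedMonomial' (p := p) hli hc he (fun k => (m k : ℕ))
    fun k => (m k).2
  have := congrArg φ hg
  rw [map_sum, map_zero, Finset.sum_eq_single m] at this
  · simpa [hφ _ fun k => (m k).2] using this
  · intro m' _ hne
    rw [map_smul, hφ _ fun k => (m' k).2, if_neg, smul_zero]
    exact fun h => hne (funext fun k => Fin.ext (congrFun h k))
  · simp

end Independence

section Spanning

variable [Ring A] [Algebra K A] (y : Fin N → A)

/-- The span of the products of fewer than `d` of the elements `y`. -/
def shortProducts (K : Type*) [Field K] [Algebra K A] (d : ℕ) : Submodule K A :=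
  Submodule.span K {a | ∃ l : List (Fin N), l.length < d ∧ (l.map y).prod = a}

variable {y}

theorem mul_mem_shortProducts (b : Fin N) {d : ℕ} {a : A} (ha : a ∈ shortProducts y K d) :
    y b * a ∈ shortProducts y K (d + 1) := by
  induction ha using Submodule.span_induction with
  | mem a h =>
    obtain ⟨l, hl, rfl⟩ := h
    exact Submodule.subset_span ⟨b :: l, by simpa, by simp⟩
  | zero => rw [mul_zero]; exact zero_mem _
  | add x z _ _ hx hz => rw [mul_add]; exact add_mem hx hz
  | smul c x _ hx => rw [mul_smul_comm]; exact Submodule.smul_mem _ _ hx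

theorem span_mul_mem_shortProducts {w : A} (hw : w ∈ Submodule.span K (Set.range y))
    {d : ℕ} {l : List (Fin N)} (hl : l.length + 1 < d) :
    w * (l.map y).prod ∈ shortProducts y K d := by
  induction hw using Submodule.span_induction with
  | mem a h =>
    obtain ⟨b, rfl⟩ := h
    exact Submodule.subset_span ⟨b :: l, by simpa, by simp⟩
  | zero => rw [zero_mul]; exact zero_mem _
  | add x z _ _ hx hz => rw [add_mul]; exact add_mem hx hz
  | smul c x _ hx => rw [smul_mul_assoc]; exact Submodule.smul_mem _ _ hx

/-- Reordering a product changes it only by products of fewer factors. -/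
theorem perm_prod_sub_mem
    (hcomm : ∀ a b, y a * y b - y b * y a ∈ Submodule.span K (Set.range y))
    {l l' : List (Fin N)} (h : l.Perm l') :
    (l.map y).prod - (l'.map y).prod ∈ shortProducts y K l.length := by
  induction h with
  | nil => simp
  | cons a _ ih =>
    rw [List.map_cons, List.prod_cons, List.map_cons, List.prod_cons, ← mul_sub]
    exact mul_mem_shortProducts a ih
  | swap a b l =>
    simp only [List.map_cons, List.prod_cons, ← mul_assoc, ← sub_mul]
    exact span_mul_mem_shortProducts (hcomm _ _) (by simp)
  | trans h _ ih ih' =>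
    rw [← sub_add_sub_cancel]
    rw [← h.length_eq] at ih'
    exact add_mem ih ih'

/-- If commutators and `p`-th powers of the `y b` are linear combinations of the `y b`, then every
product of the `y b` is a linear combination of ordered monomials with exponents below `p`. -/
theorem prod_mem_span_orderedMonomial [Fact p.Prime]
    (hcomm : ∀ a b, y a * y b - y b * y a ∈ Submodule.span K (Set.range y))
    (hpow : ∀ b, y b ^ p ∈ Submodule.span K (Set.range y)) (l : List (Fin N)) :
    (l.map y).prod ∈ Submodule.span K
      (Set.range fun m : Fin N → Fin p => orderedMonomial y fun k => (m k : ℕ)) := by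
  obtain ⟨d, hd⟩ : ∃ d, l.length = d := ⟨_, rfl⟩
  induction d using Nat.strong_induction_on generalizing l with
  | _ d ih =>
  set Q := Submodule.span K
    (Set.range fun m : Fin N → Fin p => orderedMonomial y fun k => (m k : ℕ))
  have hshort : shortProducts y K d ≤ Q := by
    refine Submodule.span_le.2 ?_
    rintro _ ⟨l', hl', rfl⟩
    exact ih _ hl' l' rfl
  -- it suffices to treat a permutation of `l`
  have hperm : ∀ l' : List (Fin N), l.Perm l' → (l'.map y).prod ∈ Q → (l.map y).prod ∈ Q := by
    intro l' h h'
    have := hshort (hd ▸ perm_prod_sub_mem (K := K) hcomm h)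
    simpa using add_mem this h'
  by_cases hcount : ∀ b, l.count b < p
  · refine hperm ((List.finRange N).flatMap fun b => List.replicate (l.count b) b) ?_ ?_
    · rw [List.perm_iff_count]
      intro a
      rw [List.count_flatMap]
      simp only [Function.comp_def, List.count_replicate]
      rw [← Fin.sum_univ_def]
      simp
    · refine Submodule.subset_span ⟨fun b => ⟨l.count b, hcount b⟩, ?_⟩
      have : ∀ L : List (Fin N),
          ((L.flatMap fun b => List.replicate (l.count b) b).map y).prod =
            (L.map fun k => y k ^ l.count k).prod := by
        intro L
        induction L with
        | nil => simp
        | cons b L ihL => simp [ihL]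
      rw [this, ← List.ofFn_eq_map]
      rfl
  · push Not at hcount
    obtain ⟨b, hb⟩ := hcount
    have hsub : (List.replicate p b).Sublist l := List.replicate_sublist_iff.2 hb
    obtain ⟨l', hl'⟩ := hsub.exists_perm_append
    refine hperm _ hl' ?_
    rw [List.map_append, List.prod_append, List.map_replicate, List.prod_replicate]
    refine hshort (span_mul_mem_shortProducts (hpow b) ?_)
    have := hl'.length_eq
    have := (Fact.out : p.Prime).one_lt
    simp at *
    omega

end Spanning

end OrderedMonomials

/-! ### The dimension of `u_{t,q}(W(n;1))` -/

section Dimension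

variable (n p : ℕ) (K : Type*) [Field K] [Fact p.Prime] [CharP K p]

namespace RestrEnv

theorem adjoin_range_ι : Algebra.adjoin K (Set.range (ι n p K)) = ⊤ := by
  set C := Algebra.adjoin K (Set.range (ι n p K))
  let f : JW n p K →ₗ[K] C :=
    (ι n p K).codRestrict (Subalgebra.toSubmodule C) fun x => Algebra.subset_adjoin ⟨x, rfl⟩
  let g : RestrEnv n p K →ₐ[K] C := lift f
    (fun x y => Subtype.ext (ι_lie n p K x y))
    (fun i => Subtype.ext (ι_toral n p K i))
    (fun α i h => Subtype.ext (ι_nil n p K α i h))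
  have hg : C.val.comp g = AlgHom.id K _ := hom_ext fun x => by
    rw [AlgHom.comp_apply]
    simp only [g, lift_ι]
    rfl
  rw [eq_top_iff]
  intro a _
  have : a = C.val (g a) := (AlgHom.congr_fun hg a).symm
  rw [this]
  exact (g a).2

/-- The number of basis elements `x^(α) D_i` of `W(n;1)`. -/
def basisCard : ℕ := Fintype.card ((Fin n → Fin p) × Fin n)

/-- An enumeration of the index set of the basis `x^(α) D_i` of `W(n;1)`. -/
def enum : (Fin n → Fin p) × Fin n ≃ Fin (basisCard n p) := Fintype.equivFin _

/-- The enumerated basis elements `x^(α) D_i`, in `u(W(n;1))`. -/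
def gen (k : Fin (basisCard n p)) : RestrEnv n p K :=
  ι n p K (xD n p K (fun i => (((enum n p).symm k).1 i : ℕ)) ((enum n p).symm k).2)

theorem linearIndependent_gen : LinearIndependent K (gen n p K) := by
  have h1 := (xD_linearIndependent n p K).map' (ι n p K)
    (LinearMap.ker_eq_bot.2 (ι_injective n p K))
  exact h1.comp _ (enum n p).symm.injective

theorem ι_mem_span_gen (w : JW n p K) :
    ι n p K w ∈ Submodule.span K (Set.range (gen n p K)) := by
  rw [JW.eq_sum w, map_sum]
  refine Submodule.sum_mem _ fun b _ => ?_
  rw [map_smul]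
  refine Submodule.smul_mem _ _ (Submodule.subset_span ?_)
  exact ⟨enum n p b, by simp [gen]⟩

variable {n p K} in
theorem comul_gen (k) : Bialgebra.comulAlgHom K (RestrEnv n p K) (gen n p K k) =
    gen n p K k ⊗ₜ 1 + 1 ⊗ₜ gen n p K k := comul_ι _

variable {n p K} in
theorem counit_gen (k) : Bialgebra.counitAlgHom K (RestrEnv n p K) (gen n p K k) = 0 := counit_ι _

theorem span_orderedMonomial_gen : Submodule.span K
    (Set.range fun m : Fin (basisCard n p) → Fin p =>
      orderedMonomial (gen n p K) fun k => (m k : ℕ)) = ⊤ := by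
  set Q := Submodule.span K (Set.range fun m : Fin (basisCard n p) → Fin p =>
      orderedMonomial (gen n p K) fun k => (m k : ℕ)) with hQ
  have hcomm : ∀ a b, gen n p K a * gen n p K b - gen n p K b * gen n p K a ∈
      Submodule.span K (Set.range (gen n p K)) := by
    intro a b
    simp only [gen]
    rw [← ι_lie]
    exact ι_mem_span_gen n p K _
  have hpow : ∀ b, gen n p K b ^ p ∈ Submodule.span K (Set.range (gen n p K)) := by
    intro b
    simp only [gen]
    set c := (enum n p).symm b
    by_cases h : (fun i => (c.1 i : ℕ)) = Pi.single c.2 1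
    · rw [h, ι_toral]
      exact ι_mem_span_gen n p K _
    · rw [ι_nil n p K _ _ h]
      exact zero_mem _
  -- the span of all products of generators is a left ideal containing `1`
  set P := Submodule.span K
    (Set.range fun l : List (Fin (basisCard n p)) => (l.map (gen n p K)).prod) with hP
  have hPQ : P ≤ Q := by
    refine Submodule.span_le.2 ?_
    rintro _ ⟨l, rfl⟩
    exact prod_mem_span_orderedMonomial hcomm hpow l
  have hgen : ∀ b, ∀ s ∈ P, gen n p K b * s ∈ P := by
    intro b s hs
    induction hs using Submodule.span_induction with
    | mem a h =>
      obtain ⟨l, rfl⟩ := h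
      exact Submodule.subset_span ⟨b :: l, by simp⟩
    | zero => rw [mul_zero]; exact zero_mem _
    | add x z _ _ hx hz => rw [mul_add]; exact add_mem hx hz
    | smul c x _ hx => rw [mul_smul_comm]; exact Submodule.smul_mem _ _ hx
  have hmul : ∀ a : RestrEnv n p K, ∀ s ∈ P, a * s ∈ P := by
    intro a
    have ha : a ∈ Algebra.adjoin K (Set.range (ι n p K)) := by
      rw [adjoin_range_ι]; exact Algebra.mem_top
    induction ha using Algebra.adjoin_induction with
    | mem x hx =>
      obtain ⟨w, rfl⟩ := hx
      intro s hs
      have := ι_mem_span_gen n p K w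
      generalize ι n p K w = x at this
      induction this using Submodule.span_induction with
      | mem a h =>
        obtain ⟨b, rfl⟩ := h
        exact hgen b s hs
      | zero => rw [zero_mul]; exact zero_mem _
      | add x z _ _ hx hz => rw [add_mul]; exact add_mem hx hz
      | smul c x _ hx => rw [smul_mul_assoc]; exact Submodule.smul_mem _ _ hx
    | algebraMap r =>
      intro s hs
      rw [← Algebra.smul_def]
      exact Submodule.smul_mem _ _ hs
    | add x y _ _ hx hy =>
      intro s hs
      rw [add_mul]
      exact add_mem (hx s hs) (hy s hs)
    | mul x y _ _ hx hy =>
      intro s hs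
      rw [mul_assoc]
      exact hx _ (hy s hs)
  rw [eq_top_iff]
  intro a _
  have := hmul a 1 (Submodule.subset_span ⟨[], by simp⟩)
  rw [mul_one] at this
  exact hPQ this

/-- The ordered monomials in the `x^(α) D_i` with exponents below `p` form a basis of
`u(W(n;1))`. -/
def pbwBasis : Module.Basis (Fin (basisCard n p) → Fin p) K (RestrEnv n p K) :=
  Module.Basis.mk
    (linearIndependent_orderedMonomial (linearIndependent_gen n p K) comul_gen counit_gen)
    (span_orderedMonomial_gen n p K).ge

instance : Module.Finite K (RestrEnv n p K) := .of_basis (pbwBasis n p K)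

theorem finrank_eq : Module.finrank K (RestrEnv n p K) = p ^ (n * p ^ n) := by
  rw [Module.finrank_eq_card_basis (pbwBasis n p K)]
  simp [basisCard, mul_comm]

variable {n p K} in
/-- A linear functional on `u(W(n;1))` detecting `x^(α) D_i` among the powers of basis elements. -/
theorem exists_dual_pow (b₀ : (Fin n → Fin p) × Fin n) : ∃ φ : RestrEnv n p K →ₗ[K] K,
    ∀ (b : (Fin n → Fin p) × Fin n) (r : ℕ), r < p →
      φ (ι n p K (xD n p K (fun i => (b.1 i : ℕ)) b.2) ^ r) = if r = 1 ∧ b = b₀ then 1 else 0 := by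
  have hp := (Fact.out : p.Prime).one_lt
  have hsingle : ∀ (b : Fin (basisCard n p)) (r : ℕ), r < p →
      ∀ k, (Pi.single b r : Fin (basisCard n p) → ℕ) k < p := by
    intro b r hr k
    by_cases h : k = b
    · subst h; simpa
    · simp [h]; omega
  obtain ⟨φ, hφ⟩ := exists_dual_orderedMonomial' (p := p) (linearIndependent_gen n p K) comul_gen
    counit_gen (Pi.single (enum n p b₀) 1) (hsingle _ _ hp)
  refine ⟨φ, fun b r hr => ?_⟩
  have h1 := hφ (Pi.single (enum n p b) r) (hsingle _ _ hr)
  rw [orderedMonomial_single, gen, Equiv.symm_apply_apply] at h1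
  rw [h1]
  congr 1
  refine propext ⟨fun h => ?_, fun ⟨h1, h2⟩ => by rw [h1, h2]⟩
  have h2 := congrFun h (enum n p b₀)
  rw [Pi.single_eq_same] at h2
  by_cases hb : b = b₀
  · subst hb
    rw [Pi.single_eq_same] at h2
    exact ⟨h2, rfl⟩
  · rw [Pi.single_eq_of_ne fun e => hb ((enum n p).injective e).symm] at h2
    exact absurd h2 zero_ne_one

end RestrEnv

variable {K} (q : K)

omit [CharP K p] in
theorem natDegree_truncPoly :
    (Polynomial.X ^ p - Polynomial.C q * Polynomial.X : Polynomial K).natDegree = p := by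
  have hp := (Fact.out : p.Prime).one_lt
  rw [Polynomial.natDegree_sub_eq_left_of_natDegree_lt, Polynomial.natDegree_X_pow]
  rw [Polynomial.natDegree_X_pow]
  refine lt_of_le_of_lt (Polynomial.natDegree_C_mul_le _ _) ?_
  rwa [Polynomial.natDegree_X]

omit [CharP K p] in
theorem truncPoly_ne_zero :
    (Polynomial.X ^ p - Polynomial.C q * Polynomial.X : Polynomial K) ≠ 0 := by
  intro h
  have := natDegree_truncPoly p q
  rw [h, Polynomial.natDegree_zero] at this
  exact (Fact.out : p.Prime).ne_zero this.symm

omit [CharP K p] in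
theorem finrank_truncPoly : Module.finrank K (TruncPoly p q) = p := by
  rw [(AdjoinRoot.powerBasis (truncPoly_ne_zero p q)).finrank, AdjoinRoot.powerBasis_dim,
    natDegree_truncPoly]

theorem UTQ.finrank_eq : Module.finrank K (UTQ n p q) = p ^ (1 + n * p ^ n) := by
  rw [Module.finrank_tensorProduct, finrank_truncPoly, RestrEnv.finrank_eq, pow_add, pow_one]

omit [CharP K p] in
theorem UTQ.t_ne_zero : UTQ.t p q ≠ 0 := by
  have hp := (Fact.out : p.Prime).one_lt
  rw [UTQ.t, AdjoinRoot.root, Ne, AdjoinRoot.mk_eq_zero]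
  intro h
  have h1 := Polynomial.natDegree_le_of_dvd h Polynomial.X_ne_zero
  rw [natDegree_truncPoly, Polynomial.natDegree_X] at h1
  omega

end Dimension

/-! ### The standard antipode -/

section PrimitiveGenerators

open MulOpposite

variable {R A : Type*} [CommRing R] [Ring A] [Bialgebra R A]

/-- If the algebra `A` is generated by primitive elements, an algebra map `S : A → Aᵐᵒᵖ` with
`S x = -x` on these generators is an antipode. -/
theorem sandwich_comul_of_primitive (S : A →ₐ[R] Aᵐᵒᵖ) {s : Set A} (hs : Algebra.adjoin R s = ⊤)
    (hS : ∀ x ∈ s, S x = op (-x))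
    (hcomul : ∀ x ∈ s, Bialgebra.comulAlgHom R A x = x ⊗ₜ 1 + 1 ⊗ₜ x)
    (hcounit : ∀ x ∈ s, Bialgebra.counitAlgHom R A x = 0) (a : A) :
    sandwichRight S (Bialgebra.comulAlgHom R A a) 1 =
      algebraMap R A (Bialgebra.counitAlgHom R A a) ∧
    unop (sandwichLeft S (Bialgebra.comulAlgHom R A a)) 1 =
      algebraMap R A (Bialgebra.counitAlgHom R A a) := by
  have ha : a ∈ Algebra.adjoin R s := hs ▸ Algebra.mem_top
  induction ha using Algebra.adjoin_induction with
  | mem x hx =>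
    rw [hcomul x hx, hcounit x hx, map_add, map_add, LinearMap.add_apply, unop_add,
      LinearMap.add_apply, sandwichRight_tmul, sandwichRight_tmul, sandwichLeft_tmul,
      sandwichLeft_tmul, hS x hx, map_one]
    simp
  | algebraMap r =>
    have h1 : Bialgebra.counitAlgHom R A (algebraMap R A r) = r := AlgHom.commutes _ _
    rw [h1, AlgHom.commutes, AlgHom.commutes, AlgHom.commutes]
    simp [Algebra.algebraMap_eq_smul_one]
  | add x y _ _ hx hy =>
    simp only [map_add, LinearMap.add_apply, unop_add, hx, hy, and_self]
  | mul x y _ _ hx hy =>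
    simp only [map_mul, unop_mul, Module.End.mul_apply, hy.1, hx.2]
    simp only [Algebra.algebraMap_eq_smul_one] at hx hy ⊢
    simp only [map_smul, hx.1, hy.2, mul_smul_comm, mul_one, true_and]
    exact smul_comm _ _ _

end PrimitiveGenerators

section StandardAntipode

open MulOpposite TruncPow

variable (n p : ℕ) (K : Type*) [Field K] [Fact p.Prime] [CharP K p]

namespace RestrEnv

theorem natCast_eq_zero : (p : RestrEnv n p K) = 0 := by
  rw [← map_natCast (algebraMap K (RestrEnv n p K)), CharP.cast_eq_zero, map_zero]

/-- The antipode of `u(W(n;1))`, `w ↦ -w`, as an algebra map to the opposite algebra. -/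
def antipode : RestrEnv n p K →ₐ[K] (RestrEnv n p K)ᵐᵒᵖ :=
  lift ((opLinearEquiv K).toLinearMap ∘ₗ (-ι n p K))
    (fun x y => by
      simp only [LinearMap.comp_apply, LinearMap.neg_apply, ι_lie, LinearEquiv.coe_coe,
        coe_opLinearEquiv, ← op_mul, neg_mul_neg, neg_sub, op_sub])
    (fun i => by
      simp only [LinearMap.comp_apply, LinearMap.neg_apply, LinearEquiv.coe_coe,
        coe_opLinearEquiv, ← op_pow]
      rw [neg_pow_self (natCast_eq_zero n p K) (ι_toral n p K i)])
    (fun α i hα => by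
      simp only [LinearMap.comp_apply, LinearMap.neg_apply, LinearEquiv.coe_coe,
        coe_opLinearEquiv, ← op_pow]
      rw [neg_pow, ι_nil n p K α i hα, mul_zero, op_zero])

theorem antipode_ι (w : JW n p K) : antipode n p K (ι n p K w) = op (-ι n p K w) :=
  lift_ι _ _ _ _ w

end RestrEnv

namespace UTQ

variable {K} (q : K)

theorem natCast_eq_zero : (p : UTQ n p q) = 0 := by
  rw [← map_natCast (algebraMap K (UTQ n p q)), CharP.cast_eq_zero, map_zero]

theorem ι_lie (x y : JW n p K) :
    ι n p q ⁅x, y⁆ = ι n p q x * ι n p q y - ι n p q y * ι n p q x := by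
  simp only [ι, LinearMap.comp_apply, RestrEnv.ι_lie, map_sub, TensorProduct.mk_apply,
    Algebra.TensorProduct.tmul_mul_tmul, mul_one]

theorem adjoin_range_ι : Algebra.adjoin (TruncPoly p q) (Set.range (ι n p q)) = ⊤ := by
  rw [eq_top_iff]
  have h1 : ∀ a : RestrEnv n p K, (1 : TruncPoly p q) ⊗ₜ[K] a ∈
      Algebra.adjoin (TruncPoly p q) (Set.range (ι n p q)) := by
    intro a
    have ha : a ∈ Algebra.adjoin K (Set.range (RestrEnv.ι n p K)) :=
      RestrEnv.adjoin_range_ι n p K ▸ Algebra.mem_top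
    have hle : Algebra.adjoin K (Set.range (RestrEnv.ι n p K)) ≤
        ((Algebra.adjoin (TruncPoly p q) (Set.range (ι n p q))).restrictScalars K).comap
          (Algebra.TensorProduct.includeRight : RestrEnv n p K →ₐ[K] UTQ n p q) := by
      rw [Algebra.adjoin_le_iff]
      rintro _ ⟨w, rfl⟩
      exact Algebra.subset_adjoin ⟨w, rfl⟩
    exact hle ha
  intro a _
  induction a using TensorProduct.induction_on with
  | zero => exact zero_mem _
  | add x y hx hy => exact add_mem (hx trivial) (hy trivial)
  | tmul r a =>
    have : r ⊗ₜ[K] a = r • ((1 : TruncPoly p q) ⊗ₜ[K] a) := by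
      rw [TensorProduct.smul_tmul', smul_eq_mul, mul_one]
    rw [this]
    exact Subalgebra.smul_mem _ (h1 a) r

/-- The standard antipode of `u_{t,q}`, `w ↦ -w`, as an algebra map to the opposite algebra. -/
def antipode₀ : UTQ n p q →ₐ[TruncPoly p q] (UTQ n p q)ᵐᵒᵖ :=
  Algebra.TensorProduct.lift (Algebra.ofId (TruncPoly p q) (UTQ n p q)ᵐᵒᵖ)
    ((AlgHom.op (Algebra.TensorProduct.includeRight : RestrEnv n p K →ₐ[K] UTQ n p q)).comp
      (RestrEnv.antipode n p K))
    (by intro r x; rw [Algebra.ofId_apply]; exact Algebra.commute_algebraMap_left r _)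

theorem antipode₀_ι (w : JW n p K) : antipode₀ n p q (ι n p q w) = op (-ι n p q w) := by
  rw [antipode₀, ι, LinearMap.comp_apply, TensorProduct.mk_apply, Algebra.TensorProduct.lift_tmul,
    map_one, one_mul, AlgHom.comp_apply, RestrEnv.antipode_ι]
  simp [TensorProduct.tmul_neg]

theorem antipode₀_spec (a : UTQ n p q) :
    sandwichRight (antipode₀ n p q) (Bialgebra.comulAlgHom (TruncPoly p q) (UTQ n p q) a) 1 =
      algebraMap _ _ (Bialgebra.counitAlgHom (TruncPoly p q) (UTQ n p q) a) ∧
    unop (sandwichLeft (antipode₀ n p q)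
      (Bialgebra.comulAlgHom (TruncPoly p q) (UTQ n p q) a)) 1 =
      algebraMap _ _ (Bialgebra.counitAlgHom (TruncPoly p q) (UTQ n p q) a) := by
  refine sandwich_comul_of_primitive _ (adjoin_range_ι n p q) ?_ ?_ ?_ a <;> rintro _ ⟨w, rfl⟩
  · exact antipode₀_ι n p q w
  · exact comul₀_ι n p q w
  · exact counit₀_ι n p q w

end UTQ

end StandardAntipode

/-! ### Weights and divided powers in the Jacobson-Witt algebra -/

section WeightSystem

open MulOpposite TruncPow

variable (n p : ℕ) {K : Type*} [Field K] [Fact p.Prime] [CharP K p]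

namespace UTQ

theorem lie_euler_eLie (k : Fin n) :
    ⁅xD n p K (Pi.single k 1) k, eLie n p K k⁆ = eLie n p K k := by
  rw [eLie, lie_smul, lie_euler_xD]
  simp

theorem lie_euler_eLie_of_ne {j k : Fin n} (h : j ≠ k) :
    ⁅xD n p K (Pi.single j 1) j, eLie n p K k⁆ = 0 := by
  rw [eLie, lie_smul, lie_xD_eq_zero, smul_zero] <;> simp [h, h.symm]

theorem lie_eLie_eLie (j k : Fin n) : ⁅eLie n p K j, eLie n p K k⁆ = 0 := by
  by_cases h : j = k
  · rw [h, lie_self]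
  · rw [eLie, eLie, smul_lie, lie_smul, lie_xD_eq_zero, smul_zero, smul_zero] <;>
      simp [h, Ne.symm h]

theorem lie_euler_euler (j k : Fin n) :
    ⁅xD n p K (Pi.single j 1) j, xD n p K (Pi.single k 1) k⁆ = 0 := by
  by_cases h : j = k
  · rw [h, lie_self]
  · rw [lie_xD_eq_zero] <;> simp [h, Ne.symm h]

theorem lie_euler_ad_pow (k : Fin n) {w : JW n p K} {c : ℤ}
    (hw : ⁅xD n p K (Pi.single k 1) k, w⁆ = (c : K) • w) (m : ℕ) :
    ⁅xD n p K (Pi.single k 1) k, (LieAlgebra.ad K (JW n p K) (eLie n p K k) ^ m) w⁆ =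
      ((c + m : ℤ) : K) • (LieAlgebra.ad K (JW n p K) (eLie n p K k) ^ m) w := by
  induction m with
  | zero => simpa using hw
  | succ m ih =>
    rw [pow_succ', Module.End.mul_apply, LieAlgebra.ad_apply, leibniz_lie, lie_euler_eLie, ih,
      lie_smul]
    push_cast
    module

theorem lie_euler_ad_pow_of_ne {j k : Fin n} (h : j ≠ k) {w : JW n p K} {c : K}
    (hw : ⁅xD n p K (Pi.single k 1) k, w⁆ = c • w) (m : ℕ) :
    ⁅xD n p K (Pi.single k 1) k, (LieAlgebra.ad K (JW n p K) (eLie n p K j) ^ m) w⁆ =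
      c • (LieAlgebra.ad K (JW n p K) (eLie n p K j) ^ m) w := by
  induction m with
  | zero => simpa using hw
  | succ m ih =>
    rw [pow_succ', Module.End.mul_apply, LieAlgebra.ad_apply, leibniz_lie,
      lie_euler_eLie_of_ne n p h.symm, ih, lie_smul, zero_lie, zero_add]

variable (q : K)

/-- In characteristic `p` one has `(ad X)^p = ad (X^p)`, hence `(ad x)^p` vanishes in `u_{t,q}` if
`x^p = 0` there. -/
theorem ι_ad_pow_eq_zero {x : JW n p K} (hx : ι n p q x ^ p = 0) (w : JW n p K) :
    ι n p q ((LieAlgebra.ad K (JW n p K) x ^ p) w) = 0 := by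
  rcases subsingleton_or_nontrivial (UTQ n p q) with _ | _
  · exact Subsingleton.elim _ _
  have : CharP (Module.End K (UTQ n p q)) p :=
    charP_of_injective_algebraMap (algebraMap K _).injective p
  have h1 : ∀ m, ι n p q ((LieAlgebra.ad K (JW n p K) x ^ m) w) =
      ((LinearMap.mulLeft K (ι n p q x) - LinearMap.mulRight K (ι n p q x)) ^ m) (ι n p q w) := by
    intro m
    induction m with
    | zero => simp
    | succ m ih =>
      rw [pow_succ', pow_succ', Module.End.mul_apply, Module.End.mul_apply, ← ih,
        LieAlgebra.ad_apply, ι_lie]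
      rfl
  rw [h1, sub_pow_char_of_commute p (LinearMap.commute_mulLeft_right _ _),
    LinearMap.pow_mulLeft, LinearMap.pow_mulRight, hx]
  simp

/-- The `d_k^(m)` are divided powers of `ad e(k)`; for `m = p - 1` both sides vanish. -/
theorem ι_eLie_lie_divAd (k : Fin n) {m : ℕ} (hm : m < p) (w : JW n p K) :
    e n p q k * ι n p q (divAd n p K k m w) - ι n p q (divAd n p K k m w) * e n p q k =
      ((m + 1 : ℕ) : UTQ n p q) * ι n p q (divAd n p K k (m + 1) w) := by
  rw [e, ← ι_lie, divAd, divAd, LinearMap.smul_apply, lie_smul, ← LieAlgebra.ad_apply K,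
    ← Module.End.mul_apply, ← pow_succ', LinearMap.smul_apply]
  rcases Nat.lt_or_ge (m + 1) p with h | h
  · have h0 : ((m + 1 : ℕ) : K) ≠ 0 := RDP.natCast_ne_zero (Nat.succ_ne_zero m) h
    rw [← map_natCast (algebraMap K (UTQ n p q)), ← Algebra.smul_def, ← map_smul (ι n p q),
      smul_smul,
      Nat.factorial_succ, Nat.cast_mul, mul_inv, mul_inv_cancel_left₀ h0]
  · obtain rfl : p = m + 1 := by omega
    rw [natCast_eq_zero, zero_mul, map_smul, ι_ad_pow_eq_zero n _ q (e_pow n _ q k), smul_zero]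

/-- The scalar `η_k t`, which turns the factor `k` of a twist on or off. -/
def scale (η : Fin n → Fin 2) (k : Fin n) : TruncPoly p q := ((η k : ℕ) : TruncPoly p q) * t p q

theorem commute_of_lie_eq_zero {x y : JW n p K} (h : ⁅x, y⁆ = 0) :
    Commute (ι n p q x) (ι n p q y) := by
  rw [Commute, SemiconjBy, ← sub_eq_zero, ← ι_lie, h, map_zero]

theorem isToralFamily (s : Fin n → TruncPoly p q) :
    IsToralFamily (TruncPoly p q) p (h n p q) fun k => s k • e n p q k where
  comul_h k := comul₀_ι n p q _
  comul_E k := by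
    rw [map_smul, TensorProduct.tmul_smul, ← TensorProduct.smul_tmul', ← smul_add]
    exact congrArg _ (comul₀_ι n p q _)
  counit_h k := counit₀_ι n p q _
  counit_E k := by
    rw [map_smul]
    exact (congrArg _ (counit₀_ι n p q _)).trans (smul_zero _)
  commute_h j k := commute_of_lie_eq_zero n p q (lie_euler_euler n p j k)
  commute_E j k := ((commute_of_lie_eq_zero n p q (lie_eLie_eLie n p j k)).smul_left _).smul_right _
  commute_h_E j k hjk :=
    (commute_of_lie_eq_zero n p q (lie_euler_eLie_of_ne n p hjk)).smul_right _
  h_mul_E k := by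
    have := ι_lie n p q (xD n p K (Pi.single k 1) k) (eLie n p K k)
    rw [lie_euler_eLie, eq_sub_iff_add_eq'] at this
    rw [mul_smul_comm, smul_mul_assoc, mul_add, mul_one]
    exact congrArg _ this.symm
  h_pow k := by
    rw [h, ι, LinearMap.comp_apply, TensorProduct.mk_apply, Algebra.TensorProduct.tmul_pow,
      RestrEnv.ι_toral, one_pow]
  E_pow k := by rw [smul_pow, e_pow, smul_zero]

theorem mul_ι_of_lie {x w : JW n p K} {c : ℤ} (hw : ⁅x, w⁆ = (c : K) • w) :
    ι n p q x * ι n p q w = ι n p q w * (ι n p q x + (c : UTQ n p q)) := by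
  have := ι_lie n p q x w
  rw [hw, map_smul, Algebra.smul_def, map_intCast, eq_sub_iff_add_eq'] at this
  rw [← this, mul_add, (Int.cast_commute c (ι n p q w)).eq]

/-- The condition on `w` in the weight system is that `w` has weight `c k` for
`ad (x^(ε_k) D_k)`. -/
theorem isWeightSystem (s : Fin n → TruncPoly p q) (c : Fin n → ℤ) :
    IsToralFamily.IsWeightSystem (S := K) p (h n p q) (fun k => s k • e n p q k) (ι n p q)
      (divAd n p K) s c
      (fun k w => ⁅xD n p K (Pi.single k 1) k, w⁆ = (c k : K) • w) where
  zero k := by simp [divAd]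
  divSeq k w m hm := by
    have := congrArg (s k ^ (m + 1) • ·) (ι_eLie_lie_divAd n p q k hm w)
    simp only [mul_smul_comm, smul_mul_assoc, smul_smul, smul_sub] at this ⊢
    simpa only [pow_succ, mul_comm] using this
  weight k m w hw := by
    refine mul_ι_of_lie n p q ?_
    rw [divAd, LinearMap.smul_apply, lie_smul, lie_euler_ad_pow n p k hw, smul_comm]
  stable j k m w hjk hw := by
    rw [divAd, LinearMap.smul_apply, lie_smul, lie_euler_ad_pow_of_ne n p hjk hw, smul_comm]

end UTQ

end WeightSystem

/-! ### The twisted Hopf algebra structures -/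

section TwistedStructures

open MulOpposite TruncPow

namespace TruncPow

/-- Conjugation of `x + z` by `(1 - y)^x`, when `[z, y] = y`. -/
theorem tpow_mul_add {B : Type*} [Ring B] {p : ℕ} [Fact p.Prime] (hp : (p : B) = 0) {x y z : B}
    (hx : x ^ p = x) (hy : y ^ p = 0) (hxy : Commute x y) (hzy : z * y = y * (z + 1))
    (hxz : Commute x z) (U : Bˣ) (hU : (U : B) = 1 - y) :
    tpow p x y * (x + z) = (x * ((U⁻¹ : Bˣ) : B) + z) * tpow p x y := by
  let d : ℕ → B := fun m => if m = 0 then z else if m = 1 then -y else 0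
  have hd : IsDivSeq p y d := by
    rintro (_ | _ | m) _
    · simp [d, hzy, mul_add]
    · simp [d]
    · simp [d]
  have hxd : ∀ m, Commute x (d m) := by
    rintro (_ | _ | m)
    · exact hxz
    · exact hxy.neg_right
    · exact Commute.zero_right _
  have key := tpow_mul_divSeq hp hx hy hxy hd hxd U hU
  have hsum : ∑ m ∈ Finset.range p, (-1 : B) ^ m * rising x 0 m * ((U ^ (-(m : ℤ)) : Bˣ) : B) * d m
      = z + x * ((U⁻¹ : Bˣ) : B) * y := by
    have h2 : Finset.range 2 ⊆ Finset.range p :=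
      Finset.range_subset_range.2 (Fact.out : p.Prime).two_le
    rw [← Finset.sum_subset h2, Finset.sum_range_succ, Finset.sum_range_one]
    · simp [d, rising_zero, rising_succ]
    · intro m _ hm
      have : 1 < m := by simpa using hm
      simp [d, show m ≠ 0 by omega, show m ≠ 1 by omega]
  have hy' : y = 1 - (U : B) := by rw [hU, sub_sub_cancel]
  rw [hsum] at key
  change tpow p x y * z = _ at key
  rw [mul_add, key, (tpow_commute (Commute.refl x) hxy.symm).eq, ← add_mul]
  congr 1
  have hxUy : x * ((U⁻¹ : Bˣ) : B) * y = x * ((U⁻¹ : Bˣ) : B) * (1 - (U : B)) := by rw [← hy']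
  rw [hxUy, mul_sub, mul_one, mul_assoc x _ (U : B), Units.inv_mul, mul_one]
  abel

end TruncPow

theorem ofFn_prod_mul_of_commute {B : Type*} [Ring B] {n : ℕ} {f : Fin n → B} {a b : B} (k : Fin n)
    (hk : f k * a = b * f k) (ha : ∀ j, j ≠ k → Commute (f j) a)
    (hb : ∀ j, j ≠ k → Commute (f j) b) : (List.ofFn f).prod * a = b * (List.ofFn f).prod := by
  induction n with
  | zero => exact k.elim0
  | succ n ih =>
    rw [List.ofFn_succ, List.prod_cons, mul_assoc]
    induction k using Fin.cases with
    | zero =>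
      rw [(commute_ofFn_prod fun j => ha _ (Fin.succ_ne_zero j)).eq, ← mul_assoc, hk, mul_assoc]
    | succ k =>
      rw [ih k hk (fun j hj => ha _ fun h => hj (Fin.succ_injective _ h))
        (fun j hj => hb _ fun h => hj (Fin.succ_injective _ h)), ← mul_assoc,
        (hb 0 (Fin.succ_ne_zero k).symm).eq, mul_assoc]

section Toral

variable {R A : Type*} [CommRing R] [Ring A] [Bialgebra R A] {n p : ℕ} [Fact p.Prime]
  {h E : Fin n → A} (T : IsToralFamily R p h E) (hp : (p : A) = 0)

theorem IsToralFamily.twistProd_mul_comul_h (k : Fin n) (U : Aˣ) (hU : (U : A) = 1 - E k) :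
    (T.twistProd hp : A ⊗[R] A) * (h k ⊗ₜ[R] (1 : A) + (1 : A) ⊗ₜ[R] h k) =
      (h k ⊗ₜ[R] ((U⁻¹ : Aˣ) : A) + (1 : A) ⊗ₜ[R] h k) * T.twistProd hp := by
  rw [T.twistProd_val hp]
  have hcomm : ∀ j, j ≠ k → ∀ z : A, Commute (E j) z → ∀ x : A, Commute (h j) x →
      Commute (tpow p (h j ⊗ₜ[R] (1 : A)) ((1 : A) ⊗ₜ[R] E j)) (x ⊗ₜ[R] z) := by
    intro j _ z hz x hx
    apply tpow_commute
    · simp [Commute, SemiconjBy, hx.eq]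
    · simp [Commute, SemiconjBy, hz.eq]
  have hEU : ∀ j, Commute (E j) ((U⁻¹ : Aˣ) : A) := fun j => by
    refine Commute.units_inv_right ?_
    rw [hU]
    exact (Commute.one_right _).sub_right (T.commute_E _ _)
  refine ofFn_prod_mul_of_commute k ?_ (fun j hj => ?_) (fun j hj => ?_)
  · have := tpow_mul_add (B := A ⊗[R] A) (p := p) (natCast_tensor_eq_zero hp)
      (x := h k ⊗ₜ[R] (1 : A)) (y := (1 : A) ⊗ₜ[R] E k) (z := (1 : A) ⊗ₜ[R] h k)
      (by rw [Algebra.TensorProduct.tmul_pow, T.h_pow, one_pow])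
      (by rw [Algebra.TensorProduct.tmul_pow, T.E_pow, TensorProduct.tmul_zero])
      (commute_includeLeft_includeRight _ _)
      (by rw [Algebra.TensorProduct.one_def, ← TensorProduct.tmul_add,
        Algebra.TensorProduct.tmul_mul_tmul, Algebra.TensorProduct.tmul_mul_tmul, T.h_mul_E])
      (commute_includeLeft_includeRight _ _)
      (Units.map (Algebra.TensorProduct.includeRight : A →ₐ[R] A ⊗[R] A).toMonoidHom U)
      (by
        change (1 : A) ⊗ₜ[R] (U : A) = _
        rw [hU, TensorProduct.tmul_sub, Algebra.TensorProduct.one_def])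
    rw [this]
    change (h k ⊗ₜ[R] (1 : A) * (1 : A) ⊗ₜ[R] ((U⁻¹ : Aˣ) : A) + _) * _ = _
    rw [Algebra.TensorProduct.tmul_mul_tmul, mul_one, one_mul]
  · exact (hcomm j hj _ (Commute.one_right _) _ (T.commute_h _ _)).add_right
      (hcomm j hj _ (T.commute_h_E _ _ hj.symm).symm _ (Commute.one_right _))
  · exact (hcomm j hj _ (hEU j) _ (T.commute_h _ _)).add_right
      (hcomm j hj _ (T.commute_h_E _ _ hj.symm).symm _ (Commute.one_right _))

end Toral

namespace UTQ

variable (n p : ℕ) {K : Type*} [Field K] [Fact p.Prime] [CharP K p] (q : K)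

theorem fin_two_cases (a : Fin 2) : a = 0 ∨ a = 1 := by omega

theorem oneSub_pow_val (η : Fin n → Fin 2) (k : Fin n) :
    ((oneSub n p q k ^ (η k : ℕ) : (UTQ n p q)ˣ) : UTQ n p q) =
      1 - scale n p q η k • e n p q k := by
  rcases fin_two_cases (η k) with h | h <;> simp [scale, h, oneSub]

/-- The twist `F^η` as a unit. -/
def twistUnit (η : Fin n → Fin 2) : (UTQ n p q ⊗[TruncPoly p q] UTQ n p q)ˣ :=
  (isToralFamily n p q (scale n p q η)).twistProd (natCast_eq_zero n p q)

theorem basicTwist_eq_tpow (k : Fin n) : basicTwist n p q k =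
    tpow p (h n p q k ⊗ₜ[TruncPoly p q] 1) (1 ⊗ₜ[TruncPoly p q] (t p q • e n p q k)) := by
  rw [tpow_tmul_eq_sum, basicTwist]
  refine Finset.sum_congr rfl fun r hr => ?_
  have h0 : (Nat.factorial r : K) * invFact p r = 1 :=
    factorial_mul_invFact (CharP.cast_eq_zero K p) (Finset.mem_range.1 hr)
  rw [smul_pow, inv_eq_of_mul_eq_one_right h0, ← Int.cast_smul_eq_zsmul (TruncPoly p q)]
  simp

theorem twistUnit_val (η : Fin n → Fin 2) :
    (twistUnit n p q η : UTQ n p q ⊗[TruncPoly p q] UTQ n p q) = twist n p q η := by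
  rw [twistUnit, IsToralFamily.twistProd_val, twist]
  congr 2
  funext k
  rcases fin_two_cases (η k) with h | h
  · simp [scale, h, tpow_zero_right]
  · simp [scale, h, basicTwist_eq_tpow]

/-- The deformed Hopf algebra structure on `u_{t,q}(W(n;1))` obtained from the twist `F^η`. -/
def hopf (η : Fin n → Fin 2) : HopfStructure (TruncPoly p q) (UTQ n p q) :=
  have hS := (isToralFamily n p q (scale n p q η)).sandwich_twistProd (natCast_eq_zero n p q)
    (antipode₀ n p q) (fun k => antipode₀_ι n p q _)
    (fun k => by rw [map_smul, e, antipode₀_ι, ← op_smul, smul_neg])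
  twistedHopf (antipode₀ n p q) (fun a => (antipode₀_spec n p q a).1)
    (fun a => (antipode₀_spec n p q a).2) (twistUnit n p q η)
    ((isToralFamily n p q (scale n p q η)).isDrinfeldTwist (natCast_eq_zero n p q))
    ((isToralFamily n p q (scale n p q η)).antipodeProd (natCast_eq_zero n p q)) hS.1 hS.2

theorem hopf_comul (η : Fin n → Fin 2) (a : UTQ n p q) : (hopf n p q η).comul a =
    twistUnit n p q η * comul₀ n p q a * ((twistUnit n p q η)⁻¹ : (_)ˣ) := rfl

theorem hopf_antipode_ι (η : Fin n → Fin 2) (w : JW n p K) :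
    (hopf n p q η).antipode (ι n p q w) =
      -(((isToralFamily n p q (scale n p q η)).antipodeProd (natCast_eq_zero n p q) : UTQ n p q) *
        ι n p q w * (((isToralFamily n p q (scale n p q η)).antipodeProd
          (natCast_eq_zero n p q))⁻¹ : (_)ˣ)) := by
  change _ * (unop (antipode₀ n p q (ι n p q w)) * _) = _
  rw [antipode₀_ι, unop_op, neg_mul, mul_neg, mul_assoc]

theorem hopf_counit_ι (η : Fin n → Fin 2) (w : JW n p K) :
    (hopf n p q η).counit (ι n p q w) = 0 := counit₀_ι n p q w

omit [Fact p.Prime] in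
theorem eq_zero_of_mem_indices {η : Fin n → Fin 2} {m : Fin n → ℕ} (hm : m ∈ indices p η)
    {k : Fin n} (hk : η k = 0) : m k = 0 := by
  have := (Finset.mem_Icc.1 hm).2 k
  simpa [hk] using this

omit [CharP K p] in
/-- The factors `(η_k t)^(m k)` restrict a sum over all multi-indices to those with `m ≤ ητ`. -/
theorem sum_scale_smul {M : Type*} [AddCommGroup M] [Module (TruncPoly p q) M]
    (η : Fin n → Fin 2) (g : (Fin n → ℕ) → M) :
    ∑ m ∈ Fintype.piFinset fun _ : Fin n => Finset.range p,
      (∏ k, scale n p q η k ^ m k) • g m =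
    ∑ m ∈ indices p η, t p q ^ (∑ k, m k) • g m := by
  have hp := (Fact.out : p.Prime).pos
  symm
  refine Finset.sum_subset_zero_on_sdiff (fun m hm => ?_) (fun m hm => ?_) (fun m hm => ?_)
  · rw [Fintype.mem_piFinset]
    intro k
    have h1 := (Finset.mem_Icc.1 hm).2 k
    rcases fin_two_cases (η k) with h | h <;> simp [h] at h1 ⊢ <;> omega
  · rw [Finset.mem_sdiff, Fintype.mem_piFinset] at hm
    obtain ⟨hm1, hm2⟩ := hm
    obtain ⟨k, hk⟩ : ∃ k, ¬ m k ≤ (η k : ℕ) * (p - 1) := by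
      by_contra! hall
      exact hm2 (Finset.mem_Icc.2 ⟨fun _ => Nat.zero_le _, hall⟩)
    have hmk := Finset.mem_range.1 (hm1 k)
    rw [Finset.prod_eq_zero (Finset.mem_univ k), zero_smul]
    rcases fin_two_cases (η k) with h | h
    · simp [h] at hk
      simp [scale, h, hk]
    · simp [h] at hk
      omega
  · rw [← Finset.prod_pow_eq_pow_sum]
    congr 1
    refine Finset.prod_congr rfl fun k _ => ?_
    rcases fin_two_cases (η k) with h | h
    · simp [eq_zero_of_mem_indices n p hm h]
    · simp [scale, h]

theorem oneSubPow_wt (η : Fin n → Fin 2) (α : Fin n → ℕ) (i : Fin n) :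
    oneSubPow n p q (wt η α i) = (List.ofFn fun k => (oneSub n p q k ^ (η k : ℕ)) ^
      ((α k : ℤ) - if i = k then 1 else 0)).prod := by
  rw [oneSubPow]
  simp only [wt, zpow_mul, zpow_natCast]

theorem oneSubPow_neg_wt (η : Fin n → Fin 2) (α : Fin n → ℕ) (i : Fin n) :
    oneSubPow n p q (-wt η α i) = (List.ofFn fun k => (oneSub n p q k ^ (η k : ℕ)) ^
      (-((α k : ℤ) - if i = k then 1 else 0))).prod := by
  rw [oneSubPow]
  simp only [wt, Pi.neg_apply, ← mul_neg, zpow_mul, zpow_natCast]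

theorem oneSubPow_neg_indices {η : Fin n → Fin 2} {m : Fin n → ℕ} (hm : m ∈ indices p η) :
    oneSubPow n p q (fun k => -(m k : ℤ)) =
      (List.ofFn fun k => (oneSub n p q k ^ (η k : ℕ)) ^ (-(m k : ℤ))).prod := by
  rw [oneSubPow]
  congr 2
  funext k
  rcases fin_two_cases (η k) with h | h
  · simp [eq_zero_of_mem_indices n p hm h]
  · simp [h]

theorem hopf_comul_xD (η : Fin n → Fin 2) (α : Fin n → ℕ) (i : Fin n) :
    (hopf n p q η).comul (ι n p q (xD n p K α i)) = comulFormula n p q η α i := by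
  have T := isToralFamily n p q (scale n p q η)
  have D := isWeightSystem n p q (scale n p q η) fun k => (α k : ℤ) - if i = k then 1 else 0
  have h1 := T.twistProd_mul_tmul_one (natCast_eq_zero n p q) D
    (fun k => oneSub n p q k ^ (η k : ℕ)) (oneSub_pow_val n p q η) (xD n p K α i)
    (fun k => lie_euler_xD k α i)
  have h2 := T.twistProd_mul_one_tmul (natCast_eq_zero n p q) D
    (fun k => oneSub n p q k ^ (η k : ℕ)) (oneSub_pow_val n p q η) (xD n p K α i)
    (fun k => lie_euler_xD k α i)
  rw [hopf_comul, Units.mul_inv_eq_iff_eq_mul, comul₀_ι, mul_add]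
  refine (congrArg₂ _ h1 h2).trans ?_
  rw [← add_mul]
  congr 1
  rw [comulFormula, oneSubPow_wt]
  congr 1
  refine (sum_scale_smul n p q η _).trans (Finset.sum_congr rfl fun m hm => ?_)
  rw [oneSubPow_neg_indices n p q hm, smul_comm, mul_smul_comm, TensorProduct.tmul_smul]
  rfl

theorem hopf_antipode_xD (η : Fin n → Fin 2) (α : Fin n → ℕ) (i : Fin n) :
    (hopf n p q η).antipode (ι n p q (xD n p K α i)) = antipodeFormula n p q η α i := by
  have T := isToralFamily n p q (scale n p q η)
  have D := isWeightSystem n p q (scale n p q η) fun k => (α k : ℤ) - if i = k then 1 else 0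
  have h1 := T.antipodeProd_mul (natCast_eq_zero n p q) D
    (fun k => oneSub n p q k ^ (η k : ℕ)) (oneSub_pow_val n p q η) (xD n p K α i)
    (fun k => lie_euler_xD k α i)
  rw [hopf_antipode_ι, antipodeFormula, neg_inj, Units.mul_inv_eq_iff_eq_mul, h1,
    oneSubPow_neg_wt]
  congr 2
  exact sum_scale_smul n p q η _

end UTQ

end TwistedStructures

/-! ### Noncocommutativity, distinctness and noncommutativity -/

section Distinctness

namespace UTQ

variable (n p : ℕ) {K : Type*} [Field K] [Fact p.Prime] [CharP K p] (q : K)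

/-- The extension of scalars of a linear functional on `u(W(n;1))` to `u_{t,q}(W(n;1))`. -/
def extendFunctional (φ : RestrEnv n p K →ₗ[K] K) : UTQ n p q →ₗ[TruncPoly p q] TruncPoly p q :=
  (TensorProduct.AlgebraTensorModule.rid K (TruncPoly p q) (TruncPoly p q)).toLinearMap ∘ₗ
    φ.baseChange (TruncPoly p q)

theorem extendFunctional_ι_pow (φ : RestrEnv n p K →ₗ[K] K) (w : JW n p K) (r : ℕ) :
    extendFunctional n p q φ (ι n p q w ^ r) =
      algebraMap K (TruncPoly p q) (φ (RestrEnv.ι n p K w ^ r)) := by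
  rw [ι, LinearMap.comp_apply, TensorProduct.mk_apply, Algebra.TensorProduct.tmul_pow, one_pow]
  exact (Algebra.algebraMap_eq_smul_one (R := K) (A := TruncPoly p q) _).symm

/-- `Δ_η(h(k)) = h(k) ⊗ (1 - e(k) t)^(-η_k) + 1 ⊗ h(k)`. -/
theorem hopf_comul_h (η : Fin n → Fin 2) (k : Fin n) :
    (hopf n p q η).comul (h n p q k) = h n p q k ⊗ₜ[TruncPoly p q]
      (((oneSub n p q k ^ (η k : ℕ))⁻¹ : (UTQ n p q)ˣ) : UTQ n p q) +
        1 ⊗ₜ[TruncPoly p q] h n p q k := by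
  rw [hopf_comul, Units.mul_inv_eq_iff_eq_mul, h, comul₀_ι]
  exact (isToralFamily n p q (scale n p q η)).twistProd_mul_comul_h (natCast_eq_zero n p q) k _
    (oneSub_pow_val n p q η k)

/-- For odd `p`, a bilinear functional which reads off `2 η_k t` from `Δ_η(h(k))`, and `0` from its
image under the flip of the tensor factors. -/
theorem exists_functional (hp2 : p ≠ 2) (k : Fin n) :
    ∃ Φ : UTQ n p q ⊗[TruncPoly p q] UTQ n p q →ₗ[TruncPoly p q] TruncPoly p q,
      ∀ η : Fin n → Fin 2,
        Φ ((hopf n p q η).comul (h n p q k)) = ((η k : ℕ) * 2 : TruncPoly p q) * t p q ∧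
        Φ (Algebra.TensorProduct.comm (TruncPoly p q) (UTQ n p q) (UTQ n p q)
          ((hopf n p q η).comul (h n p q k))) = 0 := by
  have hp : 2 < p := lt_of_le_of_ne (Fact.out : p.Prime).two_le (Ne.symm hp2)
  have hlt : ∀ a < p, ∀ j, (Pi.single k a : Fin n → ℕ) j < p := by
    intro a ha j
    by_cases hj : j = k
    · subst hj; simpa using ha
    · rw [Pi.single_eq_of_ne hj]; omega
  let b : (a : ℕ) → a < p → (Fin n → Fin p) × Fin n := fun a ha =>
    (fun j => ⟨(Pi.single k a : Fin n → ℕ) j, hlt a ha j⟩, k)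
  have hb : b 1 (by omega) ≠ b 2 hp := by
    intro hb
    have := congrArg Fin.val (congrFun (congrArg Prod.fst hb) k)
    simp [b] at this
  obtain ⟨φ, hφ⟩ := RestrEnv.exists_dual_pow (K := K) (b 1 (by omega))
  obtain ⟨ψ, hψ⟩ := RestrEnv.exists_dual_pow (K := K) (b 2 hp)
  have φh := fun r hr => hφ (b 1 (by omega)) r hr
  have φe := fun r hr => hφ (b 2 hp) r hr
  have ψh := fun r hr => hψ (b 1 (by omega)) r hr
  have ψe := fun r hr => hψ (b 2 hp) r hr
  simp only [hb, hb.symm, and_true, and_false, if_false, b] at φh φe ψh ψe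
  let φ' := extendFunctional n p q φ
  let ψ' := extendFunctional n p q ψ
  have φ'h : φ' (h n p q k) = 1 := by
    have := extendFunctional_ι_pow n p q φ (xD n p K (Pi.single k 1) k) 1
    rwa [pow_one, φh 1 (by omega), if_pos rfl, map_one] at this
  have ψ'h : ψ' (h n p q k) = 0 := by
    have := extendFunctional_ι_pow n p q ψ (xD n p K (Pi.single k 1) k) 1
    rwa [pow_one, ψh 1 (by omega), map_zero] at this
  have φ'e : ∀ r < p, φ' (e n p q k ^ r) = 0 := by
    intro r hr
    rw [e]
    refine (extendFunctional_ι_pow n p q φ _ r).trans ?_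
    rw [eLie, map_smul, smul_pow, map_smul, φe r hr, smul_zero, map_zero]
  have ψ'e : ∀ r < p, ψ' (e n p q k ^ r) = if r = 1 then 2 else 0 := by
    intro r hr
    rw [e]
    refine (extendFunctional_ι_pow n p q ψ _ r).trans ?_
    rw [eLie, map_smul, smul_pow, map_smul, ψe r hr]
    by_cases h1 : r = 1
    · rw [if_pos h1, if_pos h1, h1, pow_one, smul_eq_mul, mul_one]
      exact map_ofNat (algebraMap K (TruncPoly p q)) 2
    · simp [h1]
  have φ'1 : φ' 1 = 0 := by simpa using φ'e 0 (by omega)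
  have ψ'1 : ψ' 1 = 0 := by simpa using ψ'e 0 (by omega)
  have hinv : ((oneSub n p q k)⁻¹ : (UTQ n p q)ˣ) =
      ∑ j ∈ Finset.range p, t p q ^ j • e n p q k ^ j := by
    simp only [← smul_pow]; rfl
  have φ'inv : φ' ((oneSub n p q k)⁻¹ : (UTQ n p q)ˣ) = 0 := by
    rw [hinv, map_sum]
    refine Finset.sum_eq_zero fun j hj => ?_
    rw [map_smul, φ'e j (Finset.mem_range.1 hj), smul_zero]
  have ψ'inv : ψ' ((oneSub n p q k)⁻¹ : (UTQ n p q)ˣ) = 2 * t p q := by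
    rw [hinv, map_sum, Finset.sum_eq_single_of_mem 1 (Finset.mem_range.2 (by omega))]
    · rw [map_smul, ψ'e 1 (by omega), if_pos rfl, pow_one, smul_eq_mul, mul_comm]
    · intro j hj hj1
      rw [map_smul, ψ'e j (Finset.mem_range.1 hj), if_neg hj1, smul_zero]
  refine ⟨LinearMap.mul' _ _ ∘ₗ TensorProduct.map φ' ψ', fun η => ?_⟩
  rw [hopf_comul_h]
  rcases fin_two_cases (η k) with hη | hη
  · simp [hη, φ'h, φ'1, ψ'h, ψ'1]
  · simp [hη, φ'h, φ'1, ψ'h, ψ'1, φ'inv, ψ'inv]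

theorem two_mul_t_ne_zero (hp2 : p ≠ 2) : (2 : TruncPoly p q) * t p q ≠ 0 := by
  have h2 : ((2 : ℕ) : K) ≠ 0 := RDP.natCast_ne_zero two_ne_zero
    (lt_of_le_of_ne (Fact.out : p.Prime).two_le (Ne.symm hp2))
  have : (2 : TruncPoly p q) * t p q = ((2 : ℕ) : K) • t p q := by
    rw [Algebra.smul_def, map_natCast, Nat.cast_ofNat]
  rw [this]
  exact smul_ne_zero h2 (t_ne_zero p q)

theorem hopf_not_isCocommutative (hp2 : p ≠ 2) {η : Fin n → Fin 2} (hη : η ≠ 0) :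
    ¬ (hopf n p q η).IsCocommutative := by
  intro hc
  obtain ⟨k, hk⟩ : ∃ k, η k ≠ 0 := by
    by_contra! h
    exact hη (funext h)
  obtain ⟨Φ, hΦ⟩ := exists_functional n p q hp2 k
  have h1 := (hΦ η).2
  rw [hc, (hΦ η).1, (fin_two_cases (η k)).resolve_left hk] at h1
  exact two_mul_t_ne_zero p q hp2 (by simpa using h1)

theorem hopf_comul_injective (hp2 : p ≠ 2) :
    Function.Injective fun η : Fin n → Fin 2 => (hopf n p q η).comul := by
  intro η η' hηη'
  funext k
  obtain ⟨Φ, hΦ⟩ := exists_functional n p q hp2 k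
  have h1 := (hΦ η).1.symm.trans
    ((congrArg (fun f => Φ (f (h n p q k))) hηη').trans (hΦ η').1)
  have h2 := two_mul_t_ne_zero p q hp2
  rcases fin_two_cases (η k) with h | h <;> rcases fin_two_cases (η' k) with h' | h'
  · rw [h, h']
  · exact absurd (by simpa [h, h'] using h1.symm) h2
  · exact absurd (by simpa [h, h'] using h1) h2
  · rw [h, h']

theorem ι_injective : Function.Injective (ι n p q) := by
  have : Nontrivial (TruncPoly p q) := ⟨⟨_, _, t_ne_zero p q⟩⟩
  have h1 : Function.Injective
      (Algebra.TensorProduct.includeRight : RestrEnv n p K →ₐ[K] UTQ n p q) :=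
    Algebra.TensorProduct.includeRight_injective
      (algebraMap K (TruncPoly p q)).injective
  exact h1.comp (RestrEnv.ι_injective n p K)

theorem exists_not_commute (hn : 0 < n) : ∃ a b : UTQ n p q, a * b ≠ b * a := by
  have k : Fin n := ⟨0, hn⟩
  refine ⟨ι n p q (xD n p K (Pi.single k 1) k), ι n p q (xD n p K 0 k), fun h => ?_⟩
  rw [← sub_eq_zero, ← ι_lie, lie_euler_xD, ← map_zero (ι n p q)] at h
  have h0 := ι_injective n p q h
  have h1 := (xD_linearIndependent (n := n) (p := p) (K := K)).ne_zero
    ((fun _ => ⟨0, (Fact.out : p.Prime).pos⟩, k))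
  refine smul_ne_zero ?_ ?_ h0
  · simp
  · exact h1

end UTQ

end Distinctness

theorem theorem3p7 {K : Type*} [Field K] (p : ℕ) [Fact p.Prime] [CharP K p]
    (n : ℕ) (hn : 0 < n) (q : K) :
    ∃ H : (Fin n → Fin 2) → HopfStructure (TruncPoly p q) (UTQ n p q),
      (∀ η : Fin n → Fin 2,
        (∀ (α : Fin n → ℕ) (i : Fin n), (∀ j, α j < p) →
          (H η).comul (UTQ.ι n p q (xD n p K α i)) = UTQ.comulFormula n p q η α i ∧
          (H η).antipode (UTQ.ι n p q (xD n p K α i)) = UTQ.antipodeFormula n p q η α i ∧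
          (H η).counit (UTQ.ι n p q (xD n p K α i)) = 0) ∧
        (∃ F : (UTQ n p q ⊗[TruncPoly p q] UTQ n p q)ˣ,
          (F : UTQ n p q ⊗[TruncPoly p q] UTQ n p q) = UTQ.twist n p q η ∧
          IsDrinfeldTwist (UTQ.comul₀ n p q) (UTQ.counit₀ n p q) F ∧
          ∀ a, (H η).comul a = F * UTQ.comul₀ n p q a * (F⁻¹ : (_)ˣ)) ∧
        (p ≠ 2 → η ≠ 0 → ¬ (H η).IsCocommutative)) ∧
      (p ≠ 2 → Function.Injective fun η => (H η).comul) ∧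
      (∃ a b : UTQ n p q, a * b ≠ b * a) ∧
      Module.finrank K (UTQ n p q) = p ^ (1 + n * p ^ n) := by
  refine ⟨UTQ.hopf n p q, fun η => ⟨fun α i _ => ⟨UTQ.hopf_comul_xD n p q η α i,
    UTQ.hopf_antipode_xD n p q η α i, UTQ.hopf_counit_ι n p q η _⟩, ?_, ?_⟩, ?_, ?_, ?_⟩
  · exact ⟨UTQ.twistUnit n p q η, UTQ.twistUnit_val n p q η,
      (UTQ.isToralFamily n p q (UTQ.scale n p q η)).isDrinfeldTwist (UTQ.natCast_eq_zero n p q),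
      UTQ.hopf_comul n p q η⟩
  · exact fun hp2 hη => UTQ.hopf_not_isCocommutative n p q hp2 hη
  · exact UTQ.hopf_comul_injective n p q
  · exact UTQ.exists_not_commute n p q hn
  · exact UTQ.finrank_eq n p q

end
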